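/- **Model and estimator.** Let $\mathcal I=[s,t]$ be a compact interval with $s<t$, and write $\|\psi\|^2=\int_{\mathcal I}\psi^2$. Let $X_1,X_2,\dots$ be independent and identically distributed random functions on $\mathcal I$ (random elements of $L^2(\mathcal I)$) with $E\|X_1\|^2<\infty$. Let $\varepsilon_1,\varepsilon_2,\dots$ be independent and identically distributed real random variables, independent of the sequence $(X_i)$, with $E\varepsilon_1=0$ and all moments finite. For a constant $a$ and a slope function $b\in L^2(\mathcal I)$ let $Y_i=a+\int_{\mathcal I}bX_i+\varepsilon_i$. Let $\theta_1,\theta_2,\dots$ be the eigenvalues of the covariance operator of $X_1$ (the integral operator with kernel $K(u,v)=\operatorname{cov}\{X_1(u),X_1(v)\}$), where the corresponding eigenfunctions $\phi_1,\phi_2,\dots$ form an orthonormal basis of $L^2(\mathcal I)$, and let $\xi_j=\int_{\mathcal I}(X_1-EX_1)\phi_j$. For $C_1>0$ and $\beta>1$ let $$\mathcal B(C_1,\beta)=\Big\{b=\sum_{j\ge1}b_j\phi_j:\ |b_j|\le C_1j^{-\beta}\text{ for each }j\ge1\Big\}.$$ For sample size $n$ put $\bar X=n^{-1}\sum_{i\le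 n}X_i$ and $\bar Y=n^{-1}\sum_{i\le n}Y_i$. Let $(\hat\theta_j,\hat\phi_j)_{j\ge1}$, with $\hat\theta_1\ge\hat\theta_2\ge\cdots$ and with $(\hat\phi_j)$ an orthonormal basis of $L^2(\mathcal I)$ (chosen measurably), be eigenvalue and eigenfunction pairs of the integral operator with kernel $n^{-1}\sum_{i\le n}\{X_i(u)-\bar X(u)\}\{X_i(v)-\bar X(v)\}$. Let $\hat g=n^{-1}\sum_{i\le n}(X_i-\bar X)(Y_i-\bar Y)$ and, for a deterministic cut-off $m=m(n)$, $$\hat b=\sum_{j=1}^m\hat\theta_j^{-1}\Big(\int_{\mathcal I}\hat g\hat\phi_j\Big)\hat\phi_j,\qquad \tilde b=\begin{cases}\hat b,&\text{if }\|\hat b\|\le C_4n^{C_5},\\ C_3\ \text{(a constant function)},&\text{otherwise.}\end{cases}$$ (Terms with $\hat\theta_j=0$, for which $\int_{\mathcal I}\hat g\hat\phi_j=0$, are read as $0$.) **Theorem 4.1.** Let $C,C_1,\dots,C_5>0$, $\alpha>1$, $\beta\ge\alpha+2$ and $\gamma>\tfrac12$. Assume the following. 1. $C^{-1}j^{-\alpha}\le\theta_j\le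 Cj^{-\alpha}$ and $\theta_j-\theta_{j+1}\ge C^{-1}j^{-\alpha-1}$ for all $j\ge1$. 2. For each integer $r\ge2$ there is a constant $C(r)$, not depending on $j$, with $E|\xi_j|^{2r}\le C(r)\theta_j^r$ for all $j\ge1$. For any $j_1,\dots,j_4$, $E(\xi_{j_1}\xi_{j_2}\xi_{j_3}\xi_{j_4})=0$ unless each index $j_k$ is repeated, that is, whenever some index occurs exactly once among $j_1,\dots,j_4$. 3. $x=\sum_{j\ge1}x_j\phi_j\in L^2(\mathcal I)$ is a fixed function with $|x_j|\le C_2j^{-\gamma}$ for each $j\ge1$. 4. The ratio of $m$ to $m_0$ is bounded away from zero and infinity as $n\to\infty$, where $$m_0=\begin{cases}n^{1/\{2(\beta+\gamma-1)\}},&\text{if }\alpha+1<2\gamma,\\ (n/\log n)^{1/(\alpha+2\beta-1)},&\text{if }\alpha+1=2\gamma,\\ n^{1/(\alpha+2\beta-1)},&\text{if }\alpha+1>2\gamma.\end{cases}$$ Then, as $n\to\infty$, $$\sup_{b\in\mathcal B(C_1,\beta)}E\Big(\int_{\mathcal I}\tilde b\,x-\int_{\mathcal I}b\,x\Big)^2=O(\tau),\qquad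 \tau=\begin{cases}n^{-1},&\text{if }\alpha+1<2\gamma,\\ n^{-1}\log n,&\text{if }\alpha+1=2\gamma,\\ n^{-2(\beta+\gamma-1)/(\alpha+2\beta-1)},&\text{if }\alpha+1>2\gamma.\end{cases}$$ -/

import Mathlib

open MeasureTheory ProbabilityTheory Filter Asymptotics
open scoped ENNReal Topology

noncomputable section

namespace FLR

/-- The Hilbert space `L²(𝓘)` of square-integrable functions on the interval `𝓘 = [s, t]`, with
`inner ℝ f h = ∫_𝓘 f h` and `‖f‖² = ∫_𝓘 f²`. -/
abbrev L2 (s t : ℝ) : Type := Lp ℝ 2 (volume.restrict (Set.Icc s t))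

instance instMeasurableSpaceL2 (s t : ℝ) : MeasurableSpace (L2 s t) := borel _

instance instBorelSpaceL2 (s t : ℝ) : BorelSpace (L2 s t) := ⟨rfl⟩

variable {s t : ℝ} {Ω : Type*}

/-- Covariance operator of the random function `X`: the integral operator whose kernel is
`K(u, v) = cov {X(u), X(v)}`, that is `f ↦ E [(∫ (X - E X) f) (X - E X)]`. -/
def covOp [MeasurableSpace Ω] (P : Measure Ω) (X : Ω → L2 s t) (f : L2 s t) : L2 s t :=
  ∫ ω, inner ℝ (X ω - ∫ ω', X ω' ∂P) f • (X ω - ∫ ω', X ω' ∂P) ∂P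

/-- `ξ_j = ∫ (X - E X) φ_j`. Basis elements are numbered from `0`, so that the index `j : ℕ` of the
code is the index `j + 1` of the usual numbering; the same holds for eigenvalues below. -/
def score [MeasurableSpace Ω] (P : Measure Ω) (X : Ω → L2 s t) (φ : HilbertBasis ℕ ℝ (L2 s t))
    (j : ℕ) (ω : Ω) : ℝ :=
  inner ℝ (X ω - ∫ ω', X ω' ∂P) (φ j)

/-- The smoothness class of all `b = ∑ b_j φ_j` with `|b_j| ≤ C₁ j ^ (-β)` for `j ≥ 1`. -/
def smoothClass (φ : HilbertBasis ℕ ℝ (L2 s t)) (C₁ β : ℝ) : Set (L2 s t) :=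
  {b | ∀ j : ℕ, |inner ℝ b (φ j)| ≤ C₁ * ((j : ℝ) + 1) ^ (-β)}

/-- The response `Y_i = a + ∫ b X_i + ε_i`. -/
def response (a : ℝ) (b : L2 s t) (X : ℕ → Ω → L2 s t) (ε : ℕ → Ω → ℝ) (i : ℕ) (ω : Ω) : ℝ :=
  a + inner ℝ b (X i ω) + ε i ω

/-- The mean of the first `n` observations `Z_0, …, Z_{n-1}`. -/
def sampleMean {E : Type*} [AddCommGroup E] [Module ℝ E] (Z : ℕ → Ω → E) (n : ℕ) (ω : Ω) : E :=
  (n : ℝ)⁻¹ • ∑ i ∈ Finset.range n, Z i ω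

/-- The empirical covariance operator, with kernel
`n⁻¹ ∑ {X_i(u) - X̄(u)} {X_i(v) - X̄(v)}`. -/
def empCovOp (X : ℕ → Ω → L2 s t) (n : ℕ) (ω : Ω) (f : L2 s t) : L2 s t :=
  (n : ℝ)⁻¹ • ∑ i ∈ Finset.range n,
    inner ℝ (X i ω - sampleMean X n ω) f • (X i ω - sampleMean X n ω)

/-- `ĝ = n⁻¹ ∑ (Y_i - Ȳ) (X_i - X̄)`. -/
def gHat (X : ℕ → Ω → L2 s t) (Y : ℕ → Ω → ℝ) (n : ℕ) (ω : Ω) : L2 s t :=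
  (n : ℝ)⁻¹ • ∑ i ∈ Finset.range n,
    (Y i ω - sampleMean Y n ω) • (X i ω - sampleMean X n ω)

/-- For each sample size `n`, `(θ' n, φ' n)` is a spectral decomposition of the empirical covariance
operator: an orthonormal basis of eigenfunctions (chosen measurably), the corresponding eigenvalues
being in non-increasing order. -/
structure IsEmpEigensystem [MeasurableSpace Ω] (X : ℕ → Ω → L2 s t)
    (θ' : ℕ → Ω → ℕ → ℝ) (φ' : ℕ → Ω → HilbertBasis ℕ ℝ (L2 s t)) : Prop where
  antitone : ∀ n ω, Antitone (θ' n ω)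
  eigen : ∀ n ω j, empCovOp X n ω (φ' n ω j) = θ' n ω j • φ' n ω j
  measurable : ∀ n j, Measurable fun ω => φ' n ω j

/-- The principal components estimator `b̂ = ∑_{j ≤ m} θ̂_j⁻¹ ĝ_j φ̂_j`, `ĝ_j = ∫ ĝ φ̂_j`. If
`θ̂_j = 0` then `ĝ_j = 0`, and the term is `0`. -/
def bHat (X : ℕ → Ω → L2 s t) (Y : ℕ → Ω → ℝ) (θ' : ℕ → Ω → ℕ → ℝ)
    (φ' : ℕ → Ω → HilbertBasis ℕ ℝ (L2 s t)) (m n : ℕ) (ω : Ω) : L2 s t :=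
  ∑ j ∈ Finset.range m, ((θ' n ω j)⁻¹ * inner ℝ (gHat X Y n ω) (φ' n ω j)) • φ' n ω j

open Classical in
/-- The truncated estimator: `b̂` if `‖b̂‖ ≤ C₄ n ^ C₅`, and the constant function `C₃` otherwise. -/
def bTilde (C₃ C₄ C₅ : ℝ) (X : ℕ → Ω → L2 s t) (Y : ℕ → Ω → ℝ) (θ' : ℕ → Ω → ℕ → ℝ)
    (φ' : ℕ → Ω → HilbertBasis ℕ ℝ (L2 s t)) (m n : ℕ) (ω : Ω) : L2 s t :=
  if ‖bHat X Y θ' φ' m n ω‖ ≤ C₄ * (n : ℝ) ^ C₅ then bHat X Y θ' φ' m n ω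
  else Lp.const 2 (volume.restrict (Set.Icc s t)) C₃

open Classical in
/-- The order of magnitude of the frequency cut-off. -/
def mZero (α β γ : ℝ) (n : ℕ) : ℝ :=
  if α + 1 < 2 * γ then (n : ℝ) ^ (1 / (2 * (β + γ - 1)))
  else if α + 1 = 2 * γ then ((n : ℝ) / Real.log n) ^ (1 / (α + 2 * β - 1))
  else (n : ℝ) ^ (1 / (α + 2 * β - 1))

open Classical in
/-- The rate of convergence. -/
def tau (α β γ : ℝ) (n : ℕ) : ℝ :=
  if α + 1 < 2 * γ then (n : ℝ)⁻¹
  else if α + 1 = 2 * γ then (n : ℝ)⁻¹ * Real.log n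
  else (n : ℝ) ^ (-2 * (β + γ - 1) / (α + 2 * β - 1))

end FLR

end

/-!
Write `ζ` for a weighted Hilbert–Schmidt distance between the empirical and the population
covariance operator: the entry `(l, k)` in the basis `φ` is divided by `t l * t k`, where
`t k = (k + 1) ^ (-(α - 1) / 4)`. The entry itself has a standard deviation of order
`√(θ l * θ k / n)`, and `∑ θ k / t k ^ 2` converges, so that every moment of `ζ ^ 2` is of the
parametric order (`IsSample.exists_empDist_moments`). Hence `ζ ^ 2 ≤ n ^ (-11 / 12)` outside an
event whose probability is smaller than any power of `n`; there the norm constraint in the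
definition of the estimator suffices. On the main event the condition `β ≥ α + 2` makes
`m ^ (3 * (α + 1)) = O(n)`, and `ζ` is then smaller than all the gaps around the first `m`
eigenvalues.

On that event `ĝ` is the empirical covariance operator applied to `b`, plus a noise vector, so the
error splits into three parts.

* The tail of `∑ b_j x_j` beyond `m` is of order `m ^ (-(β + γ - 1))`.
* Replacing the eigenvectors `φ j` by the empirical ones in the partial sum of `∑ b_j x_j` costs
  `O(ζ)`, hence `O(1 / n)` in mean square (`exists_bias_bound`). No expansion is needed: if `B` is
  the empirical operator and `(η j, ψ j)` are its eigenpairs, the exact relation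
  `(η j - θ k) ⟪ψ j, φ k⟫ = ⟪ψ j, (B - θ k) φ k⟫` and Weyl's inequality bound the coefficients of an
  empirical eigenvector by those of the first-order approximation. The terms of second order in `ζ`
  add up to `ζ ^ 2 * m ^ (α + 3 / 2) = O(ζ)`. Among those of first order, the ones for `x` are
  summable because `b` decays fast, and the ones for `b` are bounded, by the Cauchy–Schwarz
  inequality, through the square norms of the rows of the perturbation, whose sum is at most
  `ζ ^ 2`, the complementary factor being square-summable as `γ > 1 / 2`.
* Given the design, the noise contributes the variance `σ² / n * ∑ ⟪x, ψ j⟫ ^ 2 / η j`, which is of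
  the order of `∑ j ^ (α - 2 * γ) / n` up to `O(ζ ^ 2)` (`exists_variance_bound`).

Where the norm constraint is active on the main event, the noise part of the estimator has at least
unit norm, and its fourth moment, of order `(m ^ (α + 1) / n) ^ 2 = O(1 / n)`, bounds the error.

The noise terms are integrated conditionally on the design. This needs the empirical truncated
inverse to be a measurable function of the design alone. It is one on the event that the cut-off
separates the spectrum, where it is a limit of polynomials in the empirical covariance operator
(`exists_measurable_truncInv`).
-/

noncomputable section

namespace FLR

/-! ### Series and power sums -/

lemma summable_mul_of_sq {ι : Type*} {f g : ι → ℝ} (hf : Summable fun i => f i ^ 2)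
    (hg : Summable fun i => g i ^ 2) : Summable fun i => f i * g i := by
  refine Summable.of_norm_bounded (hf.add hg) fun i => ?_
  rw [Real.norm_eq_abs, abs_le]
  constructor <;> nlinarith [sq_nonneg (f i + g i), sq_nonneg (f i - g i), sq_nonneg (f i),
    sq_nonneg (g i)]

lemma tsum_mul_sq_le {ι : Type*} {f g : ι → ℝ} (hf : Summable fun i => f i ^ 2)
    (hg : Summable fun i => g i ^ 2) :
    (∑' i, f i * g i) ^ 2 ≤ (∑' i, f i ^ 2) * ∑' i, g i ^ 2 := by
  have h := summable_mul_of_sq hf hg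
  refine le_of_tendsto_of_tendsto (Tendsto.pow h.hasSum 2)
    (Tendsto.mul (f := fun s : Finset ι => ∑ i ∈ s, f i ^ 2) hf.hasSum hg.hasSum)
    (Eventually.of_forall fun s => ?_)
  exact Finset.sum_mul_sq_le_sq_mul_sq s f g

lemma one_le_cast_add_one (j : ℕ) : (1 : ℝ) ≤ (j : ℝ) + 1 := by
  have : (0 : ℝ) ≤ j := j.cast_nonneg
  linarith

lemma cast_add_one_pos (j : ℕ) : (0 : ℝ) < (j : ℝ) + 1 := by positivity

lemma summable_add_one_rpow {r : ℝ} (hr : r < -1) : Summable fun j : ℕ => ((j : ℝ) + 1) ^ r := by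
  have h := (summable_nat_add_iff 1).2 (Real.summable_nat_rpow.2 hr)
  simpa using h

lemma sum_add_one_rpow_le {r : ℝ} (hr : 0 ≤ r) (m : ℕ) :
    ∑ j ∈ Finset.range m, ((j : ℝ) + 1) ^ r ≤ (m : ℝ) ^ (r + 1) := by
  rcases Nat.eq_zero_or_pos m with rfl | hm
  · simp [Real.zero_rpow (by linarith : r + 1 ≠ 0)]
  · have hm' : (0 : ℝ) < m := by exact_mod_cast hm
    calc ∑ j ∈ Finset.range m, ((j : ℝ) + 1) ^ r ≤ ∑ j ∈ Finset.range m, (m : ℝ) ^ r := by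
          refine Finset.sum_le_sum fun j hj => ?_
          have : j + 1 ≤ m := Finset.mem_range.1 hj
          exact Real.rpow_le_rpow (by positivity) (by exact_mod_cast this) hr
      _ = (m : ℝ) ^ (r + 1) := by
          rw [Finset.sum_const, Finset.card_range, nsmul_eq_mul, Real.rpow_add_one hm'.ne', mul_comm]

/-- The bound for the reciprocals of the squared distances of `j` to the other integers; the term
`k = j` vanishes as `1 / 0 = 0`. -/
lemma exists_tsum_inv_sub_sq_le : ∃ S : ℝ, ∀ j : ℕ,
    Summable (fun k : ℕ => 1 / ((k : ℝ) - j) ^ 2) ∧ ∑' k : ℕ, 1 / ((k : ℝ) - j) ^ 2 ≤ S := by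
  have hs : Summable fun n : ℤ => 1 / (n : ℝ) ^ 2 := Real.summable_one_div_int_pow.2 (by norm_num)
  refine ⟨∑' n : ℤ, 1 / (n : ℝ) ^ 2, fun j => ?_⟩
  have hinj : Function.Injective fun k : ℕ => (k : ℤ) - j := fun a b h => by
    simpa using h
  have he : (fun k : ℕ => 1 / ((k : ℝ) - j) ^ 2) =
      (fun n : ℤ => 1 / (n : ℝ) ^ 2) ∘ fun k : ℕ => (k : ℤ) - j := by
    ext k; simp
  rw [he]
  exact ⟨hs.comp_injective hinj, tsum_comp_le_tsum_of_inj hs (fun _ => by positivity) hinj⟩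

/-! ### Eigenvalue gaps -/

lemma antitone_of_gap {θ : ℕ → ℝ} {C α : ℝ} (hC : 0 < C)
    (hgap : ∀ j : ℕ, C⁻¹ * ((j : ℝ) + 1) ^ (-α - 1) ≤ θ j - θ (j + 1)) : Antitone θ := by
  refine antitone_nat_of_succ_le fun j => ?_
  have h1 := hgap j
  have : 0 ≤ C⁻¹ * ((j : ℝ) + 1) ^ (-α - 1) := by positivity
  linarith

/-- For `k ≤ 2 * j + 1` all the spacings between `j` and `k` are of the order of the one at `j`. -/
lemma gap_near {θ : ℕ → ℝ} {C α : ℝ} (hC : 0 < C) (hα : 0 < α)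
    (hgap : ∀ j : ℕ, C⁻¹ * ((j : ℝ) + 1) ^ (-α - 1) ≤ θ j - θ (j + 1)) {j k : ℕ} (hjk : j ≤ k)
    (hk : k ≤ 2 * j + 1) :
    C⁻¹ * 2 ^ (-α - 1) * (((k : ℝ) - j) * ((j : ℝ) + 1) ^ (-α - 1)) ≤ θ j - θ k := by
  have h1 : θ j - θ k = ∑ i ∈ Finset.Ico j k, (θ i - θ (i + 1)) := by
    have := Finset.sum_Ico_sub (fun i => - θ i) hjk
    simp only [neg_sub_neg] at this
    linarith
  rw [h1]
  have h2 : ∀ i ∈ Finset.Ico j k, C⁻¹ * (2 ^ (-α - 1) * ((j : ℝ) + 1) ^ (-α - 1))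
      ≤ θ i - θ (i + 1) := by
    intro i hi
    refine le_trans ?_ (hgap i)
    rw [← Real.mul_rpow (by norm_num) (by positivity)]
    have hi' : i + 1 ≤ 2 * (j + 1) := by have := Finset.mem_Ico.1 hi; omega
    refine mul_le_mul_of_nonneg_left ?_ (by positivity)
    exact Real.rpow_le_rpow_of_nonpos (by positivity) (by exact_mod_cast hi') (by linarith)
  have h3 := Finset.card_nsmul_le_sum _ _ _ h2
  rw [Nat.card_Ico, nsmul_eq_mul, Nat.cast_sub hjk] at h3
  linarith

/-- Uniform lower bound for the distance between two eigenvalues, near or far from each other. -/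
lemma gap_lower {θ : ℕ → ℝ} {C α : ℝ} (hC : 0 < C) (hα : 0 < α)
    (hgap : ∀ j : ℕ, C⁻¹ * ((j : ℝ) + 1) ^ (-α - 1) ≤ θ j - θ (j + 1)) {j k : ℕ} (hjk : j < k) :
    C⁻¹ * 2 ^ (-α - 1) / 2 * (((k : ℝ) - j) / (((k : ℝ) + 1) * ((j : ℝ) + 1) ^ α)) ≤ θ j - θ k := by
  set c := C⁻¹ * 2 ^ (-α - 1) with hc
  have hc0 : 0 < c := by positivity
  have hJ : (0 : ℝ) < (j : ℝ) + 1 := by positivity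
  have hK : (0 : ℝ) < (k : ℝ) + 1 := by positivity
  have hjk' : (j : ℝ) + 1 ≤ k := by exact_mod_cast hjk
  have hpow : ((j : ℝ) + 1) ^ (-α - 1) = 1 / (((j : ℝ) + 1) * ((j : ℝ) + 1) ^ α) := by
    rw [Real.rpow_sub hJ, Real.rpow_neg hJ.le, Real.rpow_one]
    field_simp
  rcases le_total k (2 * j + 1) with hk | hk
  · refine le_trans ?_ (gap_near hC hα hgap hjk.le hk)
    rw [hpow, ← hc]
    have : ((k : ℝ) - j) / (((k : ℝ) + 1) * ((j : ℝ) + 1) ^ α)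
        ≤ ((k : ℝ) - j) * (1 / (((j : ℝ) + 1) * ((j : ℝ) + 1) ^ α)) := by
      rw [mul_one_div]
      apply div_le_div_of_nonneg_left (by linarith) (by positivity)
      exact mul_le_mul_of_nonneg_right (by linarith) (by positivity)
    have h0 : 0 ≤ ((k : ℝ) - j) / (((k : ℝ) + 1) * ((j : ℝ) + 1) ^ α) :=
      div_nonneg (by linarith) (by positivity)
    nlinarith
  · have h1 := gap_near hC hα hgap (show j ≤ 2 * j + 1 by omega) le_rfl
    have h2 : θ k ≤ θ (2 * j + 1) := antitone_of_gap hC hgap hk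
    have h3 : c / 2 * (((k : ℝ) - j) / (((k : ℝ) + 1) * ((j : ℝ) + 1) ^ α))
        ≤ c * (((2 * j + 1 : ℕ) - (j : ℝ)) * ((j : ℝ) + 1) ^ (-α - 1)) := by
      rw [hpow]
      have e1 : ((2 * j + 1 : ℕ) - (j : ℝ)) * (1 / (((j : ℝ) + 1) * ((j : ℝ) + 1) ^ α))
          = 1 / ((j : ℝ) + 1) ^ α := by
        push_cast; field_simp; ring
      rw [e1]
      have e2 : ((k : ℝ) - j) / (((k : ℝ) + 1) * ((j : ℝ) + 1) ^ α) ≤ 1 / ((j : ℝ) + 1) ^ α := by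
        rw [div_le_div_iff₀ (by positivity) (by positivity)]
        nlinarith [show 0 < ((j : ℝ) + 1) ^ α by positivity]
      have e3 : 0 ≤ 1 / ((j : ℝ) + 1) ^ α := by positivity
      nlinarith
    linarith

/-- An eigenvalue is at distance of order at least `j ^ (-α - 1)` from all others. -/
lemma gap_isolated {θ : ℕ → ℝ} {C α : ℝ} (hC : 0 < C) (hα : 0 < α)
    (hgap : ∀ j : ℕ, C⁻¹ * ((j : ℝ) + 1) ^ (-α - 1) ≤ θ j - θ (j + 1)) {j k : ℕ} (hjk : k ≠ j) :
    C⁻¹ * ((j : ℝ) + 1) ^ (-α - 1) ≤ |θ j - θ k| := by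
  have hanti := antitone_of_gap hC hgap
  rcases lt_or_gt_of_ne hjk with h | h
  · have h1 : θ j ≤ θ (k + 1) := hanti h
    have h2 : C⁻¹ * ((j : ℝ) + 1) ^ (-α - 1) ≤ C⁻¹ * ((k : ℝ) + 1) ^ (-α - 1) := by
      refine mul_le_mul_of_nonneg_left ?_ (by positivity)
      have : (k : ℝ) + 1 ≤ j := by exact_mod_cast h
      exact Real.rpow_le_rpow_of_nonpos (by positivity) (by linarith) (by linarith)
    rw [abs_sub_comm]
    exact le_trans (by linarith [hgap k]) (le_abs_self _)
  · have h1 : θ k ≤ θ (j + 1) := hanti h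
    exact le_trans (by linarith [hgap j]) (le_abs_self _)

set_option maxHeartbeats 400000 in
/-- The summand of `exists_weighted_gap_sum`, bounded by a summable kernel. -/
lemma weighted_gap_term {θ : ℕ → ℝ} {C α p ρ c : ℝ} (hC : 0 < C) (hα : 1 < α) (hp : 0 < p)
    (hgap : ∀ j : ℕ, C⁻¹ * ((j : ℝ) + 1) ^ (-α - 1) ≤ θ j - θ (j + 1)) (hρ : 1 ≤ 2 * ρ)
    (hc : c = C⁻¹ * 2 ^ (-α - 1) / 2) {j k : ℕ} (hjk : k ≠ j) :
    (((k : ℝ) + 1) ^ (-p) * ((k : ℝ) + 1) ^ (-ρ) / (θ j - θ k)) ^ 2 ≤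
      c⁻¹ ^ 2 * 2 * ((1 + ((j : ℝ) + 1) ^ (2 * α + 2 - 2 * ρ)) *
        (((k : ℝ) + 1) ^ (-2 : ℝ) + 1 / ((k : ℝ) - j) ^ 2 + ((k : ℝ) + 1) ^ (-1 - 2 * p))) := by
  have hc0 : 0 < c := by rw [hc]; positivity
  set J : ℝ := (j : ℝ) + 1 with hJdef
  set K : ℝ := (k : ℝ) + 1 with hKdef
  have hJ1 : 1 ≤ J := one_le_cast_add_one j
  have hK1 : 1 ≤ K := one_le_cast_add_one k
  have hJ : 0 < J := by linarith
  have hK : 0 < K := by linarith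
  have hd : (k : ℝ) - j = K - J := by simp [hJdef, hKdef]
  rw [hd]
  have sq1 : (K ^ (-p) * K ^ (-ρ)) ^ 2 = K ^ (-2 * p - 2 * ρ) := by
    rw [← Real.rpow_add hK, ← Real.rpow_natCast, ← Real.rpow_mul hK.le]; congr 1; push_cast; ring
  rw [div_pow, sq1]
  have hA : 0 ≤ K ^ (-2 : ℝ) := by positivity
  have hB : 0 ≤ 1 / (K - J) ^ 2 := by positivity
  have hD : 0 ≤ K ^ (-1 - 2 * p) := by positivity
  have hE : 0 ≤ J ^ (2 * α + 2 - 2 * ρ) := by positivity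
  rcases lt_or_gt_of_ne hjk with h | h
  · -- as `J / (J - K) = 1 + K / (J - K)`, the power of `J` is traded for one of `K`
    have hKJ : K + 1 ≤ J := by
      have : (k : ℝ) + 1 ≤ j := by exact_mod_cast h
      simp only [hJdef, hKdef]; linarith
    have hg := gap_lower hC (by linarith) hgap h
    rw [← hc, ← hJdef, ← hKdef] at hg
    have hg0 : 0 < c * (((j : ℝ) - k) / (J * K ^ α)) := by
      have : 0 < (j : ℝ) - k := by simp only [hJdef, hKdef] at hKJ; linarith
      positivity
    have hjkJ : (j : ℝ) - k = J - K := by simp [hJdef, hKdef]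
    rw [hjkJ] at hg hg0
    have h1 : (c * ((J - K) / (J * K ^ α))) ^ 2 ≤ (θ j - θ k) ^ 2 := by
      have : (θ j - θ k) ^ 2 = (θ k - θ j) ^ 2 := by ring
      rw [this]
      exact pow_le_pow_left₀ hg0.le hg 2
    have hJK : 0 < J - K := by linarith
    have h2 : K ^ (-2 * p - 2 * ρ) / (θ j - θ k) ^ 2
        ≤ K ^ (-2 * p - 2 * ρ) / (c * ((J - K) / (J * K ^ α))) ^ 2 :=
      div_le_div_of_nonneg_left (by positivity) (by positivity) h1
    refine h2.trans ?_
    have h3 : K ^ (-2 * p - 2 * ρ) / (c * ((J - K) / (J * K ^ α))) ^ 2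
        = c⁻¹ ^ 2 * (K ^ (2 * α - 2 * p - 2 * ρ) * (J / (J - K)) ^ 2) := by
      have : K ^ (2 * α - 2 * p - 2 * ρ) = K ^ (-2 * p - 2 * ρ) * (K ^ α) ^ 2 := by
        rw [← Real.rpow_natCast, ← Real.rpow_mul hK.le, ← Real.rpow_add hK]; congr 1; push_cast; ring
      rw [this]; field_simp
    rw [h3, mul_assoc (c⁻¹ ^ 2)]
    refine mul_le_mul_of_nonneg_left ?_ (by positivity)
    have h4 : (J / (J - K)) ^ 2 ≤ 2 + 2 * (K ^ 2 / (K - J) ^ 2) := by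
      have e1 : J / (J - K) = 1 + K / (J - K) := by field_simp; ring
      have e2 : K ^ 2 / (K - J) ^ 2 = (K / (J - K)) ^ 2 := by
        rw [div_pow]; congr 1; ring
      rw [e1, e2]; linarith [sq_nonneg (1 - K / (J - K))]
    have h5 : K ^ (2 * α - 2 * p - 2 * ρ) * K ^ 2 ≤ 1 + J ^ (2 * α + 2 - 2 * ρ) := by
      have e : K ^ (2 * α - 2 * p - 2 * ρ) * K ^ 2 = K ^ (2 * α + 2 - 2 * ρ - 2 * p) := by
        rw [← Real.rpow_natCast, ← Real.rpow_add hK]; congr 1; push_cast; ring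
      rw [e]
      have e1 : K ^ (2 * α + 2 - 2 * ρ - 2 * p) ≤ K ^ (2 * α + 2 - 2 * ρ) :=
        Real.rpow_le_rpow_of_exponent_le hK1 (by linarith)
      rcases le_total 0 (2 * α + 2 - 2 * ρ) with hs | hs
      · have := Real.rpow_le_rpow hK.le (by linarith : K ≤ J) hs
        linarith
      · have := Real.rpow_le_one_of_one_le_of_nonpos hK1 hs
        linarith
    have h6 : K ^ (2 * α - 2 * p - 2 * ρ) =
        (K ^ (2 * α - 2 * p - 2 * ρ) * K ^ 2) * K ^ (-2 : ℝ) := by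
      rw [mul_assoc, ← Real.rpow_natCast, ← Real.rpow_add hK]; norm_num
    calc K ^ (2 * α - 2 * p - 2 * ρ) * (J / (J - K)) ^ 2
        ≤ K ^ (2 * α - 2 * p - 2 * ρ) * (2 + 2 * (K ^ 2 / (K - J) ^ 2)) :=
          mul_le_mul_of_nonneg_left h4 (by positivity)
      _ = 2 * ((K ^ (2 * α - 2 * p - 2 * ρ) * K ^ 2) * K ^ (-2 : ℝ) +
            (K ^ (2 * α - 2 * p - 2 * ρ) * K ^ 2) * (1 / (K - J) ^ 2)) := by
          rw [mul_add, mul_comm _ (2 : ℝ)]; nth_rewrite 1 [h6]; ring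
      _ ≤ 2 * ((1 + J ^ (2 * α + 2 - 2 * ρ)) * K ^ (-2 : ℝ) +
            (1 + J ^ (2 * α + 2 - 2 * ρ)) * (1 / (K - J) ^ 2)) := by
          gcongr
      _ ≤ _ := by nlinarith [mul_nonneg (add_nonneg zero_le_one hE) hD]
  · -- likewise `K / (K - J) = 1 + J / (K - J)`
    have hKJ : J + 1 ≤ K := by
      have : (j : ℝ) + 1 ≤ k := by exact_mod_cast h
      simp only [hJdef, hKdef]; linarith
    have hJK : 0 < K - J := by linarith
    have hg := gap_lower hC (by linarith) hgap h
    rw [← hc, ← hJdef, ← hKdef, hd] at hg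
    have hg0 : 0 < c * ((K - J) / (K * J ^ α)) := by positivity
    have h1 : (c * ((K - J) / (K * J ^ α))) ^ 2 ≤ (θ j - θ k) ^ 2 := pow_le_pow_left₀ hg0.le hg 2
    have h2 : K ^ (-2 * p - 2 * ρ) / (θ j - θ k) ^ 2
        ≤ K ^ (-2 * p - 2 * ρ) / (c * ((K - J) / (K * J ^ α))) ^ 2 :=
      div_le_div_of_nonneg_left (by positivity) (by positivity) h1
    refine h2.trans ?_
    have h3 : K ^ (-2 * p - 2 * ρ) / (c * ((K - J) / (K * J ^ α))) ^ 2
        = c⁻¹ ^ 2 * (J ^ (2 * α) * K ^ (-2 * p - 2 * ρ) * (K / (K - J)) ^ 2) := by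
      have : J ^ (2 * α) = (J ^ α) ^ 2 := by
        rw [← Real.rpow_natCast, ← Real.rpow_mul hJ.le]; congr 1; push_cast; ring
      rw [this]; field_simp
    rw [h3, mul_assoc (c⁻¹ ^ 2)]
    refine mul_le_mul_of_nonneg_left ?_ (by positivity)
    have h4 : (K / (K - J)) ^ 2 ≤ 2 + 2 * (J ^ 2 / (K - J) ^ 2) := by
      have e1 : K / (K - J) = 1 + J / (K - J) := by field_simp; ring
      have e2 : J ^ 2 / (K - J) ^ 2 = (J / (K - J)) ^ 2 := (div_pow _ _ _).symm
      rw [e1, e2]; linarith [sq_nonneg (1 - J / (K - J))]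
    have h5 : J ^ (2 * α) * K ^ (-2 * p - 2 * ρ) ≤ J ^ (2 * α + 2 - 2 * ρ) * K ^ (-1 - 2 * p) := by
      have e : K ^ (-2 * p - 2 * ρ) = K ^ (1 - 2 * ρ) * K ^ (-1 - 2 * p) := by
        rw [← Real.rpow_add hK]; congr 1; ring
      rw [e, ← mul_assoc]
      refine mul_le_mul_of_nonneg_right ?_ hD
      calc J ^ (2 * α) * K ^ (1 - 2 * ρ) ≤ J ^ (2 * α) * J ^ (1 - 2 * ρ) :=
            mul_le_mul_of_nonneg_left
              (Real.rpow_le_rpow_of_nonpos hJ (by linarith) (by linarith)) (by positivity)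
        _ = J ^ (2 * α + 1 - 2 * ρ) := by rw [← Real.rpow_add hJ]; congr 1; ring
        _ ≤ _ := Real.rpow_le_rpow_of_exponent_le hJ1 (by linarith)
    have h6 : J ^ (2 * α) * K ^ (-2 * p - 2 * ρ) * J ^ 2 ≤ J ^ (2 * α + 2 - 2 * ρ) := by
      calc J ^ (2 * α) * K ^ (-2 * p - 2 * ρ) * J ^ 2
          ≤ J ^ (2 * α) * J ^ (-2 * p - 2 * ρ) * J ^ 2 := by
            gcongr ?_ * _
            exact mul_le_mul_of_nonneg_left
              (Real.rpow_le_rpow_of_nonpos hJ (by linarith) (by linarith)) (by positivity)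
        _ = J ^ (2 * α + 2 - 2 * ρ - 2 * p) := by
            rw [← Real.rpow_natCast, ← Real.rpow_add hJ, ← Real.rpow_add hJ]
            congr 1; push_cast; ring
        _ ≤ _ := Real.rpow_le_rpow_of_exponent_le hJ1 (by linarith)
    calc J ^ (2 * α) * K ^ (-2 * p - 2 * ρ) * (K / (K - J)) ^ 2
        ≤ J ^ (2 * α) * K ^ (-2 * p - 2 * ρ) * (2 + 2 * (J ^ 2 / (K - J) ^ 2)) :=
          mul_le_mul_of_nonneg_left h4 (by positivity)
      _ = 2 * (J ^ (2 * α) * K ^ (-2 * p - 2 * ρ) +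
            (J ^ (2 * α) * K ^ (-2 * p - 2 * ρ) * J ^ 2) * (1 / (K - J) ^ 2)) := by ring
      _ ≤ 2 * (J ^ (2 * α + 2 - 2 * ρ) * K ^ (-1 - 2 * p) +
            J ^ (2 * α + 2 - 2 * ρ) * (1 / (K - J) ^ 2)) := by
          gcongr
      _ ≤ _ := by nlinarith [mul_nonneg hE hA]

/-- The series that governs the influence of the coefficients `f k`, of order `k ^ (-ρ)`, on the
`j`-th empirical coefficient. The term `k = j` vanishes as division by zero gives zero. -/
lemma exists_weighted_gap_sum {θ : ℕ → ℝ} {C α p ρ : ℝ} (hC : 0 < C) (hα : 1 < α) (hp : 0 < p)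
    (hgap : ∀ j : ℕ, C⁻¹ * ((j : ℝ) + 1) ^ (-α - 1) ≤ θ j - θ (j + 1)) (hρ : 1 ≤ 2 * ρ) (Cf : ℝ) :
    ∃ S : ℝ, 0 ≤ S ∧ ∀ f : ℕ → ℝ, (∀ k : ℕ, |f k| ≤ Cf * ((k : ℝ) + 1) ^ (-ρ)) → ∀ j : ℕ,
      Summable (fun k : ℕ => (((j : ℝ) + 1) ^ (-p) * ((k : ℝ) + 1) ^ (-p) * f k /
        (θ j - θ k)) ^ 2) ∧
      ∑' k : ℕ, (((j : ℝ) + 1) ^ (-p) * ((k : ℝ) + 1) ^ (-p) * f k / (θ j - θ k)) ^ 2 ≤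
        S * (((j : ℝ) + 1) ^ (-2 * p) * (1 + ((j : ℝ) + 1) ^ (2 * α + 2 - 2 * ρ))) := by
  obtain ⟨S₁, hS₁⟩ := exists_tsum_inv_sub_sq_le
  have hs2 : Summable fun k : ℕ => ((k : ℝ) + 1) ^ (-2 : ℝ) := summable_add_one_rpow (by norm_num)
  have hs3 : Summable fun k : ℕ => ((k : ℝ) + 1) ^ (-1 - 2 * p) :=
    summable_add_one_rpow (by linarith)
  set S₂ := ∑' k : ℕ, ((k : ℝ) + 1) ^ (-2 : ℝ)
  set S₃ := ∑' k : ℕ, ((k : ℝ) + 1) ^ (-1 - 2 * p)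
  set c := C⁻¹ * 2 ^ (-α - 1) / 2 with hc
  have hS1 : 0 ≤ S₁ := (tsum_nonneg fun _ => one_div_nonneg.2 (sq_nonneg _)).trans (hS₁ 0).2
  have hS2 : 0 ≤ S₂ := tsum_nonneg fun k => Real.rpow_nonneg (cast_add_one_pos k).le _
  have hS3 : 0 ≤ S₃ := tsum_nonneg fun k => Real.rpow_nonneg (cast_add_one_pos k).le _
  refine ⟨Cf ^ 2 * (c⁻¹ ^ 2 * 2) * (S₂ + S₁ + S₃), by positivity, fun f hf j => ?_⟩
  set J : ℝ := (j : ℝ) + 1 with hJdef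
  have hJ : 0 < J := by positivity
  have hbd : ∀ k : ℕ, (J ^ (-p) * ((k : ℝ) + 1) ^ (-p) * f k / (θ j - θ k)) ^ 2 ≤
      J ^ (-2 * p) * Cf ^ 2 * (c⁻¹ ^ 2 * 2 * (1 + J ^ (2 * α + 2 - 2 * ρ))) *
        (((k : ℝ) + 1) ^ (-2 : ℝ) + 1 / ((k : ℝ) - j) ^ 2 + ((k : ℝ) + 1) ^ (-1 - 2 * p)) := by
    intro k
    rcases eq_or_ne k j with rfl | hkj
    · simp only [sub_self, div_zero]
      have : (0 : ℝ) ^ 2 = 0 := by norm_num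
      rw [this]; positivity
    · have h1 := weighted_gap_term hC hα hp hgap hρ hc hkj
      have h2 : (J ^ (-p) * ((k : ℝ) + 1) ^ (-p) * f k / (θ j - θ k)) ^ 2 ≤
          J ^ (-2 * p) * Cf ^ 2 *
            (((k : ℝ) + 1) ^ (-p) * ((k : ℝ) + 1) ^ (-ρ) / (θ j - θ k)) ^ 2 := by
        have e1 : J ^ (-2 * p) = (J ^ (-p)) ^ 2 := by
          rw [← Real.rpow_natCast, ← Real.rpow_mul hJ.le]; congr 1; push_cast; ring
        have e2 : f k ^ 2 ≤ (Cf * ((k : ℝ) + 1) ^ (-ρ)) ^ 2 := by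
          rw [← sq_abs]; exact pow_le_pow_left₀ (abs_nonneg _) (hf k) 2
        rw [e1, div_pow, div_pow, ← mul_div_assoc]
        refine div_le_div_of_nonneg_right ?_ (sq_nonneg _)
        calc (J ^ (-p) * ((k : ℝ) + 1) ^ (-p) * f k) ^ 2
            = (J ^ (-p)) ^ 2 * (((k : ℝ) + 1) ^ (-p)) ^ 2 * f k ^ 2 := by ring
          _ ≤ (J ^ (-p)) ^ 2 * (((k : ℝ) + 1) ^ (-p)) ^ 2 * (Cf * ((k : ℝ) + 1) ^ (-ρ)) ^ 2 := by
              gcongr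
          _ = _ := by ring
      refine h2.trans ?_
      calc _ ≤ J ^ (-2 * p) * Cf ^ 2 * _ := mul_le_mul_of_nonneg_left h1 (by positivity)
        _ = _ := by ring
  have hsum := ((hs2.add (hS₁ j).1).add hs3).mul_left
    (J ^ (-2 * p) * Cf ^ 2 * (c⁻¹ ^ 2 * 2 * (1 + J ^ (2 * α + 2 - 2 * ρ))))
  have hsum' := Summable.of_nonneg_of_le (fun k => sq_nonneg _) hbd hsum
  refine ⟨hsum', (hsum'.tsum_le_tsum hbd hsum).trans ?_⟩
  rw [tsum_mul_left, (hs2.add (hS₁ j).1).tsum_add hs3, hs2.tsum_add (hS₁ j).1]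
  have h5 : S₂ + ∑' k : ℕ, 1 / ((k : ℝ) - j) ^ 2 + S₃ ≤ S₂ + S₁ + S₃ := by
    linarith [(hS₁ j).2]
  calc _ ≤ J ^ (-2 * p) * Cf ^ 2 * (c⁻¹ ^ 2 * 2 * (1 + J ^ (2 * α + 2 - 2 * ρ))) *
        (S₂ + S₁ + S₃) := mul_le_mul_of_nonneg_left h5 (by positivity)
    _ = _ := by ring

/-! ### Perturbation of eigenvalues -/

section Perturbation

variable {H : Type*} [NormedAddCommGroup H] [InnerProductSpace ℝ H]

lemma hasSum_inner_sq (φ : HilbertBasis ℕ ℝ H) (v : H) :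
    HasSum (fun k => inner ℝ (φ k) v ^ 2) (‖v‖ ^ 2) := by
  have h := φ.hasSum_inner_mul_inner v v
  rw [real_inner_self_eq_norm_sq] at h
  simpa only [real_inner_comm v, ← sq] using h

lemma exists_mem_span_orthogonal (φ ψ : HilbertBasis ℕ ℝ H) (j : ℕ) :
    ∃ v : H, v ≠ 0 ∧ (∀ k, j < k → inner ℝ (φ k) v = 0) ∧ ∀ i, i < j → inner ℝ (ψ i) v = 0 := by
  let L : (Fin (j + 1) → ℝ) →ₗ[ℝ] H := Fintype.linearCombination ℝ fun k : Fin (j + 1) => φ k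
  let T : (Fin (j + 1) → ℝ) →ₗ[ℝ] (Fin j → ℝ) :=
    LinearMap.pi fun i : Fin j => (innerₛₗ ℝ (ψ i)) ∘ₗ L
  have hker : T.ker ≠ ⊥ := LinearMap.ker_ne_bot_of_finrank_lt (by simp)
  obtain ⟨c, hc, hc0⟩ := (Submodule.ne_bot_iff _).1 hker
  have hli : LinearIndependent ℝ fun k : Fin (j + 1) => φ k :=
    φ.orthonormal.linearIndependent.comp _ Fin.val_injective
  refine ⟨L c, fun h => hc0 ?_, fun k hk => ?_, fun i hi => ?_⟩
  · have := Fintype.linearIndependent_iff.1 hli c (by simpa [L, Fintype.linearCombination_apply] using h)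
    exact funext this
  · simp only [L, Fintype.linearCombination_apply, inner_sum, inner_smul_right]
    refine Finset.sum_eq_zero fun i _ => ?_
    rw [φ.orthonormal.inner_eq_zero (by have := i.2; omega : k ≠ i), mul_zero]
  · exact congrFun (LinearMap.mem_ker.1 hc) ⟨i, hi⟩

lemma summable_mul_inner_sq (φ : HilbertBasis ℕ ℝ H) {θ : ℕ → ℝ} (hθ : Antitone θ)
    (hθ0 : ∀ j, 0 ≤ θ j) (v : H) : Summable fun k => θ k * inner ℝ (φ k) v ^ 2 := by
  refine Summable.of_nonneg_of_le (fun k => mul_nonneg (hθ0 k) (sq_nonneg _)) (fun k => ?_)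
    ((hasSum_inner_sq φ v).summable.mul_left (θ 0))
  exact mul_le_mul_of_nonneg_right (hθ (Nat.zero_le k)) (sq_nonneg _)

/-- **Weyl's inequality** for two diagonal quadratic forms: some nonzero `v` is spanned by the first
`j + 1` vectors of one basis and is orthogonal to the first `j` vectors of the other. -/
lemma eigenvalue_le_of_form_le (φ ψ : HilbertBasis ℕ ℝ H) {θ η : ℕ → ℝ} (hθ : Antitone θ)
    (hη : Antitone η) (hθ0 : ∀ j, 0 ≤ θ j) (hη0 : ∀ j, 0 ≤ η j) {ζ : ℝ}
    (h : ∀ v, ∑' k, θ k * inner ℝ (φ k) v ^ 2 ≤ ∑' k, η k * inner ℝ (ψ k) v ^ 2 + ζ * ‖v‖ ^ 2)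
    (j : ℕ) : θ j ≤ η j + ζ := by
  obtain ⟨v, hv0, hv1, hv2⟩ := exists_mem_span_orthogonal φ ψ j
  have h1 : θ j * ‖v‖ ^ 2 ≤ ∑' k, θ k * inner ℝ (φ k) v ^ 2 := by
    rw [← (hasSum_inner_sq φ v).tsum_eq, ← tsum_mul_left]
    refine Summable.tsum_le_tsum (fun k => ?_) ((hasSum_inner_sq φ v).summable.mul_left _)
      (summable_mul_inner_sq φ hθ hθ0 v)
    rcases le_or_gt k j with hk | hk
    · exact mul_le_mul_of_nonneg_right (hθ hk) (sq_nonneg _)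
    · simp [hv1 k hk]
  have h2 : ∑' k, η k * inner ℝ (ψ k) v ^ 2 ≤ η j * ‖v‖ ^ 2 := by
    rw [← (hasSum_inner_sq ψ v).tsum_eq, ← tsum_mul_left]
    refine Summable.tsum_le_tsum (fun k => ?_) (summable_mul_inner_sq ψ hη hη0 v)
      ((hasSum_inner_sq ψ v).summable.mul_left _)
    rcases lt_or_ge k j with hk | hk
    · simp [hv2 k hk]
    · exact mul_le_mul_of_nonneg_right (hη hk) (sq_nonneg _)
  have h3 : 0 < ‖v‖ ^ 2 := by positivity
  have h4 := h v
  nlinarith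

/-- The entries of `B - diag θ` in the basis `φ`, in units of the weights `t`. -/
def relDev (φ : HilbertBasis ℕ ℝ H) (θ t : ℕ → ℝ) (B : H →L[ℝ] H) (l k : ℕ) : ℝ :=
  inner ℝ (φ l) (B (φ k) - θ k • φ k) / (t l * t k)

/-- `B` is a positive symmetric operator with ordered eigenvalues `η` and eigenbasis `ψ`, whose
weighted Hilbert–Schmidt distance to the diagonal operator with eigenvalues `θ` and eigenbasis `φ`
is at most `ζ`. The weights `t` lie in `(0, 1]`. -/
structure IsPerturbation (φ ψ : HilbertBasis ℕ ℝ H) (θ η t : ℕ → ℝ) (B : H →L[ℝ] H) (ζ : ℝ) :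
    Prop where
  symm : ∀ u v, inner ℝ (B u) v = inner ℝ u (B v)
  nonneg : ∀ v, 0 ≤ inner ℝ (B v) v
  eigen : ∀ j, B (ψ j) = η j • ψ j
  antitone : Antitone η
  weight_pos : ∀ j, 0 < t j
  weight_le_one : ∀ j, t j ≤ 1
  nonneg_dist : 0 ≤ ζ
  summable : Summable fun q : ℕ × ℕ => relDev φ θ t B q.1 q.2 ^ 2
  tsum_le : ∑' q : ℕ × ℕ, relDev φ θ t B q.1 q.2 ^ 2 ≤ ζ ^ 2

/-- The coefficients of the `j`-th perturbed eigenvector, divided by the size of their first-order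
approximation. -/
def normCoef (φ ψ : HilbertBasis ℕ ℝ H) (θ t : ℕ → ℝ) (j k : ℕ) : ℝ :=
  inner ℝ (ψ j) (φ k) * (θ j - θ k) / (t j * t k)

/-- `M` is an isolation constant of the `j`-th eigenvalue: all other eigenvalues are at distance at
least `2 / M`, and the perturbation is no larger than a quarter of this. -/
structure Isolated (θ : ℕ → ℝ) (ζ : ℝ) (j : ℕ) (M : ℝ) : Prop where
  pos : 0 < M
  gap : ∀ k, k ≠ j → 2 ≤ M * |θ j - θ k|
  small : ζ * M ≤ 1 / 2

/-- The size of the influence of the coefficients of `f` on its `j`-th perturbed coefficient. -/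
def influence (φ : HilbertBasis ℕ ℝ H) (θ t : ℕ → ℝ) (f : H) (j : ℕ) : ℝ :=
  ∑' k, (t j * t k * inner ℝ f (φ k) / (θ j - θ k)) ^ 2

namespace IsPerturbation

variable {φ ψ : HilbertBasis ℕ ℝ H} {θ η t : ℕ → ℝ} {B : H →L[ℝ] H} {ζ : ℝ}

lemma eigenvalue_nonneg (h : IsPerturbation φ ψ θ η t B ζ) (j : ℕ) : 0 ≤ η j := by
  have := h.nonneg (ψ j)
  rwa [h.eigen, real_inner_smul_left, real_inner_self_eq_norm_sq, ψ.orthonormal.1, one_pow,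
    mul_one] at this

lemma summable_col (h : IsPerturbation φ ψ θ η t B ζ) (k : ℕ) :
    Summable fun l => relDev φ θ t B l k ^ 2 :=
  h.summable.prod_symm.prod_factor k

lemma summable_row (h : IsPerturbation φ ψ θ η t B ζ) (l : ℕ) :
    Summable fun k => relDev φ θ t B l k ^ 2 :=
  h.summable.prod_factor l

lemma summable_tsum_col (h : IsPerturbation φ ψ θ η t B ζ) :
    Summable fun k => ∑' l, relDev φ θ t B l k ^ 2 :=
  h.summable.prod_symm.prod

lemma summable_tsum_row (h : IsPerturbation φ ψ θ η t B ζ) :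
    Summable fun l => ∑' k, relDev φ θ t B l k ^ 2 :=
  h.summable.prod

lemma tsum_col_le (h : IsPerturbation φ ψ θ η t B ζ) :
    ∑' k, ∑' l, relDev φ θ t B l k ^ 2 ≤ ζ ^ 2 := by
  refine le_trans (le_of_eq ?_) h.tsum_le
  rw [← (Equiv.prodComm ℕ ℕ).tsum_eq (fun q : ℕ × ℕ => relDev φ θ t B q.1 q.2 ^ 2)]
  exact (h.summable.prod_symm.tsum_prod).symm

lemma tsum_row_le (h : IsPerturbation φ ψ θ η t B ζ) :
    ∑' l, ∑' k, relDev φ θ t B l k ^ 2 ≤ ζ ^ 2 :=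
  le_trans (le_of_eq h.summable.tsum_prod.symm) h.tsum_le

lemma inner_dev (h : IsPerturbation φ ψ θ η t B ζ) (l k : ℕ) :
    inner ℝ (φ l) (B (φ k) - θ k • φ k) = t l * (t k * relDev φ θ t B l k) := by
  have h1 := (h.weight_pos l).ne'
  have h2 := (h.weight_pos k).ne'
  rw [relDev]; field_simp

/-- The deviation in direction `φ k`, tested against `v`, is bounded by the weighted norm of `v`. -/
lemma inner_dev_sq_le (h : IsPerturbation φ ψ θ η t B ζ) (v : H) (k : ℕ) :
    Summable (fun l => (inner ℝ v (φ l) * t l) ^ 2) ∧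
    inner ℝ v (B (φ k) - θ k • φ k) ^ 2 ≤
      t k ^ 2 * (∑' l, relDev φ θ t B l k ^ 2) * ∑' l, (inner ℝ v (φ l) * t l) ^ 2 := by
  have hs : Summable fun l => (inner ℝ v (φ l) * t l) ^ 2 := by
    refine Summable.of_nonneg_of_le (fun _ => sq_nonneg _) (fun l => ?_)
      (hasSum_inner_sq φ v).summable
    rw [mul_pow, real_inner_comm]
    exact mul_le_of_le_one_right (sq_nonneg _) (pow_le_one₀ (h.weight_pos l).le (h.weight_le_one l))
  refine ⟨hs, ?_⟩
  have h1 : inner ℝ v (B (φ k) - θ k • φ k) =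
      t k * ∑' l, (inner ℝ v (φ l) * t l) * relDev φ θ t B l k := by
    rw [← φ.tsum_inner_mul_inner, ← tsum_mul_left]
    refine tsum_congr fun l => ?_
    rw [h.inner_dev]; ring
  rw [h1, mul_pow, mul_assoc]
  refine mul_le_mul_of_nonneg_left ?_ (sq_nonneg _)
  rw [mul_comm (∑' l, relDev φ θ t B l k ^ 2)]
  exact tsum_mul_sq_le hs (h.summable_col k)

lemma form_eq (h : IsPerturbation φ ψ θ η t B ζ) (v : H) :
    inner ℝ v (B v) = ∑' k, η k * inner ℝ (ψ k) v ^ 2 := by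
  rw [← ψ.tsum_inner_mul_inner]
  refine tsum_congr fun k => ?_
  rw [← h.symm, h.eigen, real_inner_smul_left, real_inner_comm]; ring

lemma abs_form_sub_le (h : IsPerturbation φ ψ θ η t B ζ) (hθ : Antitone θ) (hθ0 : ∀ j, 0 ≤ θ j)
    (v : H) : |inner ℝ v (B v) - ∑' k, θ k * inner ℝ (φ k) v ^ 2| ≤ ζ * ‖v‖ ^ 2 := by
  have hv := hasSum_inner_sq φ v
  have hdev : ∀ k, inner ℝ v (B (φ k) - θ k • φ k) ^ 2
      ≤ (∑' l, relDev φ θ t B l k ^ 2) * ‖v‖ ^ 2 := by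
    intro k
    obtain ⟨hs, h1⟩ := h.inner_dev_sq_le v k
    refine h1.trans ?_
    have h2 : ∑' l, (inner ℝ v (φ l) * t l) ^ 2 ≤ ‖v‖ ^ 2 := by
      rw [← hv.tsum_eq]
      refine hs.tsum_le_tsum (fun l => ?_) hv.summable
      rw [mul_pow, real_inner_comm]
      exact mul_le_of_le_one_right (sq_nonneg _)
        (pow_le_one₀ (h.weight_pos l).le (h.weight_le_one l))
    have h3 : 0 ≤ ∑' l, relDev φ θ t B l k ^ 2 := tsum_nonneg fun _ => sq_nonneg _
    have h4 : t k ^ 2 ≤ 1 := pow_le_one₀ (h.weight_pos k).le (h.weight_le_one k)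
    calc _ ≤ 1 * (∑' l, relDev φ θ t B l k ^ 2) * ‖v‖ ^ 2 := by gcongr
      _ = _ := by ring
  have hdevs : Summable fun k => inner ℝ v (B (φ k) - θ k • φ k) ^ 2 :=
    Summable.of_nonneg_of_le (fun _ => sq_nonneg _) hdev (h.summable_tsum_col.mul_right _)
  have hsum : ∑' k, inner ℝ v (B (φ k) - θ k • φ k) ^ 2 ≤ ζ ^ 2 * ‖v‖ ^ 2 := by
    refine (hdevs.tsum_le_tsum hdev (h.summable_tsum_col.mul_right _)).trans ?_
    rw [tsum_mul_right]
    exact mul_le_mul_of_nonneg_right h.tsum_col_le (sq_nonneg _)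
  have hB : inner ℝ v (B v) - ∑' k, θ k * inner ℝ (φ k) v ^ 2 =
      ∑' k, inner ℝ (φ k) v * inner ℝ v (B (φ k) - θ k • φ k) := by
    rw [← φ.tsum_inner_mul_inner,
      ← (φ.summable_inner_mul_inner v (B v)).tsum_sub (summable_mul_inner_sq φ hθ hθ0 v)]
    refine tsum_congr fun k => ?_
    rw [← h.symm, inner_sub_right, real_inner_smul_right, real_inner_comm v (φ k),
      real_inner_comm v (B (φ k))]
    ring
  have h5 := tsum_mul_sq_le hv.summable hdevs
  rw [← hB, hv.tsum_eq] at h5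
  have h6 : 0 ≤ ζ * ‖v‖ ^ 2 := mul_nonneg h.nonneg_dist (sq_nonneg _)
  refine abs_le_of_sq_le_sq ?_ h6
  calc _ ≤ _ := h5
    _ ≤ ‖v‖ ^ 2 * (ζ ^ 2 * ‖v‖ ^ 2) := mul_le_mul_of_nonneg_left hsum (sq_nonneg _)
    _ = _ := by ring

/-- **Weyl's inequality**: ordered eigenvalues move by no more than the size of the
perturbation. -/
lemma abs_eigenvalue_sub_le (h : IsPerturbation φ ψ θ η t B ζ) (hθ : Antitone θ)
    (hθ0 : ∀ j, 0 ≤ θ j) (j : ℕ) : |η j - θ j| ≤ ζ := by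
  have h1 : η j ≤ θ j + ζ := eigenvalue_le_of_form_le ψ φ h.antitone hθ h.eigenvalue_nonneg hθ0
    (fun v => by
      have := abs_le.1 (h.abs_form_sub_le hθ hθ0 v)
      rw [h.form_eq] at this; linarith [this.2]) j
  have h2 : θ j ≤ η j + ζ := eigenvalue_le_of_form_le φ ψ hθ h.antitone hθ0 h.eigenvalue_nonneg
    (fun v => by
      have := abs_le.1 (h.abs_form_sub_le hθ hθ0 v)
      rw [h.form_eq] at this; linarith [this.1]) j
  rw [abs_le]; constructor <;> linarith

/-! ### Perturbation of eigenvectors -/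

/-- The eigenvector equation in the coordinate `k`. It is exact, and takes the place of a
first-order expansion. -/
lemma gap_mul_inner (h : IsPerturbation φ ψ θ η t B ζ) (j k : ℕ) :
    (η j - θ k) * inner ℝ (ψ j) (φ k) = inner ℝ (ψ j) (B (φ k) - θ k • φ k) := by
  rw [inner_sub_right, ← h.symm, h.eigen, real_inner_smul_left, real_inner_smul_right]; ring

/-- Up to a factor `2`, empirical gaps are as large as the population ones. -/
lemma half_gap_le (h : IsPerturbation φ ψ θ η t B ζ) (hθ : Antitone θ) (hθ0 : ∀ j, 0 ≤ θ j)
    {j : ℕ} {M : ℝ} (hM : Isolated θ ζ j M) {k : ℕ} (hk : k ≠ j) :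
    |θ j - θ k| ≤ 2 * |η j - θ k| ∧ 1 ≤ M * |η j - θ k| := by
  have h1 := h.abs_eigenvalue_sub_le hθ hθ0 j
  have h2 : |θ j - θ k| ≤ |η j - θ j| + |η j - θ k| := by
    rw [abs_sub_comm (η j) (θ j)]; exact abs_sub_le _ _ _
  have h3 := hM.gap k hk
  have h4 := hM.small
  have h5 := hM.pos
  have h6 : ζ ≤ |θ j - θ k| / 2 := by
    by_contra hcon
    push Not at hcon
    nlinarith
  refine ⟨by linarith, ?_⟩
  have : |θ j - θ k| ≤ 2 * |η j - θ k| := by linarith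
  nlinarith

/-- The part of the perturbed eigenvector off its own direction, in the weighted norm. -/
lemma tsum_off_le (h : IsPerturbation φ ψ θ η t B ζ) (hθ : Antitone θ) (hθ0 : ∀ j, 0 ≤ θ j)
    {j : ℕ} {M : ℝ} (hM : Isolated θ ζ j M) :
    Summable (fun k => (if k = j then 0 else inner ℝ (ψ j) (φ k) * t k) ^ 2) ∧
    ∑' k, (if k = j then 0 else inner ℝ (ψ j) (φ k) * t k) ^ 2 ≤ 2 * t j ^ 2 * (ζ * M) ^ 2 ∧
    ∑' k, (inner ℝ (ψ j) (φ k) * t k) ^ 2 ≤ 2 * t j ^ 2 := by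
  have hs := (h.inner_dev_sq_le (ψ j) 0).1
  set T := ∑' k, (inner ℝ (ψ j) (φ k) * t k) ^ 2 with hT
  have hT0 : 0 ≤ T := tsum_nonneg fun _ => sq_nonneg _
  -- `T` bounds the part off `φ j` by at most `T / 4`, and can therefore be absorbed
  have hoff : ∀ k, (if k = j then 0 else inner ℝ (ψ j) (φ k) * t k) ^ 2 ≤
      (∑' l, relDev φ θ t B l k ^ 2) * (T * M ^ 2) := by
    intro k
    have hz : 0 ≤ ∑' l, relDev φ θ t B l k ^ 2 := tsum_nonneg fun _ => sq_nonneg _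
    split_ifs with hk
    · have : (0 : ℝ) ^ 2 = 0 := by norm_num
      rw [this]; positivity
    · have h1 := (h.inner_dev_sq_le (ψ j) k).2
      rw [← h.gap_mul_inner, ← hT] at h1
      have h2 := (h.half_gap_le hθ hθ0 hM hk).2
      have h3 : (1 : ℝ) ≤ M ^ 2 * (η j - θ k) ^ 2 := by
        rw [← sq_abs (η j - θ k), ← mul_pow]; exact one_le_pow₀ h2
      have h4 : t k ^ 4 ≤ 1 := pow_le_one₀ (h.weight_pos k).le (h.weight_le_one k)
      calc (inner ℝ (ψ j) (φ k) * t k) ^ 2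
          = 1 * (inner ℝ (ψ j) (φ k) ^ 2 * t k ^ 2) := by ring
        _ ≤ M ^ 2 * (η j - θ k) ^ 2 * (inner ℝ (ψ j) (φ k) ^ 2 * t k ^ 2) := by gcongr
        _ = M ^ 2 * t k ^ 2 * ((η j - θ k) * inner ℝ (ψ j) (φ k)) ^ 2 := by ring
        _ ≤ M ^ 2 * t k ^ 2 * (t k ^ 2 * (∑' l, relDev φ θ t B l k ^ 2) * T) := by gcongr
        _ = t k ^ 4 * ((∑' l, relDev φ θ t B l k ^ 2) * (T * M ^ 2)) := by ring
        _ ≤ 1 * ((∑' l, relDev φ θ t B l k ^ 2) * (T * M ^ 2)) := by gcongr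
        _ = _ := one_mul _
  have hoffs := Summable.of_nonneg_of_le (fun _ => sq_nonneg _) hoff
    (h.summable_tsum_col.mul_right _)
  have hoff2 : ∑' k, (if k = j then 0 else inner ℝ (ψ j) (φ k) * t k) ^ 2 ≤ T * (ζ * M) ^ 2 := by
    refine (hoffs.tsum_le_tsum hoff (h.summable_tsum_col.mul_right _)).trans ?_
    rw [tsum_mul_right]
    have := mul_le_mul_of_nonneg_right h.tsum_col_le (show 0 ≤ T * M ^ 2 by positivity)
    linarith [this, show ζ ^ 2 * (T * M ^ 2) = T * (ζ * M) ^ 2 by ring]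
  have hTeq : T = (inner ℝ (ψ j) (φ j) * t j) ^ 2 +
      ∑' k, (if k = j then 0 else inner ℝ (ψ j) (φ k) * t k) ^ 2 := by
    rw [hT, hs.tsum_eq_add_tsum_ite j]
    congr 1
    refine tsum_congr fun k => ?_
    split_ifs <;> simp
  have he : (inner ℝ (ψ j) (φ j) * t j) ^ 2 ≤ t j ^ 2 := by
    rw [mul_pow]
    have h1 := abs_real_inner_le_norm (ψ j) (φ j)
    rw [ψ.orthonormal.1, φ.orthonormal.1, one_mul] at h1
    exact mul_le_of_le_one_left (sq_nonneg _) ((sq_le_one_iff_abs_le_one _).2 h1)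
  have hζM : (ζ * M) ^ 2 ≤ 1 / 4 := by
    have h0 : 0 ≤ ζ * M := mul_nonneg h.nonneg_dist hM.pos.le
    have := hM.small
    nlinarith
  have hT2 : T ≤ 2 * t j ^ 2 := by nlinarith
  exact ⟨hoffs, hoff2.trans (mul_le_mul_of_nonneg_right hT2 (sq_nonneg _)), hT2⟩

/-- Two bounds for a coefficient of the perturbed eigenvector: a crude one, and a sharper one whose
leading term has the first-order approximation. -/
lemma normCoef_sq_le (h : IsPerturbation φ ψ θ η t B ζ) (hθ : Antitone θ) (hθ0 : ∀ j, 0 ≤ θ j)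
    {j : ℕ} {M : ℝ} (hM : Isolated θ ζ j M) (k : ℕ) :
    normCoef φ ψ θ t j k ^ 2 ≤ 8 * ∑' l, relDev φ θ t B l k ^ 2 ∧
    normCoef φ ψ θ t j k ^ 2 ≤
      8 * relDev φ θ t B j k ^ 2 + 16 * (ζ * M) ^ 2 * ∑' l, relDev φ θ t B l k ^ 2 := by
  have hz : 0 ≤ ∑' l, relDev φ θ t B l k ^ 2 := tsum_nonneg fun _ => sq_nonneg _
  have htj := h.weight_pos j
  have htk := h.weight_pos k
  rcases eq_or_ne k j with rfl | hk
  · have : normCoef φ ψ θ t k k = 0 := by simp [normCoef]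
    rw [this, zero_pow two_ne_zero]
    constructor <;> positivity
  obtain ⟨hoffs, hoff, hT⟩ := h.tsum_off_le hθ hθ0 hM
  obtain ⟨hs, hd⟩ := h.inner_dev_sq_le (ψ j) k
  have hgap := (h.half_gap_le hθ hθ0 hM hk).1
  have hy : normCoef φ ψ θ t j k ^ 2 * (t j ^ 2 * t k ^ 2) ≤
      4 * inner ℝ (ψ j) (B (φ k) - θ k • φ k) ^ 2 := by
    have e : normCoef φ ψ θ t j k ^ 2 * (t j ^ 2 * t k ^ 2) =
        inner ℝ (ψ j) (φ k) ^ 2 * |θ j - θ k| ^ 2 := by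
      rw [normCoef, sq_abs]; field_simp
    rw [e, ← h.gap_mul_inner]
    have : |θ j - θ k| ^ 2 ≤ (2 * |η j - θ k|) ^ 2 := pow_le_pow_left₀ (abs_nonneg _) hgap 2
    rw [mul_pow 2, sq_abs (η j - θ k)] at this
    nlinarith [mul_le_mul_of_nonneg_left this (sq_nonneg (inner ℝ (ψ j) (φ k)))]
  have hpos : 0 < t j ^ 2 * t k ^ 2 := by positivity
  constructor
  · refine le_of_mul_le_mul_right (hy.trans ?_) hpos
    calc _ ≤ 4 * (t k ^ 2 * (∑' l, relDev φ θ t B l k ^ 2) *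
          ∑' l, (inner ℝ (ψ j) (φ l) * t l) ^ 2) := by gcongr
      _ ≤ 4 * (t k ^ 2 * (∑' l, relDev φ θ t B l k ^ 2) * (2 * t j ^ 2)) := by gcongr
      _ = _ := by ring
  · refine le_of_mul_le_mul_right (hy.trans ?_) hpos
    -- the term `l = j` of the expansion is the first-order approximation
    have hsplit : inner ℝ (ψ j) (B (φ k) - θ k • φ k) =
        inner ℝ (ψ j) (φ j) * (t j * (t k * relDev φ θ t B j k)) +
          t k * ∑' l, (if l = j then 0 else inner ℝ (ψ j) (φ l) * t l) * relDev φ θ t B l k := by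
      rw [← φ.tsum_inner_mul_inner,
        (φ.summable_inner_mul_inner (ψ j) _).tsum_eq_add_tsum_ite j, h.inner_dev, ← tsum_mul_left]
      congr 1
      refine tsum_congr fun l => ?_
      split_ifs
      · simp
      · rw [h.inner_dev]; ring
    have h1 := tsum_mul_sq_le hoffs (h.summable_col k)
    have h2 : (∑' l, (if l = j then 0 else inner ℝ (ψ j) (φ l) * t l) * relDev φ θ t B l k) ^ 2 ≤
        2 * t j ^ 2 * (ζ * M) ^ 2 * ∑' l, relDev φ θ t B l k ^ 2 :=
      h1.trans (mul_le_mul_of_nonneg_right hoff hz)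
    have h3 : inner ℝ (ψ j) (φ j) ^ 2 ≤ 1 := by
      have h1 := abs_real_inner_le_norm (ψ j) (φ j)
      rw [ψ.orthonormal.1, φ.orthonormal.1, one_mul] at h1
      exact (sq_le_one_iff_abs_le_one _).2 h1
    rw [hsplit]
    set S := ∑' l, (if l = j then 0 else inner ℝ (ψ j) (φ l) * t l) * relDev φ θ t B l k
    set e := inner ℝ (ψ j) (φ j)
    set Z := relDev φ θ t B j k
    set zz := ∑' l, relDev φ θ t B l k ^ 2
    calc 4 * (e * (t j * (t k * Z)) + t k * S) ^ 2
        ≤ 4 * (2 * (e * (t j * (t k * Z))) ^ 2 + 2 * (t k * S) ^ 2) := by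
          nlinarith [sq_nonneg (e * (t j * (t k * Z)) - t k * S)]
      _ = 8 * (e ^ 2 * (t j ^ 2 * t k ^ 2 * Z ^ 2)) + 8 * t k ^ 2 * S ^ 2 := by ring
      _ ≤ 8 * (1 * (t j ^ 2 * t k ^ 2 * Z ^ 2)) +
          8 * t k ^ 2 * (2 * t j ^ 2 * (ζ * M) ^ 2 * zz) := by gcongr
      _ = _ := by ring

lemma tsum_normCoef_sq_le (h : IsPerturbation φ ψ θ η t B ζ) (hθ : Antitone θ)
    (hθ0 : ∀ j, 0 ≤ θ j) {j : ℕ} {M : ℝ} (hM : Isolated θ ζ j M) :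
    Summable (fun k => normCoef φ ψ θ t j k ^ 2) ∧
    ∑' k, normCoef φ ψ θ t j k ^ 2 ≤ 8 * ζ ^ 2 ∧
    ∑' k, normCoef φ ψ θ t j k ^ 2 ≤
      8 * ∑' k, relDev φ θ t B j k ^ 2 + 16 * (ζ * M) ^ 2 * ζ ^ 2 := by
  have h1 := fun k => (h.normCoef_sq_le hθ hθ0 hM k).1
  have h2 := fun k => (h.normCoef_sq_le hθ hθ0 hM k).2
  have hs1 := h.summable_tsum_col.mul_left 8
  have hs := Summable.of_nonneg_of_le (fun _ => sq_nonneg _) h1 hs1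
  refine ⟨hs, (hs.tsum_le_tsum h1 hs1).trans ?_, ?_⟩
  · rw [tsum_mul_left]; linarith [h.tsum_col_le]
  · have ha := (h.summable_row j).mul_left 8
    have hb := h.summable_tsum_col.mul_left (16 * (ζ * M) ^ 2)
    refine (hs.tsum_le_tsum h2 (ha.add hb)).trans ?_
    rw [ha.tsum_add hb, tsum_mul_left, tsum_mul_left]
    gcongr
    exact h.tsum_col_le

/-- The change of the `j`-th coefficient of `f`, up to the cosine of the angle between the `j`-th
eigenvectors. -/
lemma coef_sub_sq_le (h : IsPerturbation φ ψ θ η t B ζ) (hθ : Antitone θ)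
    (hθ0 : ∀ j, 0 ≤ θ j) {j : ℕ} {M : ℝ} (hM : Isolated θ ζ j M) (f : H)
    (hf : Summable fun k => (t j * t k * inner ℝ f (φ k) / (θ j - θ k)) ^ 2) :
    (inner ℝ f (ψ j) - inner ℝ f (φ j) * inner ℝ (ψ j) (φ j)) ^ 2 ≤
      influence φ θ t f j * ∑' k, normCoef φ ψ θ t j k ^ 2 := by
  have hy := (h.tsum_normCoef_sq_le hθ hθ0 hM).1
  have e : inner ℝ f (ψ j) - inner ℝ f (φ j) * inner ℝ (ψ j) (φ j) =
      ∑' k, (t j * t k * inner ℝ f (φ k) / (θ j - θ k)) * normCoef φ ψ θ t j k := by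
    rw [← φ.tsum_inner_mul_inner f (ψ j),
      (φ.summable_inner_mul_inner f (ψ j)).tsum_eq_add_tsum_ite j,
      real_inner_comm (ψ j) (φ j), add_sub_cancel_left]
    refine tsum_congr fun k => ?_
    split_ifs with hk
    · simp [hk]
    · have hgap : θ j - θ k ≠ 0 := by
        intro h0
        have := hM.gap k hk
        rw [h0, abs_zero, mul_zero] at this
        linarith
      have h1 := (h.weight_pos j).ne'
      have h2 := (h.weight_pos k).ne'
      rw [normCoef, real_inner_comm (φ k) (ψ j)]; field_simp
  rw [e]
  exact tsum_mul_sq_le hf hy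

/-- The squared sine of the angle between the `j`-th eigenvectors is of second order. -/
lemma one_sub_inner_sq_le (h : IsPerturbation φ ψ θ η t B ζ) (hθ : Antitone θ)
    (hθ0 : ∀ j, 0 ≤ θ j) {j : ℕ} {M : ℝ} (hM : Isolated θ ζ j M) :
    0 ≤ 1 - inner ℝ (ψ j) (φ j) ^ 2 ∧ 1 - inner ℝ (ψ j) (φ j) ^ 2 ≤ 2 * (ζ * M) ^ 2 := by
  have hsum := hasSum_inner_sq φ (ψ j)
  have h1 : 1 - inner ℝ (ψ j) (φ j) ^ 2 =
      ∑' k, if k = j then 0 else inner ℝ (ψ j) (φ k) ^ 2 := by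
    have := hsum.summable.tsum_eq_add_tsum_ite j
    rw [hsum.tsum_eq, ψ.orthonormal.1, one_pow] at this
    simp only [real_inner_comm (ψ j)] at this
    linarith
  have hs : Summable fun k => if k = j then 0 else inner ℝ (ψ j) (φ k) ^ 2 := by
    refine Summable.of_nonneg_of_le (fun k => ?_) (fun k => ?_) hsum.summable
    · split_ifs <;> positivity
    · split_ifs
      · positivity
      · rw [real_inner_comm]
  obtain ⟨hy, hy8, -⟩ := h.tsum_normCoef_sq_le hθ hθ0 hM
  have h2 : ∀ k, (if k = j then 0 else inner ℝ (ψ j) (φ k) ^ 2) ≤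
      M ^ 2 / 4 * normCoef φ ψ θ t j k ^ 2 := by
    intro k
    split_ifs with hk
    · positivity
    · have hg := hM.gap k hk
      have hg2 : 4 ≤ M ^ 2 * (θ j - θ k) ^ 2 := by
        rw [← sq_abs (θ j - θ k)]
        nlinarith
      have htj := h.weight_pos j
      have htk := h.weight_pos k
      have ht : t j ^ 2 * t k ^ 2 ≤ 1 :=
        mul_le_one₀ (pow_le_one₀ htj.le (h.weight_le_one j)) (sq_nonneg _)
          (pow_le_one₀ htk.le (h.weight_le_one k))
      have e : M ^ 2 / 4 * normCoef φ ψ θ t j k ^ 2 =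
          inner ℝ (ψ j) (φ k) ^ 2 * (M ^ 2 * (θ j - θ k) ^ 2 / 4) / (t j ^ 2 * t k ^ 2) := by
        rw [normCoef]; field_simp
      rw [e, le_div_iff₀ (by positivity)]
      refine mul_le_mul_of_nonneg_left ?_ (sq_nonneg _)
      linarith
  refine ⟨by rw [h1]; exact tsum_nonneg fun k => by split_ifs <;> positivity, ?_⟩
  rw [h1]
  refine (hs.tsum_le_tsum h2 (hy.mul_left _)).trans ?_
  rw [tsum_mul_left]
  calc _ ≤ M ^ 2 / 4 * (8 * ζ ^ 2) := by gcongr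
    _ = _ := by ring

end IsPerturbation

end Perturbation

/-! ### Plug-in sums over the leading empirical eigenvectors -/

section PluginSums

variable {H : Type*} [NormedAddCommGroup H] [InnerProductSpace ℝ H]
  {φ ψ : HilbertBasis ℕ ℝ H} {θ η t : ℕ → ℝ} {B : H →L[ℝ] H} {ζ C α : ℝ}

lemma cast_add_one_le {j m : ℕ} (hj : j < m) : (j : ℝ) + 1 ≤ m := by exact_mod_cast hj

/-- The condition on `m` isolates each of the first `m` eigenvalues. -/
lemma IsPerturbation.isolated (h : IsPerturbation φ ψ θ η t B ζ) (hC : 0 < C) (hα : 1 < α)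
    (hgap : ∀ j : ℕ, C⁻¹ * ((j : ℝ) + 1) ^ (-α - 1) ≤ θ j - θ (j + 1)) {m : ℕ}
    (hm : 4 * C * (ζ * (m : ℝ) ^ (α + 3 / 2)) ≤ 1) {j : ℕ} (hj : j < m) :
    Isolated θ ζ j (2 * C * ((j : ℝ) + 1) ^ (α + 1)) := by
  have hJ := cast_add_one_pos j
  refine ⟨by positivity, fun k hk => ?_, ?_⟩
  · have h1 := gap_isolated hC (by linarith) hgap hk
    have h2 : ((j : ℝ) + 1) ^ (α + 1) * ((j : ℝ) + 1) ^ (-α - 1) = 1 := by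
      rw [← Real.rpow_add hJ]; norm_num
    calc (2 : ℝ) = 2 * C * ((j : ℝ) + 1) ^ (α + 1) * (C⁻¹ * ((j : ℝ) + 1) ^ (-α - 1)) := by
          rw [show 2 * C * ((j : ℝ) + 1) ^ (α + 1) * (C⁻¹ * ((j : ℝ) + 1) ^ (-α - 1)) =
            2 * (C * C⁻¹) * (((j : ℝ) + 1) ^ (α + 1) * ((j : ℝ) + 1) ^ (-α - 1)) by ring, h2,
            mul_inv_cancel₀ hC.ne']
          norm_num
      _ ≤ _ := mul_le_mul_of_nonneg_left h1 (by positivity)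
  · have h1 : ((j : ℝ) + 1) ^ (α + 1) ≤ (m : ℝ) ^ (α + 3 / 2) :=
      (Real.rpow_le_rpow hJ.le (cast_add_one_le hj) (by linarith)).trans
        (Real.rpow_le_rpow_of_exponent_le ((one_le_cast_add_one j).trans (cast_add_one_le hj))
          (by linarith))
    have h2 := mul_le_mul_of_nonneg_left h1 (mul_nonneg hC.le h.nonneg_dist)
    nlinarith

lemma IsPerturbation.le_eigenvalue (h : IsPerturbation φ ψ θ η t B ζ) (hθ : Antitone θ)
    (hθ0 : ∀ j, 0 ≤ θ j) (hC : 0 < C) (hα : 1 < α)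
    (hlow : ∀ j : ℕ, C⁻¹ * ((j : ℝ) + 1) ^ (-α) ≤ θ j) {m : ℕ}
    (hm : 4 * C * (ζ * (m : ℝ) ^ (α + 3 / 2)) ≤ 1) {j : ℕ} (hj : j < m) :
    0 < η j ∧ (η j)⁻¹ ≤ 2 * C * ((j : ℝ) + 1) ^ α := by
  have hJ := cast_add_one_pos j
  have h1 := abs_le.1 (h.abs_eigenvalue_sub_le hθ hθ0 j)
  have h2 := hlow j
  have h3 : ((j : ℝ) + 1) ^ α ≤ (m : ℝ) ^ (α + 3 / 2) :=
    (Real.rpow_le_rpow hJ.le (cast_add_one_le hj) (by linarith)).trans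
      (Real.rpow_le_rpow_of_exponent_le ((one_le_cast_add_one j).trans (cast_add_one_le hj))
        (by linarith))
  have h4 := mul_le_mul_of_nonneg_left h3 (mul_nonneg hC.le h.nonneg_dist)
  have h5 : C⁻¹ * ((j : ℝ) + 1) ^ (-α) = (C * ((j : ℝ) + 1) ^ α)⁻¹ := by
    rw [Real.rpow_neg hJ.le, mul_inv]
  have hpos : 0 < C * ((j : ℝ) + 1) ^ α := by positivity
  have h6 : ζ ≤ (C * ((j : ℝ) + 1) ^ α)⁻¹ / 4 := by
    rw [inv_eq_one_div, div_div, le_div_iff₀ (by positivity)]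
    nlinarith
  have h7 : (2 * C * ((j : ℝ) + 1) ^ α)⁻¹ ≤ η j := by
    rw [h5] at h2
    rw [show 2 * C * ((j : ℝ) + 1) ^ α = 2 * (C * ((j : ℝ) + 1) ^ α) by ring, mul_inv]
    have := inv_pos.2 hpos
    linarith [h1.1]
  have h8 : 0 < η j := lt_of_lt_of_le (by positivity) h7
  exact ⟨h8, inv_le_of_inv_le₀ (by positivity) h7⟩

/-- Influences of coefficients that decay fast enough for the gaps not to matter, or that merely
decay faster than `j ^ (-1 / 2)`. -/
lemma exists_influence_le (φ : HilbertBasis ℕ ℝ H) {p β γ : ℝ} (hC : 0 < C) (hα : 1 < α)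
    (hp : 0 < p) (hβ : α + 2 ≤ β) (hγ : 1 / 2 < γ)
    (hgap : ∀ j : ℕ, C⁻¹ * ((j : ℝ) + 1) ^ (-α - 1) ≤ θ j - θ (j + 1)) (C₁ C₂ : ℝ) :
    ∃ S : ℝ, 0 ≤ S ∧
      (∀ b : H, (∀ k : ℕ, |inner ℝ b (φ k)| ≤ C₁ * ((k : ℝ) + 1) ^ (-β)) → ∀ j : ℕ,
        Summable (fun k : ℕ => (((j : ℝ) + 1) ^ (-p) * ((k : ℝ) + 1) ^ (-p) * inner ℝ b (φ k) /
          (θ j - θ k)) ^ 2) ∧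
        influence φ θ (fun k => ((k : ℝ) + 1) ^ (-p)) b j ≤ (S * ((j : ℝ) + 1) ^ (-p)) ^ 2) ∧
      ∀ x : H, (∀ k : ℕ, |inner ℝ x (φ k)| ≤ C₂ * ((k : ℝ) + 1) ^ (-γ)) → ∀ j : ℕ,
        Summable (fun k : ℕ => (((j : ℝ) + 1) ^ (-p) * ((k : ℝ) + 1) ^ (-p) * inner ℝ x (φ k) /
          (θ j - θ k)) ^ 2) ∧
        influence φ θ (fun k => ((k : ℝ) + 1) ^ (-p)) x j ≤
          (S * ((j : ℝ) + 1) ^ (α + 1 / 2)) ^ 2 := by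
  obtain ⟨Sb, hSb0, hSb⟩ := exists_weighted_gap_sum hC hα hp hgap (ρ := β) (by linarith) C₁
  obtain ⟨Sx, hSx0, hSx⟩ := exists_weighted_gap_sum hC hα hp hgap (ρ := γ) (by linarith) C₂
  have hS0 : 0 ≤ 2 * (Sb + Sx) := by positivity
  refine ⟨√(2 * (Sb + Sx)), Real.sqrt_nonneg _, fun b hb j => ?_, fun x hx j => ?_⟩
  · obtain ⟨h1, h2⟩ := hSb _ hb j
    refine ⟨h1, h2.trans ?_⟩
    have hJ := cast_add_one_pos j
    have hJ1 := one_le_cast_add_one j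
    have e : ((j : ℝ) + 1) ^ (-2 * p) = (((j : ℝ) + 1) ^ (-p)) ^ 2 := by
      rw [← Real.rpow_natCast, ← Real.rpow_mul hJ.le]; congr 1; push_cast; ring
    have h3 : ((j : ℝ) + 1) ^ (2 * α + 2 - 2 * β) ≤ 1 :=
      Real.rpow_le_one_of_one_le_of_nonpos hJ1 (by linarith)
    rw [mul_pow, Real.sq_sqrt hS0, e]
    calc Sb * ((((j : ℝ) + 1) ^ (-p)) ^ 2 * (1 + ((j : ℝ) + 1) ^ (2 * α + 2 - 2 * β)))
        ≤ (Sb + Sx) * ((((j : ℝ) + 1) ^ (-p)) ^ 2 * (1 + 1)) := by gcongr; linarith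
      _ = _ := by ring
  · obtain ⟨h1, h2⟩ := hSx _ hx j
    refine ⟨h1, h2.trans ?_⟩
    have hJ := cast_add_one_pos j
    have hJ1 := one_le_cast_add_one j
    have e : (((j : ℝ) + 1) ^ (α + 1 / 2)) ^ 2 = ((j : ℝ) + 1) ^ (2 * α + 1) := by
      rw [← Real.rpow_natCast, ← Real.rpow_mul hJ.le]; congr 1; push_cast; ring
    have h3 : ((j : ℝ) + 1) ^ (2 * α + 2 - 2 * γ) ≤ ((j : ℝ) + 1) ^ (2 * α + 1) :=
      Real.rpow_le_rpow_of_exponent_le hJ1 (by linarith)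
    have h4 : (1 : ℝ) ≤ ((j : ℝ) + 1) ^ (2 * α + 1) := Real.one_le_rpow hJ1 (by linarith)
    have h5 : ((j : ℝ) + 1) ^ (-2 * p) ≤ 1 :=
      Real.rpow_le_one_of_one_le_of_nonpos hJ1 (by linarith)
    rw [mul_pow, Real.sq_sqrt hS0, e]
    calc Sx * (((j : ℝ) + 1) ^ (-2 * p) * (1 + ((j : ℝ) + 1) ^ (2 * α + 2 - 2 * γ)))
        ≤ (Sb + Sx) * (1 * (((j : ℝ) + 1) ^ (2 * α + 1) + ((j : ℝ) + 1) ^ (2 * α + 1))) := by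
          gcongr; linarith
      _ = _ := by ring

lemma abs_le_mul_sqrt {a I Y s : ℝ} (hs : 0 ≤ s) (hY : 0 ≤ Y) (h : a ^ 2 ≤ I * Y)
    (hI : I ≤ s ^ 2) : |a| ≤ s * √Y := by
  refine abs_le_of_sq_le_sq ?_ (by positivity)
  rw [mul_pow, Real.sq_sqrt hY]
  exact h.trans (mul_le_mul_of_nonneg_right hI hY)

set_option maxHeartbeats 800000 in
/-- **Bias of the empirical projection**: replacing the leading `m` eigenvectors by perturbed ones
changes the truncated inner product of `b` and `x` by a multiple of the size of the
perturbation. -/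
lemma exists_bias_bound (φ : HilbertBasis ℕ ℝ H) {p β γ C₁ C₂ : ℝ} (hC : 0 < C) (hα : 1 < α)
    (hp : 0 < p) (hβ : α + 2 ≤ β) (hγ : 1 / 2 < γ) (hC₁ : 0 < C₁) (hC₂ : 0 < C₂)
    (hθ0 : ∀ j, 0 ≤ θ j)
    (hgap : ∀ j : ℕ, C⁻¹ * ((j : ℝ) + 1) ^ (-α - 1) ≤ θ j - θ (j + 1)) :
    ∃ K : ℝ, 0 ≤ K ∧ ∀ (ψ : HilbertBasis ℕ ℝ H) (η : ℕ → ℝ) (B : H →L[ℝ] H) (ζ : ℝ) (m : ℕ)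
      (b x : H), IsPerturbation φ ψ θ η (fun k => ((k : ℝ) + 1) ^ (-p)) B ζ →
      4 * C * (ζ * (m : ℝ) ^ (α + 3 / 2)) ≤ 1 →
      (∀ k : ℕ, |inner ℝ b (φ k)| ≤ C₁ * ((k : ℝ) + 1) ^ (-β)) →
      (∀ k : ℕ, |inner ℝ x (φ k)| ≤ C₂ * ((k : ℝ) + 1) ^ (-γ)) →
      |∑ j ∈ Finset.range m, inner ℝ b (ψ j) * inner ℝ x (ψ j) -
        ∑ j ∈ Finset.range m, inner ℝ b (φ j) * inner ℝ x (φ j)| ≤ K * ζ := by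
  obtain ⟨S, hS0, hSb, hSx⟩ := exists_influence_le φ hC hα hp hβ hγ hgap C₁ C₂
  have hθ := antitone_of_gap hC hgap
  have hs1 : Summable fun j : ℕ => ((j : ℝ) + 1) ^ (-3 / 2 : ℝ) :=
    summable_add_one_rpow (by norm_num)
  have hs2 : Summable fun j : ℕ => (((j : ℝ) + 1) ^ (-γ - p)) ^ 2 := by
    refine (summable_add_one_rpow (r := (-γ - p) * 2) (by linarith)).congr fun j => ?_
    rw [← Real.rpow_natCast, ← Real.rpow_mul (cast_add_one_pos j).le]; norm_num
  set U₁ := ∑' j : ℕ, ((j : ℝ) + 1) ^ (-3 / 2 : ℝ)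
  set U₂ := ∑' j : ℕ, (((j : ℝ) + 1) ^ (-γ - p)) ^ 2
  have hU₁ : 0 ≤ U₁ := tsum_nonneg fun j => Real.rpow_nonneg (cast_add_one_pos j).le _
  -- coefficients of the terms of second order, of first order for `x` and of first order for `b`
  set K₁ := 8 * C ^ 2 * C₁ * C₂ + 8 * C * C₂ * S + 8 * S ^ 2 with hK₁
  set K₂ := 3 * C₁ * S with hK₂
  set K₃ := 3 * C₂ * S with hK₃
  refine ⟨K₁ / (4 * C) + K₂ * U₁ + K₃ * √U₂, by positivity,
    fun ψ η B ζ m b x h hm hb hx => ?_⟩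
  have hζ := h.nonneg_dist
  set r : ℕ → ℝ := fun j => ∑' k, relDev φ θ (fun k => ((k : ℝ) + 1) ^ (-p)) B j k ^ 2 with hr
  have hr0 : ∀ j, 0 ≤ r j := fun j => tsum_nonneg fun _ => sq_nonneg _
  have hterm : ∀ j ∈ Finset.range m,
      |inner ℝ b (ψ j) * inner ℝ x (ψ j) - inner ℝ b (φ j) * inner ℝ x (φ j)| ≤
        ζ ^ 2 * K₁ * ((j : ℝ) + 1) ^ (α + 1 / 2) + ζ * K₂ * ((j : ℝ) + 1) ^ (-3 / 2 : ℝ) +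
          K₃ * (((j : ℝ) + 1) ^ (-γ - p) * √(r j)) := by
    intro j hj
    have hj := Finset.mem_range.1 hj
    have hM := h.isolated hC hα hgap hm hj
    have hJ := cast_add_one_pos j
    have hJ1 := one_le_cast_add_one j
    obtain ⟨hys, hy1, hy2⟩ := h.tsum_normCoef_sq_le hθ hθ0 hM
    obtain ⟨he0, he1⟩ := h.one_sub_inner_sq_le hθ hθ0 hM
    have hbS := hSb b hb j
    have hxS := hSx x hx j
    have hB := h.coef_sub_sq_le hθ hθ0 hM b hbS.1
    have hX := h.coef_sub_sq_le hθ hθ0 hM x hxS.1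
    set J : ℝ := (j : ℝ) + 1 with hJdef
    set Y := ∑' k, normCoef φ ψ θ (fun k => ((k : ℝ) + 1) ^ (-p)) j k ^ 2
    have hY0 : 0 ≤ Y := tsum_nonneg fun _ => sq_nonneg _
    have hB' := abs_le_mul_sqrt (mul_nonneg hS0 (Real.rpow_nonneg hJ.le _)) hY0 hB hbS.2
    have hX' := abs_le_mul_sqrt (mul_nonneg hS0 (Real.rpow_nonneg hJ.le _)) hY0 hX hxS.2
    set e := inner ℝ (ψ j) (φ j)
    set bj := inner ℝ b (φ j)
    set xj := inner ℝ x (φ j)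
    set B' := inner ℝ b (ψ j) - bj * e
    set X' := inner ℝ x (ψ j) - xj * e
    have hbj : |bj| ≤ C₁ * J ^ (-β) := hb j
    have hxj : |xj| ≤ C₂ * J ^ (-γ) := hx j
    have he : |e| ≤ 1 := (sq_le_one_iff_abs_le_one _).1 (by linarith)
    have hsY1 : √Y ≤ 3 * ζ := by
      rw [Real.sqrt_le_left (by positivity)]; nlinarith
    have hsY2 : √Y ≤ 3 * √(r j) + 8 * C * ζ ^ 2 * J ^ (α + 1) := by
      rw [Real.sqrt_le_left (by positivity)]
      have h1 : 0 ≤ 3 * √(r j) * (8 * C * ζ ^ 2 * J ^ (α + 1)) := by positivity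
      have h2 : (3 * √(r j)) ^ 2 = 9 * r j := by rw [mul_pow, Real.sq_sqrt (hr0 j)]; norm_num
      calc Y ≤ 8 * r j + 16 * (ζ * (2 * C * J ^ (α + 1))) ^ 2 * ζ ^ 2 := hy2
        _ ≤ 9 * r j + (8 * C * ζ ^ 2 * J ^ (α + 1)) ^ 2 := by nlinarith [hr0 j]
        _ ≤ _ := by nlinarith
    -- the first and last terms are of second order in `ζ`
    have hdecomp : inner ℝ b (ψ j) * inner ℝ x (ψ j) - bj * xj =
        -(bj * xj * (1 - e ^ 2)) + bj * e * X' + xj * e * B' + B' * X' := by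
      simp only [B', X']; ring
    have hJγ : J ^ (-γ) ≤ J ^ (-1 / 2 : ℝ) := Real.rpow_le_rpow_of_exponent_le hJ1 (by linarith)
    have hJβ : J ^ (-β) ≤ J ^ (-α - 2) := Real.rpow_le_rpow_of_exponent_le hJ1 (by linarith)
    have hJp : J ^ (-p) ≤ 1 := Real.rpow_le_one_of_one_le_of_nonpos hJ1 (by linarith)
    have T1 : |bj * xj * (1 - e ^ 2)| ≤ ζ ^ 2 * (8 * C ^ 2 * C₁ * C₂) * J ^ (α + 1 / 2) := by
      rw [abs_mul, abs_mul, abs_of_nonneg he0]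
      calc |bj| * |xj| * (1 - e ^ 2)
          ≤ (C₁ * J ^ (-α - 2)) * (C₂ * J ^ (-1 / 2 : ℝ)) * (2 * (ζ * (2 * C * J ^ (α + 1))) ^ 2) := by
            gcongr
            · exact hbj.trans (by gcongr)
            · exact hxj.trans (by gcongr)
        _ = ζ ^ 2 * (8 * C ^ 2 * C₁ * C₂) *
            (J ^ (-α - 2) * J ^ (-1 / 2 : ℝ) * (J ^ (α + 1)) ^ 2) := by ring
        _ ≤ _ := by
            gcongr
            rw [← Real.rpow_natCast, ← Real.rpow_mul hJ.le, ← Real.rpow_add hJ, ← Real.rpow_add hJ]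
            exact Real.rpow_le_rpow_of_exponent_le hJ1 (by push_cast; linarith)
    have T2 : |bj * e * X'| ≤ ζ * K₂ * J ^ (-3 / 2 : ℝ) := by
      rw [abs_mul, abs_mul]
      calc |bj| * |e| * |X'| ≤ (C₁ * J ^ (-α - 2)) * 1 * (S * J ^ (α + 1 / 2) * (3 * ζ)) := by
            gcongr
            · exact hbj.trans (by gcongr)
            · exact hX'.trans (by gcongr)
        _ = ζ * K₂ * (J ^ (-α - 2) * J ^ (α + 1 / 2)) := by rw [hK₂]; ring
        _ = _ := by rw [← Real.rpow_add hJ]; congr 2; ring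
    have T3 : |xj * e * B'| ≤ K₃ * (J ^ (-γ - p) * √(r j)) +
        ζ ^ 2 * (8 * C * C₂ * S) * J ^ (α + 1 / 2) := by
      rw [abs_mul, abs_mul]
      calc |xj| * |e| * |B'| ≤ (C₂ * J ^ (-γ)) * 1 *
            (S * J ^ (-p) * (3 * √(r j) + 8 * C * ζ ^ 2 * J ^ (α + 1))) := by
            gcongr
            exact hB'.trans (by gcongr)
        _ = K₃ * (J ^ (-γ) * J ^ (-p) * √(r j)) +
            ζ ^ 2 * (8 * C * C₂ * S) * (J ^ (-γ) * J ^ (-p) * J ^ (α + 1)) := by rw [hK₃]; ring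
        _ ≤ _ := by
            rw [← Real.rpow_add hJ, ← Real.rpow_add hJ, ← sub_eq_add_neg]
            have h1 : J ^ (-γ - p + (α + 1)) ≤ J ^ (α + 1 / 2) :=
              Real.rpow_le_rpow_of_exponent_le hJ1 (by linarith)
            have h2 : 0 ≤ ζ ^ 2 * (8 * C * C₂ * S) := by positivity
            linarith [mul_le_mul_of_nonneg_left h1 h2]
    have T4 : |B' * X'| ≤ ζ ^ 2 * (8 * S ^ 2) * J ^ (α + 1 / 2) := by
      rw [abs_mul]
      calc |B'| * |X'| ≤ (S * J ^ (-p) * √Y) * (S * J ^ (α + 1 / 2) * √Y) := by gcongr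
        _ = S ^ 2 * J ^ (-p) * J ^ (α + 1 / 2) * (√Y ^ 2) := by ring
        _ ≤ S ^ 2 * 1 * J ^ (α + 1 / 2) * (8 * ζ ^ 2) := by
            rw [Real.sq_sqrt hY0]; gcongr
        _ = _ := by ring
    rw [hdecomp]
    have habs : |-(bj * xj * (1 - e ^ 2)) + bj * e * X' + xj * e * B' + B' * X'| ≤
        |bj * xj * (1 - e ^ 2)| + |bj * e * X'| + |xj * e * B'| + |B' * X'| := by
      refine (abs_add_le _ _).trans ?_
      refine add_le_add_left ((abs_add_le _ _).trans ?_) _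
      refine add_le_add_left ((abs_add_le _ _).trans ?_) _
      rw [abs_neg]
    refine habs.trans ?_
    have e1 : ζ ^ 2 * K₁ * J ^ (α + 1 / 2) = ζ ^ 2 * (8 * C ^ 2 * C₁ * C₂) * J ^ (α + 1 / 2) +
        ζ ^ 2 * (8 * C * C₂ * S) * J ^ (α + 1 / 2) + ζ ^ 2 * (8 * S ^ 2) * J ^ (α + 1 / 2) := by
      rw [hK₁]; ring
    linarith
  rw [← Finset.sum_sub_distrib]
  refine (Finset.abs_sum_le_sum_abs _ _).trans ((Finset.sum_le_sum hterm).trans ?_)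
  rw [Finset.sum_add_distrib, Finset.sum_add_distrib, ← Finset.mul_sum, ← Finset.mul_sum,
    ← Finset.mul_sum]
  -- the condition on `m` turns the second-order terms into first-order ones
  have A1 : ζ ^ 2 * K₁ * ∑ j ∈ Finset.range m, ((j : ℝ) + 1) ^ (α + 1 / 2) ≤ K₁ / (4 * C) * ζ := by
    have h1 := sum_add_one_rpow_le (r := α + 1 / 2) (by linarith) m
    rw [show α + 1 / 2 + 1 = α + 3 / 2 by ring] at h1
    have hK0 : 0 ≤ K₁ := by positivity
    calc _ ≤ ζ ^ 2 * K₁ * (m : ℝ) ^ (α + 3 / 2) := by gcongr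
      _ = K₁ / (4 * C) * ζ * (4 * C * (ζ * (m : ℝ) ^ (α + 3 / 2))) := by field_simp
      _ ≤ K₁ / (4 * C) * ζ * 1 := by gcongr
      _ = _ := mul_one _
  have A2 : ζ * K₂ * ∑ j ∈ Finset.range m, ((j : ℝ) + 1) ^ (-3 / 2 : ℝ) ≤ K₂ * U₁ * ζ := by
    have := hs1.sum_le_tsum (Finset.range m)
      (fun j _ => Real.rpow_nonneg (cast_add_one_pos j).le _)
    calc _ ≤ ζ * K₂ * U₁ := by gcongr
      _ = _ := by ring
  -- the row norms `r j` add up to at most `ζ ^ 2`, so nothing is lost by summing over `j`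
  have A3 : K₃ * ∑ j ∈ Finset.range m, ((j : ℝ) + 1) ^ (-γ - p) * √(r j) ≤ K₃ * √U₂ * ζ := by
    have hK3 : 0 ≤ K₃ := by positivity
    rw [mul_assoc K₃]
    refine mul_le_mul_of_nonneg_left ?_ hK3
    refine abs_le_of_sq_le_sq ?_ (by positivity) |> (le_abs_self _).trans
    have hU₂ : 0 ≤ U₂ := tsum_nonneg fun j => sq_nonneg _
    rw [mul_pow, Real.sq_sqrt hU₂]
    refine (Finset.sum_mul_sq_le_sq_mul_sq _ _ _).trans ?_
    have h1 := hs2.sum_le_tsum (Finset.range m) (fun j _ => sq_nonneg _)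
    have h2 : ∑ j ∈ Finset.range m, √(r j) ^ 2 ≤ ζ ^ 2 := by
      simp_rw [Real.sq_sqrt (hr0 _)]
      exact (h.summable_tsum_row.sum_le_tsum _ (fun j _ => hr0 j)).trans h.tsum_row_le
    exact mul_le_mul h1 h2 (Finset.sum_nonneg fun _ _ => sq_nonneg _) hU₂
  linarith

/-- **Variance of the plug-in estimator**, conditionally on the design: the sum of the squared
perturbed coefficients of `x`, weighted by inverse eigenvalues. -/
lemma exists_variance_bound (φ : HilbertBasis ℕ ℝ H) {p γ C₂ : ℝ} (hC : 0 < C) (hα : 1 < α)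
    (hp : 0 < p) (hγ : 1 / 2 < γ) (hC₂ : 0 < C₂)
    (hlow : ∀ j : ℕ, C⁻¹ * ((j : ℝ) + 1) ^ (-α) ≤ θ j)
    (hgap : ∀ j : ℕ, C⁻¹ * ((j : ℝ) + 1) ^ (-α - 1) ≤ θ j - θ (j + 1)) :
    ∃ K : ℝ, 0 ≤ K ∧ ∀ (ψ : HilbertBasis ℕ ℝ H) (η : ℕ → ℝ) (B : H →L[ℝ] H) (ζ : ℝ) (m : ℕ)
      (x : H), IsPerturbation φ ψ θ η (fun k => ((k : ℝ) + 1) ^ (-p)) B ζ →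
      4 * C * (ζ * (m : ℝ) ^ (α + 3 / 2)) ≤ 1 →
      (∀ k : ℕ, |inner ℝ x (φ k)| ≤ C₂ * ((k : ℝ) + 1) ^ (-γ)) →
      ∑ j ∈ Finset.range m, (η j)⁻¹ * inner ℝ x (ψ j) ^ 2 ≤
        K * ∑ j ∈ Finset.range m, ((j : ℝ) + 1) ^ (α - 2 * γ) +
          K * (ζ ^ 2 * (m : ℝ) ^ (3 * α + 2)) := by
  obtain ⟨S, hS0, -, hSx⟩ := exists_influence_le φ hC hα hp le_rfl hγ hgap 1 C₂
  have hθ := antitone_of_gap hC hgap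
  have hθ0 : ∀ j, 0 ≤ θ j := fun j => le_trans (by positivity) (hlow j)
  refine ⟨4 * C * C₂ ^ 2 + 32 * C * S ^ 2, by positivity, fun ψ η B ζ m x h hm hx => ?_⟩
  have hterm : ∀ j ∈ Finset.range m, (η j)⁻¹ * inner ℝ x (ψ j) ^ 2 ≤
      4 * C * C₂ ^ 2 * ((j : ℝ) + 1) ^ (α - 2 * γ) +
        32 * C * S ^ 2 * ζ ^ 2 * ((j : ℝ) + 1) ^ (3 * α + 1) := by
    intro j hj
    have hj := Finset.mem_range.1 hj
    have hM := h.isolated hC hα hgap hm hj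
    have hJ := cast_add_one_pos j
    obtain ⟨hη0, hη⟩ := h.le_eigenvalue hθ hθ0 hC hα hlow hm hj
    obtain ⟨hys, hy1, -⟩ := h.tsum_normCoef_sq_le hθ hθ0 hM
    obtain ⟨he0, -⟩ := h.one_sub_inner_sq_le hθ hθ0 hM
    have hxS := hSx x hx j
    have hX := h.coef_sub_sq_le hθ hθ0 hM x hxS.1
    set J : ℝ := (j : ℝ) + 1 with hJdef
    set e := inner ℝ (ψ j) (φ j)
    set xj := inner ℝ x (φ j)
    have hxj : xj ^ 2 ≤ (C₂ * J ^ (-γ)) ^ 2 := by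
      rw [← sq_abs]; exact pow_le_pow_left₀ (abs_nonneg _) (hx j) 2
    have hX2 : (inner ℝ x (ψ j) - xj * e) ^ 2 ≤ (S * J ^ (α + 1 / 2)) ^ 2 * (8 * ζ ^ 2) :=
      hX.trans (mul_le_mul hxS.2 hy1 (tsum_nonneg fun _ => sq_nonneg _) (sq_nonneg _))
    have h1 : inner ℝ x (ψ j) ^ 2 ≤
        2 * (C₂ * J ^ (-γ)) ^ 2 + 2 * ((S * J ^ (α + 1 / 2)) ^ 2 * (8 * ζ ^ 2)) := by
      have h2 : xj ^ 2 * e ^ 2 ≤ (C₂ * J ^ (-γ)) ^ 2 * 1 :=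
        mul_le_mul hxj (by linarith) (sq_nonneg _) (sq_nonneg _)
      nlinarith [sq_nonneg (inner ℝ x (ψ j) - 2 * (xj * e))]
    have e1 : (J ^ (-γ)) ^ 2 = J ^ (-2 * γ) := by
      rw [← Real.rpow_natCast, ← Real.rpow_mul hJ.le]; congr 1; push_cast; ring
    have e2 : (J ^ (α + 1 / 2)) ^ 2 = J ^ (2 * α + 1) := by
      rw [← Real.rpow_natCast, ← Real.rpow_mul hJ.le]; congr 1; push_cast; ring
    have e3 : J ^ (α - 2 * γ) = J ^ α * J ^ (-2 * γ) := by rw [← Real.rpow_add hJ]; congr 1; ring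
    have e4 : J ^ (3 * α + 1) = J ^ α * J ^ (2 * α + 1) := by
      rw [← Real.rpow_add hJ]; congr 1; ring
    calc _ ≤ (2 * C * J ^ α) *
          (2 * (C₂ * J ^ (-γ)) ^ 2 + 2 * ((S * J ^ (α + 1 / 2)) ^ 2 * (8 * ζ ^ 2))) := by gcongr
      _ = _ := by rw [mul_pow, mul_pow, e1, e2, e3, e4]; ring
  refine (Finset.sum_le_sum hterm).trans ?_
  rw [Finset.sum_add_distrib, ← Finset.mul_sum, ← Finset.mul_sum]
  have h1 := sum_add_one_rpow_le (r := 3 * α + 1) (by linarith) m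
  rw [show 3 * α + 1 + 1 = 3 * α + 2 by ring] at h1
  have h2 : 0 ≤ ∑ j ∈ Finset.range m, ((j : ℝ) + 1) ^ (α - 2 * γ) :=
    Finset.sum_nonneg fun j _ => Real.rpow_nonneg (cast_add_one_pos j).le _
  have h3 : 32 * C * S ^ 2 * ζ ^ 2 * ∑ j ∈ Finset.range m, ((j : ℝ) + 1) ^ (3 * α + 1) ≤
      32 * C * S ^ 2 * ζ ^ 2 * (m : ℝ) ^ (3 * α + 2) := by gcongr
  have h4 : 0 ≤ 32 * C * S ^ 2 * ∑ j ∈ Finset.range m, ((j : ℝ) + 1) ^ (α - 2 * γ) := by positivity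
  have h5 : 0 ≤ 4 * C * C₂ ^ 2 * (ζ ^ 2 * (m : ℝ) ^ (3 * α + 2)) := by positivity
  linarith

end PluginSums

/-! ### Moments of sums of independent variables -/

/-- An expansion in which only the term of first order in `z` is kept exactly. -/
lemma add_pow_even_le (r : ℕ) (s z : ℝ) :
    (s + z) ^ (2 * (r + 1)) ≤ s ^ (2 * (r + 1)) + (2 * (r + 1) : ℕ) * (s ^ (2 * r + 1) * z) +
      4 ^ (r + 1) * (s ^ (2 * r) * z ^ 2 + z ^ (2 * (r + 1))) := by
  have hterm : ∀ i ∈ Finset.range (2 * r + 1),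
      s ^ i * z ^ (2 * (r + 1) - i) ≤ s ^ (2 * r) * z ^ 2 + z ^ (2 * (r + 1)) := by
    intro i hi
    have hi' : i ≤ 2 * r := by have := Finset.mem_range.1 hi; omega
    refine (le_abs_self _).trans ?_
    have e1 : s ^ (2 * r) = |s| ^ (2 * r) := (Even.pow_abs (even_two_mul r) s).symm
    have e2 : z ^ (2 * (r + 1)) = |z| ^ (2 * (r + 1)) := (Even.pow_abs (even_two_mul _) z).symm
    rw [abs_mul, abs_pow, abs_pow, e1, e2, ← sq_abs z]
    rcases le_total |s| |z| with h | h
    · have h1 : |s| ^ i * |z| ^ (2 * (r + 1) - i) ≤ |z| ^ i * |z| ^ (2 * (r + 1) - i) := by gcongr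
      rw [← pow_add, show i + (2 * (r + 1) - i) = 2 * (r + 1) by omega] at h1
      exact h1.trans (le_add_of_nonneg_left (by positivity))
    · have h1 : |s| ^ i * |z| ^ (2 * (r + 1) - i) ≤ |s| ^ i * (|s| ^ (2 * r - i) * |z| ^ 2) := by
        rw [show 2 * (r + 1) - i = (2 * r - i) + 2 by omega, pow_add]
        gcongr
      rw [← mul_assoc, ← pow_add, show i + (2 * r - i) = 2 * r by omega] at h1
      exact h1.trans (le_add_of_nonneg_right (by positivity))
  have hA : 0 ≤ s ^ (2 * r) * z ^ 2 + z ^ (2 * (r + 1)) := by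
    have h1 : 0 ≤ s ^ (2 * r) := Even.pow_nonneg (even_two_mul r) s
    have h2 : 0 ≤ z ^ (2 * (r + 1)) := Even.pow_nonneg (even_two_mul _) z
    positivity
  rw [add_pow, Finset.sum_range_succ, show 2 * (r + 1) = (2 * r + 1) + 1 by ring,
    Finset.sum_range_succ]
  have hsum : ∑ i ∈ Finset.range (2 * r + 1),
      s ^ i * z ^ (2 * r + 1 + 1 - i) * ((2 * r + 1 + 1).choose i : ℝ) ≤
      4 ^ (r + 1) * (s ^ (2 * r) * z ^ 2 + z ^ (2 * (r + 1))) := by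
    calc _ ≤ ∑ i ∈ Finset.range (2 * r + 1), (s ^ (2 * r) * z ^ 2 + z ^ (2 * (r + 1))) *
          ((2 * r + 1 + 1).choose i : ℝ) := by
          refine Finset.sum_le_sum fun i hi => ?_
          exact mul_le_mul_of_nonneg_right (hterm i hi) (by positivity)
      _ ≤ ∑ i ∈ Finset.range (2 * r + 1 + 1 + 1), (s ^ (2 * r) * z ^ 2 + z ^ (2 * (r + 1))) *
          ((2 * r + 1 + 1).choose i : ℝ) := by
          refine Finset.sum_le_sum_of_subset_of_nonneg
            (Finset.range_subset_range.2 (by omega)) fun i _ _ => mul_nonneg hA (by positivity)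
      _ = _ := by
          have h4 : ((2 ^ (2 * r + 1 + 1) : ℕ) : ℝ) = 4 ^ (r + 1) := by
            rw [show 2 * r + 1 + 1 = 2 * (r + 1) by ring, pow_mul]; norm_num
          rw [← Finset.mul_sum, ← Nat.cast_sum, Nat.sum_range_choose, h4, mul_comm]
  have e3 : 2 * r + 1 + 1 - (2 * r + 1) = 1 := by omega
  simp only [e3, Nat.choose_self, Nat.choose_succ_self_right, pow_one, Nat.sub_self, pow_zero,
    mul_one, Nat.cast_one]
  rw [show 2 * (r + 1) = 2 * r + 1 + 1 by ring] at hsum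
  push_cast at hsum ⊢
  linarith

section Moments

variable {Ω : Type*} [MeasurableSpace Ω] {P : Measure Ω}

lemma indepFun_sum_range_pow {Z : ℕ → Ω → ℝ} (hi : iIndepFun Z P) (hm : ∀ i, Measurable (Z i))
    (n a b : ℕ) :
    IndepFun (fun ω => (∑ i ∈ Finset.range n, Z i ω) ^ a) (fun ω => Z n ω ^ b) P := by
  have h := hi.indepFun_sum_range_succ hm n
  have h2 := h.comp (φ := fun x : ℝ => x ^ a) (ψ := fun x : ℝ => x ^ b)
    (measurable_id.pow_const a) (measurable_id.pow_const b)
  have e : (fun ω => (∑ i ∈ Finset.range n, Z i ω) ^ a) =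
      (fun x : ℝ => x ^ a) ∘ (∑ i ∈ Finset.range n, Z i) := by ext ω; simp
  rw [e]; exact h2

lemma integrable_sum_range_pow [IsProbabilityMeasure P] {Z : ℕ → Ω → ℝ} (hi : iIndepFun Z P)
    (hm : ∀ i, Measurable (Z i)) (hint : ∀ i (q : ℕ), Integrable (fun ω => Z i ω ^ q) P) (n q : ℕ) :
    Integrable (fun ω => (∑ i ∈ Finset.range n, Z i ω) ^ q) P := by
  induction n generalizing q with
  | zero => simp
  | succ n ih =>
    simp_rw [Finset.sum_range_succ, add_pow]
    refine integrable_finsetSum _ fun i _ => Integrable.mul_const ?_ _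
    exact (indepFun_sum_range_pow hi hm n i (q - i)).integrable_mul (ih i) (hint n (q - i))

/-- **Moments of sums**: the even moments of a sum of `n` independent centred variables are of
order `n ^ r`, uniformly over families with common bounds on the moments. -/
lemma exists_moment_bound [IsProbabilityMeasure P] (M : ℕ → ℝ) : ∃ A : ℕ → ℝ, (∀ r, 0 ≤ A r) ∧
    ∀ Z : ℕ → Ω → ℝ, iIndepFun Z P → (∀ i, Measurable (Z i)) →
      (∀ i (q : ℕ), Integrable (fun ω => Z i ω ^ q) P) → (∀ i, ∫ ω, Z i ω ∂P = 0) →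
      (∀ i q, ∫ ω, Z i ω ^ (2 * q) ∂P ≤ M q) → ∀ r n : ℕ,
      ∫ ω, (∑ i ∈ Finset.range n, Z i ω) ^ (2 * r) ∂P ≤ A r * (n : ℝ) ^ r := by
  let A : ℕ → ℝ := fun r => Nat.rec 1 (fun r a => 4 ^ (r + 1) * (a * |M 1| + |M (r + 1)|)) r
  have hA0 : A 0 = 1 := rfl
  have hAs : ∀ r, A (r + 1) = 4 ^ (r + 1) * (A r * |M 1| + |M (r + 1)|) := fun r => rfl
  have hA : ∀ r, 0 ≤ A r := fun r => by
    induction r with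
    | zero => simp [hA0]
    | succ r ih => rw [hAs]; positivity
  refine ⟨A, hA, fun Z hi hm hint h0 hM r => ?_⟩
  have hS := integrable_sum_range_pow hi hm hint
  induction r with
  | zero => intro n; simp [hA0]
  | succ r ihr =>
    intro n
    induction n with
    | zero => simp
    | succ n ihn =>
      set S : Ω → ℝ := fun ω => ∑ i ∈ Finset.range n, Z i ω with hSdef
      have hprod : ∀ a b : ℕ, Integrable (fun ω => S ω ^ a * Z n ω ^ b) P := fun a b =>
        (indepFun_sum_range_pow hi hm n a b).integrable_mul (hS n a) (hint n b)
      have hval : ∀ a b : ℕ, ∫ ω, S ω ^ a * Z n ω ^ b ∂P =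
          (∫ ω, S ω ^ a ∂P) * ∫ ω, Z n ω ^ b ∂P := fun a b =>
        (indepFun_sum_range_pow hi hm n a b).integral_fun_mul_eq_mul_integral
          (hS n a).aestronglyMeasurable (hint n b).aestronglyMeasurable
      have i1 := hprod (2 * r + 1) 1
      have i2 := hprod (2 * r) 2
      have v1 := hval (2 * r + 1) 1
      have v2 := hval (2 * r) 2
      simp only [pow_one] at i1 v1
      -- the summands are centred, so the first-order term does not contribute
      rw [h0, mul_zero] at v1
      have hZ2 : 0 ≤ ∫ ω, Z n ω ^ 2 ∂P := integral_nonneg fun ω => sq_nonneg _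
      have hint1 : Integrable (fun ω => S ω ^ (2 * (r + 1)) +
          (2 * (r + 1) : ℕ) * (S ω ^ (2 * r + 1) * Z n ω)) P :=
        (hS n (2 * (r + 1))).add (i1.const_mul ((2 * (r + 1) : ℕ) : ℝ))
      have hint2 : Integrable (fun ω => 4 ^ (r + 1) *
          (S ω ^ (2 * r) * Z n ω ^ 2 + Z n ω ^ (2 * (r + 1)))) P :=
        (i2.add (hint n (2 * (r + 1)))).const_mul ((4 : ℝ) ^ (r + 1))
      have hle : ∫ ω, (∑ i ∈ Finset.range (n + 1), Z i ω) ^ (2 * (r + 1)) ∂P ≤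
          ∫ ω, (S ω ^ (2 * (r + 1)) + (2 * (r + 1) : ℕ) * (S ω ^ (2 * r + 1) * Z n ω) +
            4 ^ (r + 1) * (S ω ^ (2 * r) * Z n ω ^ 2 + Z n ω ^ (2 * (r + 1)))) ∂P := by
        refine integral_mono (hS (n + 1) _) (hint1.add hint2) fun ω => ?_
        simp only [Finset.sum_range_succ]
        exact add_pow_even_le r _ _
      have hr : ∫ ω, S ω ^ (2 * r) ∂P ≤ A r * (n : ℝ) ^ r := ihr n
      have hcalc : ∫ ω, (S ω ^ (2 * (r + 1)) + (2 * (r + 1) : ℕ) * (S ω ^ (2 * r + 1) * Z n ω) +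
            4 ^ (r + 1) * (S ω ^ (2 * r) * Z n ω ^ 2 + Z n ω ^ (2 * (r + 1)))) ∂P =
          ∫ ω, S ω ^ (2 * (r + 1)) ∂P + 4 ^ (r + 1) * ((∫ ω, S ω ^ (2 * r) ∂P) *
            (∫ ω, Z n ω ^ 2 ∂P) + ∫ ω, Z n ω ^ (2 * (r + 1)) ∂P) := by
        rw [integral_add hint1 hint2, integral_add (hS n _) (i1.const_mul _), integral_const_mul,
          integral_const_mul, integral_add i2 (hint n _), v1, v2]
        ring
      have hS0 : 0 ≤ ∫ ω, S ω ^ (2 * r) ∂P :=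
        integral_nonneg fun ω => Even.pow_nonneg (even_two_mul r) _
      have hM1 : ∫ ω, Z n ω ^ 2 ∂P ≤ |M 1| := (hM n 1).trans (le_abs_self _)
      have hMr : ∫ ω, Z n ω ^ (2 * (r + 1)) ∂P ≤ |M (r + 1)| := (hM n (r + 1)).trans (le_abs_self _)
      have hn1 : (n : ℝ) ^ r ≤ ((n : ℝ) + 1) ^ r := by gcongr; linarith
      have hn2 : (1 : ℝ) ≤ ((n : ℝ) + 1) ^ r := one_le_pow₀ (one_le_cast_add_one n)
      have hn3 : (n : ℝ) ^ (r + 1) + ((n : ℝ) + 1) ^ r ≤ ((n : ℝ) + 1) ^ (r + 1) := by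
        rw [pow_succ, pow_succ]
        have : (0 : ℝ) ≤ n := n.cast_nonneg
        nlinarith
      have hAr := hA r
      have hAs0 := hA (r + 1)
      calc _ ≤ _ := hle
        _ = _ := hcalc
        _ ≤ A (r + 1) * (n : ℝ) ^ (r + 1) + 4 ^ (r + 1) * ((A r * ((n : ℝ) + 1) ^ r) * |M 1| +
              |M (r + 1)| * ((n : ℝ) + 1) ^ r) := by
            gcongr
            · exact hr.trans (by gcongr)
            · exact hMr.trans (le_mul_of_one_le_right (abs_nonneg _) hn2)
        _ = A (r + 1) * ((n : ℝ) ^ (r + 1) + ((n : ℝ) + 1) ^ r) := by rw [hAs]; ring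
        _ ≤ A (r + 1) * ((n : ℝ) + 1) ^ (r + 1) := by gcongr
        _ = _ := by push_cast; ring

end Moments

/-- Jensen's inequality for weighted series with values in `[0, ∞]`. -/
lemma tsum_mul_pow_le {ι : Type*} (w f : ι → ℝ≥0∞) {r : ℕ} (hr : 1 ≤ r) :
    (∑' i, w i * f i) ^ r ≤ (∑' i, w i) ^ (r - 1) * ∑' i, w i * f i ^ r := by
  have hr0 : (r : ℝ) ≠ 0 := by positivity
  have hr1 : (1 : ℝ) ≤ r := by exact_mod_cast hr
  have h1 : ∑' i, w i * f i ≤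
      (∑' i, w i) ^ (1 - (r : ℝ)⁻¹) * (∑' i, w i * f i ^ r) ^ (r : ℝ)⁻¹ := by
    rw [ENNReal.tsum_eq_iSup_sum]
    refine iSup_le fun s => (ENNReal.inner_le_weight_mul_Lp_of_nonneg s hr1 w f).trans ?_
    have : (r : ℝ)⁻¹ ≤ 1 := inv_le_one_of_one_le₀ hr1
    simp only [ENNReal.rpow_natCast]
    gcongr
    · exact ENNReal.sum_le_tsum s
    · exact ENNReal.sum_le_tsum s
  calc _ ≤ ((∑' i, w i) ^ (1 - (r : ℝ)⁻¹) * (∑' i, w i * f i ^ r) ^ (r : ℝ)⁻¹) ^ r := by gcongr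
    _ = _ := by
      rw [mul_pow, ← ENNReal.rpow_natCast, ← ENNReal.rpow_natCast, ← ENNReal.rpow_mul,
        ← ENNReal.rpow_mul, inv_mul_cancel₀ hr0, ENNReal.rpow_one, sub_mul, inv_mul_cancel₀ hr0,
        one_mul, ← Nat.cast_one, ← Nat.cast_sub hr, ENNReal.rpow_natCast]

/-! ### The empirical covariance operator -/

section EmpiricalOperator

variable {H : Type*} [NormedAddCommGroup H] [InnerProductSpace ℝ H]

/-- The mean of the first `n` terms of a sequence of vectors. -/
def empMean (n : ℕ) (xs : ℕ → H) : H := (n : ℝ)⁻¹ • ∑ i ∈ Finset.range n, xs i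

/-- The covariance operator of the first `n` terms of a sequence of vectors. -/
def empOp (n : ℕ) (xs : ℕ → H) : H →L[ℝ] H :=
  (n : ℝ)⁻¹ • ∑ i ∈ Finset.range n,
    InnerProductSpace.rankOne ℝ (xs i - empMean n xs) (xs i - empMean n xs)

lemma empOp_apply (n : ℕ) (xs : ℕ → H) (v : H) : empOp n xs v =
    (n : ℝ)⁻¹ • ∑ i ∈ Finset.range n, inner ℝ (xs i - empMean n xs) v • (xs i - empMean n xs) := by
  simp only [empOp, _root_.smul_apply, _root_.sum_apply,
    InnerProductSpace.rankOne_apply]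

lemma inner_empOp (n : ℕ) (xs : ℕ → H) (u v : H) : inner ℝ u (empOp n xs v) =
    (n : ℝ)⁻¹ * ∑ i ∈ Finset.range n,
      inner ℝ (xs i - empMean n xs) u * inner ℝ (xs i - empMean n xs) v := by
  rw [empOp_apply, real_inner_smul_right, inner_sum]
  congr 1
  refine Finset.sum_congr rfl fun i _ => ?_
  rw [real_inner_smul_right, real_inner_comm u, mul_comm]

lemma empOp_symm (n : ℕ) (xs : ℕ → H) (u v : H) :
    inner ℝ (empOp n xs u) v = inner ℝ u (empOp n xs v) := by
  rw [real_inner_comm, inner_empOp, inner_empOp]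
  simp only [mul_comm]

lemma empOp_nonneg (n : ℕ) (xs : ℕ → H) (v : H) : 0 ≤ inner ℝ (empOp n xs v) v := by
  rw [real_inner_comm, inner_empOp]
  exact mul_nonneg (by positivity) (Finset.sum_nonneg fun i _ => mul_self_nonneg _)

lemma continuous_empMean (n : ℕ) : Continuous (empMean n : (ℕ → H) → H) := by
  unfold empMean; fun_prop

lemma continuous_empOp (n : ℕ) : Continuous (empOp n : (ℕ → H) → H →L[ℝ] H) := by
  have h := continuous_empMean (H := H) n
  unfold empOp
  have h1 : ∀ i, Continuous fun xs : ℕ → H => xs i - empMean n xs := fun i => by fun_prop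
  have h2 : Continuous fun xs : ℕ → H => ∑ i ∈ Finset.range n,
      InnerProductSpace.rankOne ℝ (xs i - empMean n xs) (xs i - empMean n xs) :=
    continuous_finsetSum _ fun i _ =>
      ((InnerProductSpace.rankOne ℝ).continuous.comp (h1 i)).clm_apply (h1 i)
  exact h2.const_smul ((n : ℝ)⁻¹)

/-- Centring at an arbitrary `μ` instead of the mean costs the product of the means. -/
lemma inner_empOp_eq {n : ℕ} (hn : n ≠ 0) (xs : ℕ → H) (μ u v : H) :
    inner ℝ u (empOp n xs v) =
      (n : ℝ)⁻¹ * ∑ i ∈ Finset.range n, inner ℝ (xs i - μ) u * inner ℝ (xs i - μ) v -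
      ((n : ℝ)⁻¹ * ∑ i ∈ Finset.range n, inner ℝ (xs i - μ) u) *
        ((n : ℝ)⁻¹ * ∑ i ∈ Finset.range n, inner ℝ (xs i - μ) v) := by
  have hn' : (n : ℝ) ≠ 0 := by exact_mod_cast hn
  have hmean : ∀ w : H, inner ℝ (empMean n xs - μ) w =
      (n : ℝ)⁻¹ * ∑ i ∈ Finset.range n, inner ℝ (xs i - μ) w := by
    intro w
    simp only [inner_sub_left, Finset.sum_sub_distrib, Finset.sum_const, Finset.card_range,
      nsmul_eq_mul, empMean, real_inner_smul_left, sum_inner]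
    field_simp
  have hc : ∀ (i : ℕ) (w : H), inner ℝ (xs i - empMean n xs) w =
      inner ℝ (xs i - μ) w - inner ℝ (empMean n xs - μ) w := by
    intro i w; rw [← inner_sub_left]; congr 1; abel
  rw [inner_empOp]
  simp only [hc, hmean]
  set a := fun i => inner ℝ (xs i - μ) u
  set b := fun i => inner ℝ (xs i - μ) v
  change (n : ℝ)⁻¹ * ∑ i ∈ Finset.range n, (a i - (n : ℝ)⁻¹ * ∑ i ∈ Finset.range n, a i) *
    (b i - (n : ℝ)⁻¹ * ∑ i ∈ Finset.range n, b i) = (n : ℝ)⁻¹ * ∑ i ∈ Finset.range n, a i * b i -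
    ((n : ℝ)⁻¹ * ∑ i ∈ Finset.range n, a i) * ((n : ℝ)⁻¹ * ∑ i ∈ Finset.range n, b i)
  have e : ∑ i ∈ Finset.range n, (a i - (n : ℝ)⁻¹ * ∑ i ∈ Finset.range n, a i) *
      (b i - (n : ℝ)⁻¹ * ∑ i ∈ Finset.range n, b i) = ∑ i ∈ Finset.range n, a i * b i -
      (n : ℝ)⁻¹ * (∑ i ∈ Finset.range n, a i) * ∑ i ∈ Finset.range n, b i := by
    simp only [sub_mul, mul_sub, Finset.sum_sub_distrib, ← Finset.mul_sum, ← Finset.sum_mul,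
      Finset.sum_const, Finset.card_range, nsmul_eq_mul]
    field_simp
    ring
  rw [e]; ring

/-- The squared weighted Hilbert–Schmidt distance of the empirical covariance operator to the
diagonal operator with eigenvalues `θ` and eigenbasis `φ`. -/
def empDist (φ : HilbertBasis ℕ ℝ H) (θ t : ℕ → ℝ) (n : ℕ) (xs : ℕ → H) : ℝ≥0∞ :=
  ∑' q : ℕ × ℕ, ENNReal.ofReal (relDev φ θ t (empOp n xs) q.1 q.2 ^ 2)

lemma continuous_relDev_empOp (φ : HilbertBasis ℕ ℝ H) (θ t : ℕ → ℝ) (n l k : ℕ) :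
    Continuous fun xs : ℕ → H => relDev φ θ t (empOp n xs) l k := by
  have h := (continuous_empOp (H := H) n).clm_apply (continuous_const (y := φ k))
  unfold relDev
  exact (continuous_const.inner (h.sub continuous_const)).div_const _

lemma measurable_empDist [MeasurableSpace H] [BorelSpace H] [SecondCountableTopology H]
    (φ : HilbertBasis ℕ ℝ H) (θ t : ℕ → ℝ) (n : ℕ) : Measurable (empDist φ θ t n) :=
  Measurable.tsum fun q => ((continuous_relDev_empOp φ θ t n q.1 q.2).measurable.pow_const
    2).ennreal_ofReal

lemma isPerturbation_empOp (φ ψ : HilbertBasis ℕ ℝ H) {θ η t : ℕ → ℝ} {n : ℕ} {xs : ℕ → H}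
    (ht : ∀ j, 0 < t j) (ht1 : ∀ j, t j ≤ 1) (heig : ∀ j, empOp n xs (ψ j) = η j • ψ j)
    (hη : Antitone η) (hfin : empDist φ θ t n xs ≠ ∞) :
    IsPerturbation φ ψ θ η t (empOp n xs) √(empDist φ θ t n xs).toReal where
  symm := empOp_symm n xs
  nonneg := empOp_nonneg n xs
  eigen := heig
  antitone := hη
  weight_pos := ht
  weight_le_one := ht1
  nonneg_dist := Real.sqrt_nonneg _
  summable := by
    have := ENNReal.summable_toReal hfin
    simpa [ENNReal.toReal_ofReal, sq_nonneg] using this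
  tsum_le := by
    rw [Real.sq_sqrt ENNReal.toReal_nonneg, empDist, ENNReal.tsum_toReal_eq
      fun _ => ENNReal.ofReal_ne_top]
    simp [ENNReal.toReal_ofReal, sq_nonneg]

end EmpiricalOperator

/-! ### Moments of the distance to the population operator -/

lemma abs_mul_sub_pow_le {a b c : ℝ} (hc : |c| ≤ 1) (q : ℕ) :
    |(a * b - c) ^ q| ≤ 2 ^ q * (a ^ (2 * q) + b ^ (2 * q) + 1) := by
  have h1 : |a * b - c| ≤ |a * b| + 1 := (abs_sub _ _).trans (by linarith)
  have h2 : |a * b| ^ q ≤ a ^ (2 * q) + b ^ (2 * q) := by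
    have ha : a ^ (2 * q) = (|a| ^ q) ^ 2 := by rw [← pow_mul, mul_comm q, Even.pow_abs (even_two_mul q)]
    have hb : b ^ (2 * q) = (|b| ^ q) ^ 2 := by rw [← pow_mul, mul_comm q, Even.pow_abs (even_two_mul q)]
    rw [abs_mul, mul_pow, ha, hb]
    nlinarith [sq_nonneg (|a| ^ q - |b| ^ q), sq_nonneg (|a| ^ q), sq_nonneg (|b| ^ q)]
  calc |(a * b - c) ^ q| = |a * b - c| ^ q := abs_pow _ _
    _ ≤ (|a * b| + 1) ^ q := by gcongr
    _ ≤ 2 ^ (q - 1) * (|a * b| ^ q + 1 ^ q) := add_pow_le (abs_nonneg _) zero_le_one q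
    _ ≤ 2 ^ q * (|a * b| ^ q + 1 ^ q) := by gcongr <;> norm_num
    _ ≤ _ := by rw [one_pow]; gcongr

section Moments

variable {H : Type*} [NormedAddCommGroup H] [InnerProductSpace ℝ H] [MeasurableSpace H]
  [BorelSpace H] {Ω : Type*} [MeasurableSpace Ω] {P : Measure Ω} [IsProbabilityMeasure P]

/-- A sequence of i.i.d. random vectors with mean `μ`, whose covariance operator has eigenvalues
`θ > 0` and eigenbasis `φ`, and whose standardized scores have uniformly bounded moments. -/
structure IsSample (P : Measure Ω) (X : ℕ → Ω → H) (μ : H) (φ : HilbertBasis ℕ ℝ H)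
    (θ : ℕ → ℝ) : Prop where
  measurable : ∀ i, Measurable (X i)
  indep : iIndepFun X P
  ident : ∀ i, IdentDistrib (X i) (X 0) P P
  pos : ∀ j, 0 < θ j
  mean : ∀ k, ∫ ω, inner ℝ (X 0 ω - μ) (φ k) ∂P = 0
  cov : ∀ l k, ∫ ω, inner ℝ (X 0 ω - μ) (φ l) * inner ℝ (X 0 ω - μ) (φ k) ∂P =
    if l = k then θ k else 0
  moments : ∀ r : ℕ, 2 ≤ r → ∃ Cr : ℝ, ∀ j : ℕ,
    Integrable (fun ω => |inner ℝ (X 0 ω - μ) (φ j)| ^ (2 * r)) P ∧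
      ∫ ω, |inner ℝ (X 0 ω - μ) (φ j)| ^ (2 * r) ∂P ≤ Cr * θ j ^ r

/-- The standardized scores of a vector. -/
def stdScore (μ : H) (φ : HilbertBasis ℕ ℝ H) (θ : ℕ → ℝ) (k : ℕ) (v : H) : ℝ :=
  inner ℝ (v - μ) (φ k) / √(θ k)

omit [MeasurableSpace H] [BorelSpace H] in
lemma continuous_stdScore (μ : H) (φ : HilbertBasis ℕ ℝ H) (θ : ℕ → ℝ) (k : ℕ) :
    Continuous (stdScore μ φ θ k) := by
  unfold stdScore; fun_prop

namespace IsSample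

variable {X : ℕ → Ω → H} {μ : H} {φ : HilbertBasis ℕ ℝ H} {θ : ℕ → ℝ}

omit [IsProbabilityMeasure P] in
lemma measurable_stdScore (k : ℕ) : Measurable (stdScore μ φ θ k) :=
  (continuous_stdScore μ φ θ k).measurable

lemma exists_score_moments (h : IsSample P X μ φ θ) : ∃ M : ℕ → ℝ, (∀ q, 0 ≤ M q) ∧
    ∀ i j q, Integrable (fun ω => stdScore μ φ θ j (X i ω) ^ q) P ∧
      ∫ ω, stdScore μ φ θ j (X i ω) ^ (2 * q) ∂P ≤ M q := by
  have hmom : ∀ q : ℕ, ∃ Cr : ℝ, ∀ j : ℕ,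
      Integrable (fun ω => stdScore μ φ θ j (X 0 ω) ^ (2 * (q + 2))) P ∧
      ∫ ω, stdScore μ φ θ j (X 0 ω) ^ (2 * (q + 2)) ∂P ≤ Cr := by
    intro q
    obtain ⟨Cr, hCr⟩ := h.moments (q + 2) (by omega)
    refine ⟨Cr, fun j => ?_⟩
    have hθ := h.pos j
    have e : (fun ω => stdScore μ φ θ j (X 0 ω) ^ (2 * (q + 2))) =
        fun ω => (θ j ^ (q + 2))⁻¹ * |inner ℝ (X 0 ω - μ) (φ j)| ^ (2 * (q + 2)) := by
      ext ω
      rw [stdScore, div_pow, pow_mul √(θ j), Real.sq_sqrt hθ.le,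
        Even.pow_abs (even_two_mul (q + 2))]
      field_simp
    rw [e]
    refine ⟨(hCr j).1.const_mul _, ?_⟩
    rw [integral_const_mul, inv_mul_le_iff₀ (by positivity), mul_comm (θ j ^ (q + 2))]
    exact (hCr j).2
  choose Cr hCr using hmom
  have hmeas : ∀ j, Measurable fun ω => stdScore μ φ θ j (X 0 ω) := fun j =>
    (measurable_stdScore j).comp (h.measurable 0)
  have hle : ∀ (q : ℕ) (x : ℝ), |x| ^ q ≤ 1 + x ^ (2 * (q + 2)) := by
    intro q x
    rw [← Even.pow_abs (even_two_mul (q + 2)) x]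
    rcases le_total |x| 1 with hx | hx
    · have := pow_le_one₀ (n := q) (abs_nonneg x) hx
      have : 0 ≤ |x| ^ (2 * (q + 2)) := by positivity
      linarith
    · have := pow_le_pow_right₀ hx (show q ≤ 2 * (q + 2) by omega)
      linarith
  have hint : ∀ j q, Integrable (fun ω => stdScore μ φ θ j (X 0 ω) ^ q) P := by
    intro j q
    refine Integrable.mono' ((integrable_const 1).add (hCr q j).1)
      ((hmeas j).pow_const q).aestronglyMeasurable (ae_of_all _ fun ω => ?_)
    rw [Real.norm_eq_abs, abs_pow]
    exact hle q _
  refine ⟨fun q => 1 + |Cr (2 * q)|, fun q => by positivity, fun i j q => ?_⟩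
  have hid : ∀ q, IdentDistrib (fun ω => stdScore μ φ θ j (X i ω) ^ q)
      (fun ω => stdScore μ φ θ j (X 0 ω) ^ q) P P := fun q =>
    (h.ident i).comp ((measurable_stdScore j).pow_const q)
  refine ⟨(hid q).integrable_iff.2 (hint j q), ?_⟩
  rw [(hid _).integral_eq]
  calc ∫ ω, stdScore μ φ θ j (X 0 ω) ^ (2 * q) ∂P
      ≤ ∫ ω, (1 + stdScore μ φ θ j (X 0 ω) ^ (2 * (2 * q + 2))) ∂P := by
        refine integral_mono (hint j _) ((integrable_const 1).add (hCr _ j).1) fun ω => ?_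
        have := hle (2 * q) (stdScore μ φ θ j (X 0 ω))
        rwa [Even.pow_abs (even_two_mul q)] at this
    _ = 1 + ∫ ω, stdScore μ φ θ j (X 0 ω) ^ (2 * (2 * q + 2)) ∂P := by
        rw [integral_add (integrable_const 1) (hCr _ j).1]; simp
    _ ≤ 1 + |Cr (2 * q)| := by linarith [(hCr (2 * q) j).2, le_abs_self (Cr (2 * q))]

/-- The standardized deviation of the empirical from the population covariance of two scores. -/
def stdDev (μ : H) (φ : HilbertBasis ℕ ℝ H) (θ : ℕ → ℝ) (n l k : ℕ) (xs : ℕ → H) : ℝ :=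
  (n : ℝ)⁻¹ * ∑ i ∈ Finset.range n, (stdScore μ φ θ l (xs i) * stdScore μ φ θ k (xs i) -
    if l = k then 1 else 0) -
  ((n : ℝ)⁻¹ * ∑ i ∈ Finset.range n, stdScore μ φ θ l (xs i)) *
    ((n : ℝ)⁻¹ * ∑ i ∈ Finset.range n, stdScore μ φ θ k (xs i))

omit [MeasurableSpace H] [BorelSpace H] in
/-- The weight `θ / t ^ 2` of an index carries all the dependence on the index, as the standardized
deviations have comparable moments. -/
lemma relDev_sq_eq (hθ : ∀ j, 0 < θ j) (t : ℕ → ℝ) {n : ℕ} (hn : n ≠ 0) (l k : ℕ) (xs : ℕ → H) :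
    relDev φ θ t (empOp n xs) l k ^ 2 =
      θ l / t l ^ 2 * (θ k / t k ^ 2) * stdDev μ φ θ n l k xs ^ 2 := by
  have hl := Real.sqrt_ne_zero'.2 (hθ l)
  have hk := Real.sqrt_ne_zero'.2 (hθ k)
  have hn' : (n : ℝ) ≠ 0 := by exact_mod_cast hn
  have key : inner ℝ (φ l) (empOp n xs (φ k) - θ k • φ k) =
      √(θ l) * √(θ k) * stdDev μ φ θ n l k xs := by
    have e1 : inner ℝ (φ l) (θ k • φ k) = √(θ l) * √(θ k) * if l = k then 1 else 0 := by
      rw [real_inner_smul_right, orthonormal_iff_ite.1 φ.orthonormal l k]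
      split_ifs with h
      · rw [h, Real.mul_self_sqrt (hθ k).le]
      · simp
    have e2 : ∀ j i, inner ℝ (xs i - μ) (φ j) = √(θ j) * stdScore μ φ θ j (xs i) := by
      intro j i
      have := Real.sqrt_ne_zero'.2 (hθ j)
      rw [stdScore]; field_simp
    rw [inner_sub_right, inner_empOp_eq hn xs μ, e1]
    simp only [e2]
    have e3 : ∑ i ∈ Finset.range n, √(θ l) * stdScore μ φ θ l (xs i) *
        (√(θ k) * stdScore μ φ θ k (xs i)) = √(θ l) * √(θ k) *
        ∑ i ∈ Finset.range n, stdScore μ φ θ l (xs i) * stdScore μ φ θ k (xs i) := by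
      rw [Finset.mul_sum]; exact Finset.sum_congr rfl fun i _ => by ring
    rw [e3, ← Finset.mul_sum, ← Finset.mul_sum, stdDev, Finset.sum_sub_distrib, Finset.sum_const,
      Finset.card_range, nsmul_eq_mul]
    field_simp
    ring
  rw [relDev, key, div_pow, mul_pow, mul_pow, Real.sq_sqrt (hθ l).le, Real.sq_sqrt (hθ k).le]
  simp only [div_eq_mul_inv, mul_pow, mul_inv]
  ring

lemma stdDev_pow_le (a b c : ℝ) (r : ℕ) :
    (a - b * c) ^ (2 * r) ≤ 4 ^ r * (a ^ (2 * r) + (b ^ (2 * (2 * r)) + c ^ (2 * (2 * r)))) := by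
  have h1 : (b * c) ^ (2 * r) ≤ b ^ (2 * (2 * r)) + c ^ (2 * (2 * r)) := by
    have e1 : b ^ (2 * (2 * r)) = (b ^ (2 * r)) ^ 2 := by rw [← pow_mul]; congr 1; ring
    have e2 : c ^ (2 * (2 * r)) = (c ^ (2 * r)) ^ 2 := by rw [← pow_mul]; congr 1; ring
    rw [mul_pow, e1, e2]
    nlinarith [sq_nonneg (b ^ (2 * r) - c ^ (2 * r)), sq_nonneg (b ^ (2 * r)),
      sq_nonneg (c ^ (2 * r))]
  have e : (a - b * c) ^ (2 * r) ≤ (|a| + |b * c|) ^ (2 * r) := by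
    rw [← Even.pow_abs (even_two_mul r)]
    gcongr
    exact abs_sub _ _
  calc _ ≤ _ := e
    _ ≤ 2 ^ (2 * r - 1) * (|a| ^ (2 * r) + |b * c| ^ (2 * r)) :=
        add_pow_le (abs_nonneg _) (abs_nonneg _) _
    _ ≤ 2 ^ (2 * r) * (|a| ^ (2 * r) + |b * c| ^ (2 * r)) := by gcongr <;> norm_num
    _ = 4 ^ r * (a ^ (2 * r) + (b * c) ^ (2 * r)) := by
        rw [Even.pow_abs (even_two_mul r), Even.pow_abs (even_two_mul r), pow_mul]; norm_num
    _ ≤ _ := by gcongr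

/-- The linear part of the deviation is a mean of centred variables; the quadratic part is a product
of two such means, and of smaller order. -/
lemma exists_stdDev_moments (h : IsSample P X μ φ θ) (r : ℕ) : ∃ D : ℝ, 0 ≤ D ∧
    ∀ n l k : ℕ, n ≠ 0 →
      ∫⁻ ω, ENNReal.ofReal (stdDev μ φ θ n l k (fun i => X i ω) ^ 2) ^ r ∂P ≤
        ENNReal.ofReal (D * ((n : ℝ)⁻¹) ^ r) := by
  obtain ⟨M, hM0, hM⟩ := h.exists_score_moments
  obtain ⟨A₁, hA₁, hmom₁⟩ := exists_moment_bound (P := P) M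
  obtain ⟨A₂, hA₂, hmom₂⟩ := exists_moment_bound (P := P)
    (fun q => 4 ^ q * (M (2 * q) + M (2 * q) + 1))
  refine ⟨4 ^ r * (A₂ r + (A₁ (2 * r) + A₁ (2 * r))), by
    have := hA₁ (2 * r); have := hA₂ r; positivity,
    fun n l k hn => ?_⟩
  have hn0 : (0 : ℝ) < n := by positivity
  set c : ℝ := if l = k then 1 else 0 with hcdef
  have hc : |c| ≤ 1 := by rw [hcdef]; split_ifs <;> simp
  let U : ℕ → ℕ → Ω → ℝ := fun j i ω => stdScore μ φ θ j (X i ω)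
  let W : ℕ → Ω → ℝ := fun i ω => U l i ω * U k i ω - c
  have hUm : ∀ j i, Measurable (U j i) := fun j i => (measurable_stdScore j).comp (h.measurable i)
  have hWg : Measurable fun v : H => stdScore μ φ θ l v * stdScore μ φ θ k v - c :=
    ((measurable_stdScore l).mul (measurable_stdScore k)).sub_const c
  have hWm : ∀ i, Measurable (W i) := fun i => hWg.comp (h.measurable i)
  have hUi : ∀ j, iIndepFun (U j) P := fun j => h.indep.comp _ fun _ => measurable_stdScore j
  have hWi : iIndepFun W P := h.indep.comp _ fun _ => hWg
  have hUint : ∀ j i q, Integrable (fun ω => U j i ω ^ q) P := fun j i q => (hM i j q).1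
  have hbd : ∀ i q, Integrable (fun ω => 2 ^ q * (U l i ω ^ (2 * q) + U k i ω ^ (2 * q) + 1)) P :=
    fun i q => (((hUint l i _).add (hUint k i _)).add (integrable_const 1)).const_mul _
  have hWint : ∀ i q, Integrable (fun ω => W i ω ^ q) P := fun i q =>
    Integrable.mono' (hbd i q) ((hWm i).pow_const q).aestronglyMeasurable
      (ae_of_all _ fun ω => abs_mul_sub_pow_le hc q)
  have hU0 : ∀ j i, ∫ ω, U j i ω ∂P = 0 := fun j i => by
    have hid : IdentDistrib (U j i) (U j 0) P P := (h.ident i).comp (measurable_stdScore j)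
    rw [hid.integral_eq]
    simp only [U, stdScore]
    rw [integral_div, h.mean, zero_div]
  have hW0 : ∀ i, ∫ ω, W i ω ∂P = 0 := fun i => by
    have hid : IdentDistrib (W i) (W 0) P P := (h.ident i).comp hWg
    rw [hid.integral_eq]
    have h1 : Integrable (fun ω => U l 0 ω * U k 0 ω) P := by
      have := (hWint 0 1).add (integrable_const c)
      refine this.congr (ae_of_all _ fun ω => ?_)
      simp [W]
    have h2 : ∫ ω, U l 0 ω * U k 0 ω ∂P = c := by
      have e : ∀ ω, U l 0 ω * U k 0 ω = (√(θ l) * √(θ k))⁻¹ *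
          (inner ℝ (X 0 ω - μ) (φ l) * inner ℝ (X 0 ω - μ) (φ k)) := fun ω => by
        simp only [U, stdScore, div_eq_mul_inv, mul_inv]; ring
      simp_rw [e]
      rw [integral_const_mul, h.cov, hcdef]
      split_ifs with hlk
      · rw [hlk, Real.mul_self_sqrt (h.pos k).le, inv_mul_cancel₀ (h.pos k).ne']
      · simp
    simp only [W]
    rw [integral_sub h1 (integrable_const c), h2]; simp
  have hWM : ∀ i q, ∫ ω, W i ω ^ (2 * q) ∂P ≤ 4 ^ q * (M (2 * q) + M (2 * q) + 1) := fun i q => by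
    have h1 : ∫ ω, W i ω ^ (2 * q) ∂P ≤
        ∫ ω, 2 ^ (2 * q) * (U l i ω ^ (2 * (2 * q)) + U k i ω ^ (2 * (2 * q)) + 1) ∂P :=
      integral_mono (hWint i _) (hbd i _) fun ω => (le_abs_self _).trans (abs_mul_sub_pow_le hc _)
    refine h1.trans ?_
    have h2 : Integrable (fun ω => U l i ω ^ (2 * (2 * q)) + U k i ω ^ (2 * (2 * q))) P :=
      (hUint l i _).add (hUint k i _)
    rw [integral_const_mul, integral_add h2 (integrable_const 1),
      integral_add (hUint l i _) (hUint k i _), pow_mul]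
    simp only [integral_const, probReal_univ, smul_eq_mul, mul_one]
    norm_num
    exact add_le_add (hM i l (2 * q)).2 (hM i k (2 * q)).2
  have hb1 : ∀ j, ∫ ω, ((n : ℝ)⁻¹ * ∑ i ∈ Finset.range n, U j i ω) ^ (2 * (2 * r)) ∂P ≤
      A₁ (2 * r) * ((n : ℝ)⁻¹) ^ r := fun j => by
    simp_rw [mul_pow]
    rw [integral_const_mul]
    have h1 := hmom₁ (U j) (hUi j) (hUm j) (hUint j) (hU0 j) (fun i q => (hM i j q).2) (2 * r) n
    have hAA := hA₁ (2 * r)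
    calc _ ≤ ((n : ℝ)⁻¹) ^ (2 * (2 * r)) * (A₁ (2 * r) * (n : ℝ) ^ (2 * r)) := by gcongr
      _ = A₁ (2 * r) * (((n : ℝ)⁻¹) ^ r * ((n : ℝ)⁻¹) ^ r) := by
          rw [show 2 * (2 * r) = r + r + (2 * r) by ring, pow_add, pow_add]
          have : ((n : ℝ)⁻¹) ^ (2 * r) * (n : ℝ) ^ (2 * r) = 1 := by
            rw [← mul_pow, inv_mul_cancel₀ hn0.ne', one_pow]
          linear_combination A₁ (2 * r) * ((n : ℝ)⁻¹) ^ r * ((n : ℝ)⁻¹) ^ r * this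
      _ ≤ A₁ (2 * r) * (((n : ℝ)⁻¹) ^ r * 1) := by
          have : ((n : ℝ)⁻¹) ≤ 1 := inv_le_one_of_one_le₀ (by
            exact_mod_cast Nat.one_le_iff_ne_zero.2 hn)
          gcongr
          exact pow_le_one₀ (by positivity) this
      _ = _ := by rw [mul_one]
  have hb2 : ∫ ω, ((n : ℝ)⁻¹ * ∑ i ∈ Finset.range n, W i ω) ^ (2 * r) ∂P ≤
      A₂ r * ((n : ℝ)⁻¹) ^ r := by
    simp_rw [mul_pow]
    rw [integral_const_mul]
    have h1 := hmom₂ W hWi hWm hWint hW0 hWM r n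
    calc _ ≤ ((n : ℝ)⁻¹) ^ (2 * r) * (A₂ r * (n : ℝ) ^ r) := by gcongr
      _ = A₂ r * ((n : ℝ)⁻¹) ^ r := by
          rw [show 2 * r = r + r by ring, pow_add]
          have : ((n : ℝ)⁻¹) ^ r * (n : ℝ) ^ r = 1 := by
            rw [← mul_pow, inv_mul_cancel₀ hn0.ne', one_pow]
          linear_combination A₂ r * ((n : ℝ)⁻¹) ^ r * this
  have hi1 : ∀ j, Integrable
      (fun ω => ((n : ℝ)⁻¹ * ∑ i ∈ Finset.range n, U j i ω) ^ (2 * (2 * r))) P := fun j => by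
    simp_rw [mul_pow]
    exact (integrable_sum_range_pow (hUi j) (hUm j) (hUint j) n _).const_mul _
  have hi2 : Integrable (fun ω => ((n : ℝ)⁻¹ * ∑ i ∈ Finset.range n, W i ω) ^ (2 * r)) P := by
    simp_rw [mul_pow]
    exact (integrable_sum_range_pow hWi hWm hWint n _).const_mul _
  have hi23 : Integrable (fun ω =>
      ((n : ℝ)⁻¹ * ∑ i ∈ Finset.range n, U l i ω) ^ (2 * (2 * r)) +
        ((n : ℝ)⁻¹ * ∑ i ∈ Finset.range n, U k i ω) ^ (2 * (2 * r))) P := (hi1 l).add (hi1 k)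
  have hi3 : Integrable (fun ω => 4 ^ r *
      (((n : ℝ)⁻¹ * ∑ i ∈ Finset.range n, W i ω) ^ (2 * r) +
      (((n : ℝ)⁻¹ * ∑ i ∈ Finset.range n, U l i ω) ^ (2 * (2 * r)) +
        ((n : ℝ)⁻¹ * ∑ i ∈ Finset.range n, U k i ω) ^ (2 * (2 * r))))) P :=
    (hi2.add hi23).const_mul _
  calc ∫⁻ ω, ENNReal.ofReal (stdDev μ φ θ n l k (fun i => X i ω) ^ 2) ^ r ∂P
      ≤ ∫⁻ ω, ENNReal.ofReal (4 ^ r * (((n : ℝ)⁻¹ * ∑ i ∈ Finset.range n, W i ω) ^ (2 * r) +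
        (((n : ℝ)⁻¹ * ∑ i ∈ Finset.range n, U l i ω) ^ (2 * (2 * r)) +
        ((n : ℝ)⁻¹ * ∑ i ∈ Finset.range n, U k i ω) ^ (2 * (2 * r))))) ∂P := by
        refine lintegral_mono fun ω => ?_
        rw [← ENNReal.ofReal_pow (sq_nonneg _), ← pow_mul]
        exact ENNReal.ofReal_le_ofReal (stdDev_pow_le _ _ _ r)
    _ = ENNReal.ofReal (∫ ω, 4 ^ r * (((n : ℝ)⁻¹ * ∑ i ∈ Finset.range n, W i ω) ^ (2 * r) +
        (((n : ℝ)⁻¹ * ∑ i ∈ Finset.range n, U l i ω) ^ (2 * (2 * r)) +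
        ((n : ℝ)⁻¹ * ∑ i ∈ Finset.range n, U k i ω) ^ (2 * (2 * r)))) ∂P) := by
        refine (ofReal_integral_eq_lintegral_ofReal hi3 (ae_of_all _ fun ω => ?_)).symm
        have h1 : ∀ (q : ℕ) (x : ℝ), 0 ≤ x ^ (2 * q) := fun q x => Even.pow_nonneg (even_two_mul q) x
        exact mul_nonneg (by positivity) (add_nonneg (h1 _ _) (add_nonneg (h1 _ _) (h1 _ _)))
    _ ≤ _ := by
        refine ENNReal.ofReal_le_ofReal ?_
        rw [integral_const_mul, integral_add hi2 hi23, integral_add (hi1 l) (hi1 k), mul_assoc]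
        refine mul_le_mul_of_nonneg_left ?_ (by positivity)
        refine (add_le_add hb2 (add_le_add (hb1 l) (hb1 k))).trans (le_of_eq ?_)
        ring

/-- The moments of the squared distance between the empirical and the population covariance
operator are of the parametric order, by Jensen's inequality for the summable weights. -/
lemma exists_empDist_moments [SecondCountableTopology H] (h : IsSample P X μ φ θ) {t : ℕ → ℝ}
    (hw : Summable fun k => θ k / t k ^ 2) {r : ℕ} (hr : 1 ≤ r) : ∃ D : ℝ, 0 ≤ D ∧
    ∀ n : ℕ, n ≠ 0 → ∫⁻ ω, empDist φ θ t n (fun i => X i ω) ^ r ∂P ≤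
      ENNReal.ofReal (D * ((n : ℝ)⁻¹) ^ r) := by
  obtain ⟨D, hD0, hD⟩ := h.exists_stdDev_moments r
  have hw0 : ∀ k, 0 ≤ θ k / t k ^ 2 := fun k => div_nonneg (h.pos k).le (sq_nonneg _)
  have hww := hw.mul_of_nonneg hw hw0 hw0
  set V := ∑' q : ℕ × ℕ, θ q.1 / t q.1 ^ 2 * (θ q.2 / t q.2 ^ 2)
  have hV0 : 0 ≤ V := tsum_nonneg fun q => mul_nonneg (hw0 _) (hw0 _)
  let w : ℕ × ℕ → ℝ≥0∞ := fun q => ENNReal.ofReal (θ q.1 / t q.1 ^ 2 * (θ q.2 / t q.2 ^ 2))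
  have hV : ∑' q, w q = ENNReal.ofReal V :=
    (ENNReal.ofReal_tsum_of_nonneg (fun q => mul_nonneg (hw0 _) (hw0 _)) hww).symm
  refine ⟨V ^ r * D, by positivity, fun n hn => ?_⟩
  have hmeas : ∀ q : ℕ × ℕ, Measurable fun ω =>
      ENNReal.ofReal (stdDev μ φ θ n q.1 q.2 (fun i => X i ω) ^ 2) := by
    intro q
    have h1 : ∀ j i, Measurable fun ω => stdScore μ φ θ j (X i ω) := fun j i =>
      (measurable_stdScore j).comp (h.measurable i)
    refine (Measurable.pow_const ?_ 2).ennreal_ofReal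
    unfold stdDev
    refine Measurable.sub ?_ (Measurable.mul ?_ ?_)
    · exact (Finset.measurable_fun_sum _ fun i _ =>
        ((h1 _ i).mul (h1 _ i)).sub_const _).const_mul _
    · exact (Finset.measurable_fun_sum _ fun i _ => h1 _ i).const_mul _
    · exact (Finset.measurable_fun_sum _ fun i _ => h1 _ i).const_mul _
  calc ∫⁻ ω, empDist φ θ t n (fun i => X i ω) ^ r ∂P
      ≤ ∫⁻ ω, (∑' q, w q) ^ (r - 1) * ∑' q : ℕ × ℕ, w q *
        ENNReal.ofReal (stdDev μ φ θ n q.1 q.2 (fun i => X i ω) ^ 2) ^ r ∂P := by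
        refine lintegral_mono fun ω => le_trans (le_of_eq ?_) (tsum_mul_pow_le w _ hr)
        rw [empDist]
        congr 1
        refine tsum_congr fun q => ?_
        rw [relDev_sq_eq (μ := μ) h.pos t hn,
          ENNReal.ofReal_mul (mul_nonneg (hw0 _) (hw0 _))]
    _ = (∑' q, w q) ^ (r - 1) * ∑' q : ℕ × ℕ, w q * ∫⁻ ω,
        ENNReal.ofReal (stdDev μ φ θ n q.1 q.2 (fun i => X i ω) ^ 2) ^ r ∂P := by
        rw [lintegral_const_mul _ (Measurable.tsum fun q =>
          ((hmeas q).pow_const r).const_mul _),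
          lintegral_tsum fun q => (((hmeas q).pow_const r).const_mul _).aemeasurable]
        congr 1
        exact tsum_congr fun q => lintegral_const_mul _ ((hmeas q).pow_const r)
    _ ≤ (∑' q, w q) ^ (r - 1) * ∑' q : ℕ × ℕ, w q * ENNReal.ofReal (D * ((n : ℝ)⁻¹) ^ r) := by
        gcongr with q
        exact hD n q.1 q.2 hn
    _ = _ := by
        rw [ENNReal.tsum_mul_right, ← mul_assoc, ← pow_succ, Nat.sub_add_cancel hr, hV,
          ← ENNReal.ofReal_pow hV0, ← ENNReal.ofReal_mul (by positivity), mul_assoc]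

end IsSample

end Moments

/-! ### The truncated inverse as a function of the design -/

section SpectralInverse

variable {H : Type*} [NormedAddCommGroup H] [InnerProductSpace ℝ H]

/-- A continuous function that is `1 / u` for `u ≥ hi` and vanishes for `u ≤ lo`. -/
def cutInv (lo hi u : ℝ) : ℝ := max 0 (min 1 ((u - lo) / (hi - lo))) / max u hi

lemma continuous_cutInv {lo hi : ℝ} (h0 : 0 < hi) : Continuous (cutInv lo hi) := by
  unfold cutInv
  refine Continuous.div (by fun_prop) (by fun_prop) fun u => ?_
  exact (lt_of_lt_of_le h0 (le_max_right _ _)).ne'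

lemma cutInv_of_ge {lo hi u : ℝ} (h : lo < hi) (hu : hi ≤ u) : cutInv lo hi u = u⁻¹ := by
  have h1 : 1 ≤ (u - lo) / (hi - lo) := by rw [le_div_iff₀ (by linarith)]; linarith
  rw [cutInv, min_eq_left h1, max_eq_right zero_le_one, max_eq_left hu, one_div]

lemma cutInv_of_le {lo hi u : ℝ} (h : lo < hi) (hu : u ≤ lo) : cutInv lo hi u = 0 := by
  have h1 : (u - lo) / (hi - lo) ≤ 0 := div_nonpos_of_nonpos_of_nonneg (by linarith) (by linarith)
  rw [cutInv, max_eq_left ((min_le_right _ _).trans h1), zero_div]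

lemma aeval_eigenvector {B : H →L[ℝ] H} {v : H} {c : ℝ} (h : B v = c • v) (p : Polynomial ℝ) :
    (Polynomial.aeval B p) v = p.eval c • v := by
  have hpow : ∀ k : ℕ, (B ^ k) v = c ^ k • v := fun k => by
    induction k with
    | zero => simp
    | succ k ih => rw [pow_succ, mul_apply_eq_comp, h, map_smul, ih, smul_smul, pow_succ,
        mul_comm]
  induction p using Polynomial.induction_on' with
  | add p q hp hq => simp only [map_add, add_apply, hp, hq, Polynomial.eval_add, add_smul]
  | monomial k a =>
    rw [Polynomial.aeval_monomial, mul_apply_eq_comp, hpow, map_smul,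
      Polynomial.eval_monomial, Algebra.algebraMap_eq_smul_one, smul_apply,
      one_apply_eq_self, smul_smul, mul_comm]

lemma inner_diagonal (ψ : HilbertBasis ℕ ℝ H) {A : H →L[ℝ] H} {a : ℕ → ℝ}
    (hA : ∀ j, A (ψ j) = a j • ψ j) (v : H) (j : ℕ) :
    inner ℝ (ψ j) (A v) = a j * inner ℝ (ψ j) v := by
  have h1 := ((ψ.hasSum_repr v).mapL A).mapL (innerSL ℝ (ψ j))
  refine h1.unique ?_
  have h2 : ∀ i, i ≠ j → innerSL ℝ (ψ j) (A (ψ.repr v i • ψ i)) = 0 := fun i hi => by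
    rw [map_smul, hA, innerSL_apply_apply, real_inner_smul_right, real_inner_smul_right,
      ψ.orthonormal.inner_eq_zero hi.symm, mul_zero, mul_zero]
  have h3 := hasSum_single j h2
  rwa [map_smul, hA, innerSL_apply_apply, real_inner_smul_right, real_inner_smul_right,
    real_inner_self_eq_norm_sq, ψ.orthonormal.1, one_pow, mul_one, HilbertBasis.repr_apply_apply,
    mul_comm] at h3

lemma norm_diagonal_le (ψ : HilbertBasis ℕ ℝ H) {A : H →L[ℝ] H} {a : ℕ → ℝ}
    (hA : ∀ j, A (ψ j) = a j • ψ j) {δ : ℝ} (hδ : 0 ≤ δ) (ha : ∀ j, |a j| ≤ δ) : ‖A‖ ≤ δ := by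
  refine A.opNorm_le_bound hδ fun v => ?_
  refine le_of_sq_le_sq ?_ (by positivity)
  have h1 := hasSum_inner_sq ψ (A v)
  have h2 := (hasSum_inner_sq ψ v).mul_left (δ ^ 2)
  rw [mul_pow]
  refine hasSum_le (fun j => ?_) h1 h2
  rw [inner_diagonal ψ hA, mul_pow]
  refine mul_le_mul_of_nonneg_right ?_ (sq_nonneg _)
  rw [← sq_abs]
  exact pow_le_pow_left₀ (abs_nonneg _) (ha j) 2

/-- The operator that inverts the eigenvalues `η j` for `j < m` and annihilates the other
eigenvectors. -/
def truncInv (ψ : HilbertBasis ℕ ℝ H) (η : ℕ → ℝ) (m : ℕ) : H →L[ℝ] H :=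
  ∑ j ∈ Finset.range m, (η j)⁻¹ • InnerProductSpace.rankOne ℝ (ψ j) (ψ j)

lemma truncInv_apply (ψ : HilbertBasis ℕ ℝ H) (η : ℕ → ℝ) (m : ℕ) (v : H) :
    truncInv ψ η m v = ∑ j ∈ Finset.range m, ((η j)⁻¹ * inner ℝ v (ψ j)) • ψ j := by
  simp only [truncInv, _root_.sum_apply, _root_.smul_apply, InnerProductSpace.rankOne_apply,
    smul_smul, real_inner_comm v]

lemma truncInv_basis (ψ : HilbertBasis ℕ ℝ H) (η : ℕ → ℝ) (m k : ℕ) :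
    truncInv ψ η m (ψ k) = (if k < m then (η k)⁻¹ else 0) • ψ k := by
  rw [truncInv_apply]
  split_ifs with hk
  · rw [Finset.sum_eq_single_of_mem k (Finset.mem_range.2 hk)]
    · rw [real_inner_self_eq_norm_sq, ψ.orthonormal.1, one_pow, mul_one]
    · intro j _ hj
      rw [ψ.orthonormal.inner_eq_zero hj.symm, mul_zero, zero_smul]
  · rw [zero_smul]
    refine Finset.sum_eq_zero fun j hj => ?_
    have : k ≠ j := by have := Finset.mem_range.1 hj; omega
    rw [ψ.orthonormal.inner_eq_zero this, mul_zero, zero_smul]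

lemma norm_sum_smul_sq (ψ : HilbertBasis ℕ ℝ H) (c : ℕ → ℝ) (m : ℕ) :
    ‖∑ j ∈ Finset.range m, c j • ψ j‖ ^ 2 = ∑ j ∈ Finset.range m, c j ^ 2 := by
  rw [← real_inner_self_eq_norm_sq, ψ.orthonormal.inner_sum]
  simp [sq]

lemma norm_truncInv_sq (ψ : HilbertBasis ℕ ℝ H) (η : ℕ → ℝ) (m : ℕ) (v : H) :
    ‖truncInv ψ η m v‖ ^ 2 = ∑ j ∈ Finset.range m, ((η j)⁻¹ * inner ℝ v (ψ j)) ^ 2 := by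
  rw [truncInv_apply, norm_sum_smul_sq]

lemma truncInv_symm (ψ : HilbertBasis ℕ ℝ H) (η : ℕ → ℝ) (m : ℕ) (u v : H) :
    inner ℝ (truncInv ψ η m u) v = inner ℝ u (truncInv ψ η m v) := by
  rw [truncInv_apply, truncInv_apply, sum_inner, inner_sum]
  refine Finset.sum_congr rfl fun j _ => ?_
  rw [real_inner_smul_left, real_inner_smul_right, real_inner_comm v]
  ring

/-- The truncated inverse of the empirical covariance operator is a measurable function of the
design alone on the event that the cut-off separates its spectrum. It is there a limit of
polynomials in the operator, so that it does not depend on the choice of the eigenvectors. -/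
lemma exists_measurable_truncInv [CompleteSpace H] [SecondCountableTopology H] [MeasurableSpace H]
    [BorelSpace H] (n m : ℕ) {lo hi : ℝ} (R : ℝ) (h0 : 0 < hi) (hlohi : lo < hi) :
    ∃ Ψ : (ℕ → H) → (H →L[ℝ] H), StronglyMeasurable Ψ ∧
      ∀ (xs : ℕ → H) (ψ : HilbertBasis ℕ ℝ H) (η : ℕ → ℝ),
        (∀ j, empOp n xs (ψ j) = η j • ψ j) → (∀ j, 0 ≤ η j) → (∀ j, η j ≤ R) →
        (∀ j < m, hi ≤ η j) → (∀ j, m ≤ j → η j ≤ lo) → Ψ xs = truncInv ψ η m := by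
  have hpoly : ∀ i : ℕ, ∃ p : Polynomial ℝ, ∀ u ∈ Set.Icc 0 R,
      |p.eval u - cutInv lo hi u| < 1 / ((i : ℝ) + 1) := fun i =>
    exists_polynomial_near_of_continuousOn 0 R _ (continuous_cutInv h0).continuousOn _
      (by positivity)
  choose p hp using hpoly
  refine ⟨fun xs => limUnder atTop fun i => Polynomial.aeval (empOp n xs) (p i),
    StronglyMeasurable.limUnder fun i =>
      ((Polynomial.continuous_aeval (p i)).comp (continuous_empOp n)).stronglyMeasurable,
    fun xs ψ η heig hη0 hηR hhi hlo => ?_⟩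
  refine Tendsto.limUnder_eq ?_
  rw [tendsto_iff_norm_sub_tendsto_zero]
  refine squeeze_zero (fun _ => norm_nonneg _) (fun i => ?_) tendsto_one_div_add_atTop_nhds_zero_nat
  refine norm_diagonal_le ψ (a := fun j => (p i).eval (η j) - cutInv lo hi (η j)) (fun j => ?_)
    (by positivity) fun j => (hp i (η j) ⟨hη0 j, hηR j⟩).le
  have hcut : cutInv lo hi (η j) = if j < m then (η j)⁻¹ else 0 := by
    split_ifs with hj
    · exact cutInv_of_ge hlohi (hhi j hj)
    · exact cutInv_of_le hlohi (hlo j (not_lt.1 hj))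
  rw [sub_apply, aeval_eigenvector (heig j), truncInv_basis, hcut, sub_smul]

end SpectralInverse

/-! ### Moments of the noise -/

section Noise

variable {H : Type*} [NormedAddCommGroup H] [InnerProductSpace ℝ H] [MeasurableSpace H]
  [BorelSpace H] [SecondCountableTopology H] {Ω : Type*} [MeasurableSpace Ω] {P : Measure Ω}
  [IsProbabilityMeasure P]

/-- Independent centred errors with all moments finite, common variance `σ2` and common fourth
moment `μ4`. -/
structure IsNoise (P : Measure Ω) (ε : ℕ → Ω → ℝ) (σ2 μ4 : ℝ) : Prop where
  measurable : ∀ i, Measurable (ε i)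
  indep : iIndepFun ε P
  integrable : ∀ i (q : ℕ), Integrable (fun ω => ε i ω ^ q) P
  mean : ∀ i, ∫ ω, ε i ω ∂P = 0
  var : ∀ i, ∫ ω, ε i ω ^ 2 ∂P = σ2
  fourth : ∀ i, ∫ ω, ε i ω ^ 4 ∂P = μ4

namespace IsNoise

variable {ε : ℕ → Ω → ℝ} {σ2 μ4 : ℝ}

omit [IsProbabilityMeasure P] in
lemma var_nonneg (h : IsNoise P ε σ2 μ4) : 0 ≤ σ2 := by
  rw [← h.var 0]; exact integral_nonneg fun ω => sq_nonneg _

lemma var_sq_le (h : IsNoise P ε σ2 μ4) : σ2 ^ 2 ≤ μ4 := by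
  have h1 : 0 ≤ ∫ ω, (ε 0 ω ^ 2 - σ2) ^ 2 ∂P := integral_nonneg fun ω => sq_nonneg _
  have h2 : ∫ ω, (ε 0 ω ^ 2 - σ2) ^ 2 ∂P = μ4 - 2 * σ2 * σ2 + σ2 ^ 2 := by
    have e : ∀ ω, (ε 0 ω ^ 2 - σ2) ^ 2 = ε 0 ω ^ 4 - 2 * σ2 * ε 0 ω ^ 2 + σ2 ^ 2 := fun ω => by ring
    have i1 := h.integrable 0 4
    have i2 := (h.integrable 0 2).const_mul (2 * σ2)
    have i12 : Integrable (fun ω => ε 0 ω ^ 4 - 2 * σ2 * ε 0 ω ^ 2) P := i1.sub i2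
    simp_rw [e]
    rw [integral_add i12 (integrable_const _), integral_sub i1 i2, integral_const_mul,
      h.var, h.fourth]
    simp
  nlinarith

omit [IsProbabilityMeasure P] [SecondCountableTopology H] in
lemma indepFun_sum (h : IsNoise P ε σ2 μ4) (v : ℕ → H) (n : ℕ) {F : H → ℝ} (hF : Continuous F)
    (k : ℕ) : IndepFun (fun ω => F (∑ i ∈ Finset.range n, ε i ω • v i)) (fun ω => ε n ω ^ k) P := by
  have h1 := h.indep.indepFun_finset (Finset.range n) {n} (by simp) h.measurable
  have hg : Measurable fun y : Finset.range n → ℝ => F (∑ i, y i • v i) := by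
    refine hF.measurable.comp (Continuous.measurable ?_)
    fun_prop
  have hk : Measurable fun y : ({n} : Finset ℕ) → ℝ => y ⟨n, by simp⟩ ^ k :=
    (measurable_pi_apply _).pow_const k
  have h2 := h1.comp hg hk
  have e : (fun ω => F (∑ i ∈ Finset.range n, ε i ω • v i)) =
      (fun y : Finset.range n → ℝ => F (∑ i, y i • v i)) ∘ fun ω i => ε i ω := by
    ext ω
    simp only [Function.comp]
    rw [← Finset.sum_coe_sort (Finset.range n)]
  rw [e]; exact h2

/-- Second and fourth moments of a random combination of fixed vectors. -/
lemma sum_moments (h : IsNoise P ε σ2 μ4) (v : ℕ → H) (n : ℕ) :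
    Integrable (fun ω => ‖∑ i ∈ Finset.range n, ε i ω • v i‖ ^ 4) P ∧
    ∫ ω, ‖∑ i ∈ Finset.range n, ε i ω • v i‖ ^ 2 ∂P = σ2 * ∑ i ∈ Finset.range n, ‖v i‖ ^ 2 ∧
    ∫ ω, ‖∑ i ∈ Finset.range n, ε i ω • v i‖ ^ 4 ∂P ≤
      3 * μ4 * (∑ i ∈ Finset.range n, ‖v i‖ ^ 2) ^ 2 := by
  induction n with
  | zero => simp
  | succ n ih =>
    obtain ⟨ih1, ih2, ih3⟩ := ih
    set A := ∑ i ∈ Finset.range n, ‖v i‖ ^ 2 with hA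
    have hA0 : 0 ≤ A := Finset.sum_nonneg fun _ _ => sq_nonneg _
    set S : Ω → H := fun ω => ∑ i ∈ Finset.range n, ε i ω • v i with hS
    have hSm : Measurable S := Finset.measurable_fun_sum _ fun i _ => (h.measurable i).smul_const _
    -- powers up to four of the norm are dominated by the fourth one
    have hdom : ∀ {F : H → ℝ}, Continuous F → ∀ K : ℝ, (∀ s, |F s| ≤ K * (1 + ‖s‖ ^ 4)) →
        Integrable (fun ω => F (S ω)) P := fun {F} hF K hK =>
      Integrable.mono' (((integrable_const 1).add ih1).const_mul K)
        (hF.measurable.comp hSm).aestronglyMeasurable (ae_of_all _ fun ω => hK _)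
    have hpow : ∀ (x : ℝ), 0 ≤ x → x ≤ 1 + x ^ 4 ∧ x ^ 2 ≤ 1 + x ^ 4 ∧ x ^ 3 ≤ 1 + x ^ 4 := by
      intro x hx
      refine ⟨?_, ?_, ?_⟩ <;>
        nlinarith [sq_nonneg (x ^ 2 - 1), sq_nonneg (x - 1), sq_nonneg (x ^ 2 - x), sq_nonneg x,
          sq_nonneg (x ^ 2)]
    set w := ‖v n‖ with hw
    have hw0 : 0 ≤ w := norm_nonneg _
    have hL : ∀ s : H, |inner ℝ s (v n)| ≤ ‖s‖ * w := fun s => abs_real_inner_le_norm _ _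
    have cL : Continuous fun s : H => inner ℝ s (v n) := by fun_prop
    have cN : Continuous fun s : H => ‖s‖ ^ 2 := by fun_prop
    have cN4 : Continuous fun s : H => ‖s‖ ^ 4 := by fun_prop
    have cL2 : Continuous fun s : H => inner ℝ s (v n) ^ 2 := by fun_prop
    have cNL : Continuous fun s : H => ‖s‖ ^ 2 * inner ℝ s (v n) := by fun_prop
    have iL : Integrable (fun ω => inner ℝ (S ω) (v n)) P := hdom cL w fun s => by
      have := hpow ‖s‖ (norm_nonneg s)
      nlinarith [hL s]
    have iN : Integrable (fun ω => ‖S ω‖ ^ 2) P := hdom cN 1 fun s => by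
      have := hpow ‖s‖ (norm_nonneg s)
      rw [abs_of_nonneg (sq_nonneg _)]; linarith
    have iL2 : Integrable (fun ω => inner ℝ (S ω) (v n) ^ 2) P := hdom cL2 (w ^ 2) fun s => by
      have := hpow ‖s‖ (norm_nonneg s)
      rw [abs_of_nonneg (sq_nonneg _), ← sq_abs]
      calc _ ≤ (‖s‖ * w) ^ 2 := pow_le_pow_left₀ (abs_nonneg _) (hL s) 2
        _ = w ^ 2 * ‖s‖ ^ 2 := by ring
        _ ≤ _ := by gcongr; exact this.2.1
    have iNL : Integrable (fun ω => ‖S ω‖ ^ 2 * inner ℝ (S ω) (v n)) P := hdom cNL w fun s => by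
      have := hpow ‖s‖ (norm_nonneg s)
      rw [abs_mul, abs_of_nonneg (sq_nonneg _)]
      calc _ ≤ ‖s‖ ^ 2 * (‖s‖ * w) := by gcongr; exact hL s
        _ = w * ‖s‖ ^ 3 := by ring
        _ ≤ _ := by gcongr; exact this.2.2
    have hprod : ∀ {F : H → ℝ}, Continuous F → Integrable (fun ω => F (S ω)) P → ∀ k : ℕ,
        Integrable (fun ω => F (S ω) * ε n ω ^ k) P ∧ ∫ ω, F (S ω) * ε n ω ^ k ∂P =
          (∫ ω, F (S ω) ∂P) * ∫ ω, ε n ω ^ k ∂P := fun {F} hF hi k =>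
      ⟨(h.indepFun_sum v n hF k).integrable_mul hi (h.integrable n k),
        (h.indepFun_sum v n hF k).integral_fun_mul_eq_mul_integral hi.aestronglyMeasurable
          (h.integrable n k).aestronglyMeasurable⟩
    have mL : ∫ ω, inner ℝ (S ω) (v n) ∂P = 0 := by
      simp only [hS, sum_inner, real_inner_smul_left]
      rw [integral_finsetSum _ fun i _ => by
        simpa using (h.integrable i 1).mul_const (inner ℝ (v i) (v n))]
      refine Finset.sum_eq_zero fun i _ => ?_
      rw [integral_mul_const, h.mean, zero_mul]
    have mL2 : ∫ ω, inner ℝ (S ω) (v n) ^ 2 ∂P ≤ w ^ 2 * (σ2 * A) := by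
      rw [← ih2, ← integral_const_mul]
      refine integral_mono iL2 (iN.const_mul _) fun ω => ?_
      calc _ = |inner ℝ (S ω) (v n)| ^ 2 := (sq_abs _).symm
        _ ≤ (‖S ω‖ * w) ^ 2 := pow_le_pow_left₀ (abs_nonneg _) (hL _) 2
        _ = _ := by ring
    have p1 := hprod cL iL 1
    have p3 := hprod cL iL 3
    have q1 := hprod cNL iNL 1
    have q2 := hprod cN iN 2
    have r2 := hprod cL2 iL2 2
    simp only [pow_one, h.mean, h.var, mul_zero, mL, zero_mul] at p1 p3 q1 q2 r2
    have hN2 : ∫ ω, ‖S ω‖ ^ 2 ∂P = σ2 * A := ih2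
    have hN4 : ∫ ω, ‖S ω‖ ^ 4 ∂P ≤ 3 * μ4 * A ^ 2 := ih3
    have e4 := h.integrable n 4
    have e2 := h.integrable n 2
    have hsq : ∀ ω, ‖∑ i ∈ Finset.range (n + 1), ε i ω • v i‖ ^ 2 =
        ‖S ω‖ ^ 2 + (2 * (inner ℝ (S ω) (v n) * ε n ω) + w ^ 2 * ε n ω ^ 2) := fun ω => by
      rw [Finset.sum_range_succ, norm_add_sq_real, real_inner_smul_right, norm_smul, mul_pow,
        Real.norm_eq_abs, sq_abs]
      ring
    have hfour : ∀ ω, ‖∑ i ∈ Finset.range (n + 1), ε i ω • v i‖ ^ 4 =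
        ‖S ω‖ ^ 4 + (4 * (inner ℝ (S ω) (v n) ^ 2 * ε n ω ^ 2) + (w ^ 4 * ε n ω ^ 4 +
          (4 * (‖S ω‖ ^ 2 * inner ℝ (S ω) (v n) * ε n ω) + (2 * w ^ 2 * (‖S ω‖ ^ 2 * ε n ω ^ 2) +
            4 * w ^ 2 * (inner ℝ (S ω) (v n) * ε n ω ^ 3))))) := fun ω => by
      rw [show ‖∑ i ∈ Finset.range (n + 1), ε i ω • v i‖ ^ 4 =
        (‖∑ i ∈ Finset.range (n + 1), ε i ω • v i‖ ^ 2) ^ 2 by ring, hsq]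
      ring
    have j6 : Integrable (fun ω => 4 * w ^ 2 * (inner ℝ (S ω) (v n) * ε n ω ^ 3)) P :=
      p3.1.const_mul _
    have j5 : Integrable (fun ω => 2 * w ^ 2 * (‖S ω‖ ^ 2 * ε n ω ^ 2)) P := q2.1.const_mul _
    have j4 : Integrable (fun ω => 4 * (‖S ω‖ ^ 2 * inner ℝ (S ω) (v n) * ε n ω)) P :=
      q1.1.const_mul _
    have j3 : Integrable (fun ω => w ^ 4 * ε n ω ^ 4) P := e4.const_mul _
    have j2 : Integrable (fun ω => 4 * (inner ℝ (S ω) (v n) ^ 2 * ε n ω ^ 2)) P :=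
      r2.1.const_mul _
    have j56 : Integrable (fun ω => 2 * w ^ 2 * (‖S ω‖ ^ 2 * ε n ω ^ 2) +
      4 * w ^ 2 * (inner ℝ (S ω) (v n) * ε n ω ^ 3)) P := j5.add j6
    have j46 : Integrable (fun ω => 4 * (‖S ω‖ ^ 2 * inner ℝ (S ω) (v n) * ε n ω) +
      (2 * w ^ 2 * (‖S ω‖ ^ 2 * ε n ω ^ 2) +
      4 * w ^ 2 * (inner ℝ (S ω) (v n) * ε n ω ^ 3))) P := j4.add j56
    have j36 : Integrable (fun ω => w ^ 4 * ε n ω ^ 4 +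
      (4 * (‖S ω‖ ^ 2 * inner ℝ (S ω) (v n) * ε n ω) +
      (2 * w ^ 2 * (‖S ω‖ ^ 2 * ε n ω ^ 2) +
      4 * w ^ 2 * (inner ℝ (S ω) (v n) * ε n ω ^ 3)))) P := j3.add j46
    have j26 : Integrable (fun ω => 4 * (inner ℝ (S ω) (v n) ^ 2 * ε n ω ^ 2) +
      (w ^ 4 * ε n ω ^ 4 + (4 * (‖S ω‖ ^ 2 * inner ℝ (S ω) (v n) * ε n ω) +
      (2 * w ^ 2 * (‖S ω‖ ^ 2 * ε n ω ^ 2) +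
      4 * w ^ 2 * (inner ℝ (S ω) (v n) * ε n ω ^ 3))))) P := j2.add j36
    have k1 : Integrable (fun ω => 2 * (inner ℝ (S ω) (v n) * ε n ω)) P := p1.1.const_mul _
    have k2 : Integrable (fun ω => w ^ 2 * ε n ω ^ 2) P := e2.const_mul _
    have k12 : Integrable (fun ω => 2 * (inner ℝ (S ω) (v n) * ε n ω) + w ^ 2 * ε n ω ^ 2) P :=
      k1.add k2
    refine ⟨?_, ?_, ?_⟩
    · simp_rw [hfour]; exact ih1.add j26
    · simp_rw [hsq]
      rw [integral_add iN k12, integral_add k1 k2, integral_const_mul, integral_const_mul, p1.2,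
        h.var, ih2, Finset.sum_range_succ, ← hA, ← hw]
      ring
    · simp_rw [hfour]
      rw [integral_add ih1 j26, integral_add j2 j36, integral_add j3 j46, integral_add j4 j56,
        integral_add j5 j6, integral_const_mul, integral_const_mul, integral_const_mul,
        integral_const_mul, integral_const_mul, p3.2, q1.2, q2.2, r2.2, hN2, h.fourth,
        Finset.sum_range_succ, ← hA, ← hw]
      have h1 := h.var_sq_le
      have h2 := h.var_nonneg
      have h3 : (∫ ω, inner ℝ (S ω) (v n) ^ 2 ∂P) * σ2 ≤ w ^ 2 * (σ2 * A) * σ2 :=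
        mul_le_mul_of_nonneg_right mL2 h2
      have h4 : σ2 ^ 2 * (A * w ^ 2) ≤ μ4 * (A * w ^ 2) :=
        mul_le_mul_of_nonneg_right h1 (by positivity)
      change ∫ ω, ‖S ω‖ ^ 4 ∂P + _ ≤ _
      have h5 : 0 ≤ μ4 * w ^ 4 := mul_nonneg ((sq_nonneg _).trans h1) (by positivity)
      nlinarith

end IsNoise

omit [BorelSpace H] [SecondCountableTopology H] [MeasurableSpace H] [NormedAddCommGroup H]
  [InnerProductSpace ℝ H] in
/-- Integrating out the second of two independent variables. -/
lemma lintegral_indep_le {E₁ E₂ : Type*} [MeasurableSpace E₁] [MeasurableSpace E₂] {U : Ω → E₁}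
    {V : Ω → E₂} (hU : Measurable U) (hV : Measurable V) (hUV : IndepFun U V P)
    {F : E₁ × E₂ → ℝ≥0∞} (hF : Measurable F) {G : E₁ → ℝ≥0∞}
    (hG : ∀ u, ∫⁻ ω, F (u, V ω) ∂P ≤ G u) :
    ∫⁻ ω, F (U ω, V ω) ∂P ≤ ∫⁻ ω, G (U ω) ∂P := by
  have hmap := (indepFun_iff_map_prod_eq_prod_map_map hU.aemeasurable hV.aemeasurable).1 hUV
  have : IsProbabilityMeasure (P.map V) := Measure.isProbabilityMeasure_map hV.aemeasurable
  calc ∫⁻ ω, F (U ω, V ω) ∂P = ∫⁻ z, F z ∂(P.map fun ω => (U ω, V ω)) :=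
        (lintegral_map hF (hU.prodMk hV)).symm
    _ = ∫⁻ u, ∫⁻ v, F (u, v) ∂(P.map V) ∂(P.map U) := by
        rw [hmap, lintegral_prod _ hF.aemeasurable]
    _ = ∫⁻ ω, ∫⁻ v, F (U ω, v) ∂(P.map V) ∂P := lintegral_map hF.lintegral_prod_right' hU
    _ ≤ _ := by
        refine lintegral_mono fun ω => ?_
        exact (lintegral_map (hF.comp measurable_prodMk_left) hV).le.trans (hG _)

end Noise

/-! ### The contribution of the noise to the estimator -/

section NoiseIntegral

variable {H : Type*} [NormedAddCommGroup H] [InnerProductSpace ℝ H] [MeasurableSpace H]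
  [BorelSpace H] [SecondCountableTopology H] {Ω : Type*} [MeasurableSpace Ω] {P : Measure Ω}
  [IsProbabilityMeasure P] {ε : ℕ → Ω → ℝ} {σ2 μ4 : ℝ}

lemma IsNoise.lintegral_sum_fourth_le (h : IsNoise P ε σ2 μ4) (v : ℕ → H) (n : ℕ) :
    ∫⁻ ω, ENNReal.ofReal (‖∑ i ∈ Finset.range n, ε i ω • v i‖ ^ 4) ∂P ≤
      ENNReal.ofReal (3 * μ4 * (∑ i ∈ Finset.range n, ‖v i‖ ^ 2) ^ 2) := by
  obtain ⟨h1, -, h3⟩ := h.sum_moments v n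
  rw [← ofReal_integral_eq_lintegral_ofReal h1 (ae_of_all _ fun ω => by positivity)]
  exact ENNReal.ofReal_le_ofReal h3

lemma IsNoise.lintegral_sum_sq_le (h : IsNoise P ε σ2 μ4) (c : ℕ → ℝ) (n : ℕ) :
    ∫⁻ ω, ENNReal.ofReal ((∑ i ∈ Finset.range n, ε i ω * c i) ^ 2) ∂P ≤
      ENNReal.ofReal (σ2 * ∑ i ∈ Finset.range n, c i ^ 2) := by
  obtain ⟨h1, h2, -⟩ := h.sum_moments c n
  have hm : Measurable fun ω => ∑ i ∈ Finset.range n, ε i ω * c i :=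
    Finset.measurable_fun_sum _ fun i _ => (h.measurable i).mul_const _
  simp only [smul_eq_mul, Real.norm_eq_abs, sq_abs] at h1 h2
  have hint : Integrable (fun ω => (∑ i ∈ Finset.range n, ε i ω * c i) ^ 2) P := by
    refine Integrable.mono' ((integrable_const 1).add h1) (hm.pow_const 2).aestronglyMeasurable
      (ae_of_all _ fun ω => ?_)
    rw [Real.norm_eq_abs, abs_of_nonneg (sq_nonneg _)]
    simp only [Pi.add_apply, Even.pow_abs (show Even 4 by decide)]
    nlinarith [sq_nonneg ((∑ i ∈ Finset.range n, ε i ω * c i) ^ 2 - 1),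
      sq_nonneg ((∑ i ∈ Finset.range n, ε i ω * c i) ^ 2)]
  rw [← ofReal_integral_eq_lintegral_ofReal hint (ae_of_all _ fun ω => sq_nonneg _)]
  exact ENNReal.ofReal_le_ofReal h2.le

/-- The empirical cross-covariance of design and noise. The errors need not be centred at their
mean, as the centred design adds up to zero. -/
def noiseVec (n : ℕ) (xs : ℕ → H) (e : ℕ → ℝ) : H :=
  (n : ℝ)⁻¹ • ∑ i ∈ Finset.range n, e i • (xs i - empMean n xs)

omit [MeasurableSpace H] [BorelSpace H] [SecondCountableTopology H] in
lemma sum_inner_sq_eq (n : ℕ) (xs : ℕ → H) (u : H) :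
    ∑ i ∈ Finset.range n, ((n : ℝ)⁻¹ * inner ℝ (xs i - empMean n xs) u) ^ 2 =
      (n : ℝ)⁻¹ * inner ℝ u (empOp n xs u) := by
  rw [inner_empOp, Finset.mul_sum, Finset.mul_sum]
  exact Finset.sum_congr rfl fun i _ => by ring

omit [MeasurableSpace H] [BorelSpace H] [SecondCountableTopology H] in
lemma inner_truncInv_empOp {n m : ℕ} {xs : ℕ → H} {ψ : HilbertBasis ℕ ℝ H} {η : ℕ → ℝ}
    (heig : ∀ j, empOp n xs (ψ j) = η j • ψ j) (hη : ∀ j < m, 0 < η j) (x : H) :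
    inner ℝ (truncInv ψ η m x) (empOp n xs (truncInv ψ η m x)) =
      ∑ j ∈ Finset.range m, (η j)⁻¹ * inner ℝ x (ψ j) ^ 2 := by
  rw [truncInv_apply, map_sum]
  simp only [map_smul, heig, smul_smul]
  rw [ψ.orthonormal.inner_sum]
  refine Finset.sum_congr rfl fun j hj => ?_
  have := (hη j (Finset.mem_range.1 hj)).ne'
  simp only [conj_trivial]
  field_simp

omit [MeasurableSpace H] [BorelSpace H] [SecondCountableTopology H] in
lemma sum_norm_truncInv_sq {n m : ℕ} {xs : ℕ → H} {ψ : HilbertBasis ℕ ℝ H} {η : ℕ → ℝ}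
    (heig : ∀ j, empOp n xs (ψ j) = η j • ψ j) (hη : ∀ j < m, 0 < η j) :
    ∑ i ∈ Finset.range n, ‖(n : ℝ)⁻¹ • truncInv ψ η m (xs i - empMean n xs)‖ ^ 2 =
      (n : ℝ)⁻¹ * ∑ j ∈ Finset.range m, (η j)⁻¹ := by
  have h1 : ∀ i, ‖(n : ℝ)⁻¹ • truncInv ψ η m (xs i - empMean n xs)‖ ^ 2 =
      ∑ j ∈ Finset.range m, (η j)⁻¹ ^ 2 *
        ((n : ℝ)⁻¹ * inner ℝ (xs i - empMean n xs) (ψ j)) ^ 2 := fun i => by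
    rw [norm_smul, mul_pow, norm_truncInv_sq, Finset.mul_sum, Real.norm_eq_abs, sq_abs]
    exact Finset.sum_congr rfl fun j _ => by ring
  simp_rw [h1]
  rw [Finset.sum_comm, Finset.mul_sum]
  refine Finset.sum_congr rfl fun j hj => ?_
  have := (hη j (Finset.mem_range.1 hj)).ne'
  rw [← Finset.mul_sum, sum_inner_sq_eq, heig, real_inner_smul_right, real_inner_self_eq_norm_sq,
    ψ.orthonormal.1]
  field_simp

lemma measurable_empMean (n : ℕ) : Measurable (empMean n : (ℕ → H) → H) :=
  (continuous_empMean n).measurable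

/-- Moments of the noise part of the estimator, on an event that depends on the design only and on
which the cut-off separates the spectrum: conditionally on the design, the noise is a combination of
the errors with fixed coefficients. -/
lemma lintegral_noise_le [CompleteSpace H] {X : ℕ → Ω → H} (hX : ∀ i, Measurable (X i))
    (hε : IsNoise P ε σ2 μ4)
    (hXε : IndepFun (fun ω i => X i ω) (fun ω i => ε i ω) P) (n m : ℕ) {lo hi : ℝ} (R : ℝ)
    (h0 : 0 < hi) (hlohi : lo < hi) {G : Set (ℕ → H)} (hG : MeasurableSet G)
    (ψ : Ω → HilbertBasis ℕ ℝ H) (η : Ω → ℕ → ℝ)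
    (hgood : ∀ ω, (fun i => X i ω) ∈ G →
      (∀ j, empOp n (fun i => X i ω) (ψ ω j) = η ω j • ψ ω j) ∧ (∀ j, 0 ≤ η ω j) ∧
      (∀ j, η ω j ≤ R) ∧ (∀ j < m, hi ≤ η ω j) ∧ ∀ j, m ≤ j → η ω j ≤ lo) (x : H) :
    ∫⁻ ω, {ω | (fun i => X i ω) ∈ G}.indicator (fun ω => ENNReal.ofReal
        (inner ℝ (truncInv (ψ ω) (η ω) m (noiseVec n (fun i => X i ω) (fun i => ε i ω))) x ^ 2)) ω ∂P
      ≤ ∫⁻ ω, {ω | (fun i => X i ω) ∈ G}.indicator (fun ω => ENNReal.ofReal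
        (σ2 * ((n : ℝ)⁻¹ * ∑ j ∈ Finset.range m, (η ω j)⁻¹ * inner ℝ x (ψ ω j) ^ 2))) ω ∂P ∧
    ∫⁻ ω, {ω | (fun i => X i ω) ∈ G}.indicator (fun ω => ENNReal.ofReal
        (‖truncInv (ψ ω) (η ω) m (noiseVec n (fun i => X i ω) (fun i => ε i ω))‖ ^ 4)) ω ∂P
      ≤ ∫⁻ ω, {ω | (fun i => X i ω) ∈ G}.indicator (fun ω => ENNReal.ofReal
        (3 * μ4 * ((n : ℝ)⁻¹ * ∑ j ∈ Finset.range m, (η ω j)⁻¹) ^ 2)) ω ∂P ∧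
    Measurable ({ω | (fun i => X i ω) ∈ G}.indicator fun ω => ENNReal.ofReal
      (inner ℝ (truncInv (ψ ω) (η ω) m (noiseVec n (fun i => X i ω) (fun i => ε i ω))) x ^ 2)) := by
  -- `Ψ` depends on the design only, so that the errors can be integrated out first
  obtain ⟨Ψ, hΨm, hΨ⟩ := exists_measurable_truncInv (H := H) n m R h0 hlohi
  have hXm : Measurable fun ω i => X i ω := measurable_pi_iff.2 hX
  have hεm : Measurable fun ω i => ε i ω := measurable_pi_iff.2 hε.measurable
  have hcm : ∀ i, Measurable fun xs : ℕ → H => xs i - empMean n xs := fun i =>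
    (measurable_pi_apply i).sub (measurable_empMean n)
  have hΨx : Measurable fun xs => Ψ xs x := 
    (((ContinuousLinearMap.apply ℝ H x).continuous).comp_stronglyMeasurable hΨm).measurable
  have hΨc : ∀ i, Measurable fun xs => Ψ xs (xs i - empMean n xs) := fun i => by
    have h1 : StronglyMeasurable fun xs => (Ψ xs, xs i - empMean n xs) :=
      MeasureTheory.StronglyMeasurable.prodMk hΨm (hcm i).stronglyMeasurable
    have h2 : Continuous fun q : (H →L[ℝ] H) × H => q.1 q.2 :=
      continuous_fst.clm_apply continuous_snd
    exact (h2.comp_stronglyMeasurable h1).measurable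
  have hE : ∀ i, Measurable fun z : (ℕ → H) × (ℕ → ℝ) => z.2 i := fun i =>
    (measurable_pi_apply i).comp measurable_snd
  rw [← and_assoc, and_right_comm]
  constructor
  · set F : (ℕ → H) × (ℕ → ℝ) → ℝ≥0∞ := (Prod.fst ⁻¹' G).indicator fun z =>
      ENNReal.ofReal ((∑ i ∈ Finset.range n,
        z.2 i * ((n : ℝ)⁻¹ * inner ℝ (z.1 i - empMean n z.1) (Ψ z.1 x))) ^ 2) with hF
    set K : (ℕ → H) → ℝ≥0∞ := G.indicator fun xs => ENNReal.ofReal (σ2 *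
      ∑ i ∈ Finset.range n, ((n : ℝ)⁻¹ * inner ℝ (xs i - empMean n xs) (Ψ xs x)) ^ 2) with hK
    have hFm : Measurable F := by
      refine Measurable.indicator ?_ (measurable_fst hG)
      refine ((Finset.measurable_fun_sum _ fun i _ => (hE i).mul ?_).pow_const 2).ennreal_ofReal
      exact (((hcm i).inner hΨx).const_mul _).comp measurable_fst
    have hle := lintegral_indep_le hXm hεm hXε hFm (G := K) fun xs => by
      by_cases hxs : xs ∈ G
      · have e : ∀ e : ℕ → ℝ, F (xs, e) = ENNReal.ofReal ((∑ i ∈ Finset.range n,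
            e i * ((n : ℝ)⁻¹ * inner ℝ (xs i - empMean n xs) (Ψ xs x))) ^ 2) := fun e => by
          rw [hF, Set.indicator_of_mem (show (xs, e) ∈ Prod.fst ⁻¹' G from hxs)]
        simp_rw [e]
        rw [hK, Set.indicator_of_mem hxs]
        exact hε.lintegral_sum_sq_le _ n
      · have e : ∀ e : ℕ → ℝ, F (xs, e) = 0 := fun e => by
          rw [hF, Set.indicator_of_notMem (show (xs, e) ∉ Prod.fst ⁻¹' G from hxs)]
        simp_rw [e]
        simp
    have hpt : ({ω | (fun i => X i ω) ∈ G}.indicator fun ω => ENNReal.ofReal (inner ℝ (truncInv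
        (ψ ω) (η ω) m (noiseVec n (fun i => X i ω) (fun i => ε i ω))) x ^ 2)) =
        fun ω => F (fun i => X i ω, fun i => ε i ω) := by
      funext ω
      by_cases hω : (fun i => X i ω) ∈ G
      · obtain ⟨h1, h2, h3, h4, h5⟩ := hgood ω hω
        have hΨω := hΨ _ (ψ ω) (η ω) h1 h2 h3 h4 h5
        rw [Set.indicator_of_mem (show ω ∈ {ω | (fun i => X i ω) ∈ G} from hω), hF,
          Set.indicator_of_mem (show ((fun i => X i ω), fun i => ε i ω) ∈ Prod.fst ⁻¹' G from hω)]
        congr 2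
        rw [truncInv_symm, ← hΨω, noiseVec, real_inner_smul_left, sum_inner, Finset.mul_sum]
        refine Finset.sum_congr rfl fun i _ => ?_
        rw [real_inner_smul_left]; ring
      · rw [Set.indicator_of_notMem (show ω ∉ {ω | (fun i => X i ω) ∈ G} from hω), hF,
          Set.indicator_of_notMem (show ((fun i => X i ω), fun i => ε i ω) ∉ Prod.fst ⁻¹' G from hω)]
    refine ⟨(lintegral_congr fun ω => congrFun hpt ω).le.trans (hle.trans (le_of_eq ?_)), ?_⟩
    · refine lintegral_congr fun ω => ?_
      by_cases hω : (fun i => X i ω) ∈ G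
      · obtain ⟨h1, h2, h3, h4, h5⟩ := hgood ω hω
        have hΨω := hΨ _ (ψ ω) (η ω) h1 h2 h3 h4 h5
        rw [Set.indicator_of_mem (show ω ∈ {ω | (fun i => X i ω) ∈ G} from hω), hK,
          Set.indicator_of_mem hω, sum_inner_sq_eq n (fun i => X i ω), hΨω,
          inner_truncInv_empOp h1 fun j hj => h0.trans_le (h4 j hj)]
      · rw [Set.indicator_of_notMem (show ω ∉ {ω | (fun i => X i ω) ∈ G} from hω), hK,
          Set.indicator_of_notMem hω]
    · rw [hpt]
      exact hFm.comp (hXm.prodMk hεm)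
  · set F : (ℕ → H) × (ℕ → ℝ) → ℝ≥0∞ := (Prod.fst ⁻¹' G).indicator fun z =>
      ENNReal.ofReal (‖∑ i ∈ Finset.range n,
        z.2 i • ((n : ℝ)⁻¹ • Ψ z.1 (z.1 i - empMean n z.1))‖ ^ 4) with hF
    set K : (ℕ → H) → ℝ≥0∞ := G.indicator fun xs => ENNReal.ofReal (3 * μ4 *
      (∑ i ∈ Finset.range n, ‖(n : ℝ)⁻¹ • Ψ xs (xs i - empMean n xs)‖ ^ 2) ^ 2) with hK
    have hFm : Measurable F := by
      refine Measurable.indicator ?_ (measurable_fst hG)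
      refine ((Finset.measurable_fun_sum _ fun i _ => (hE i).smul ?_).norm.pow_const
        4).ennreal_ofReal
      exact ((hΨc i).const_smul ((n : ℝ)⁻¹)).comp measurable_fst
    have hle := lintegral_indep_le hXm hεm hXε hFm (G := K) fun xs => by
      by_cases hxs : xs ∈ G
      · have e : ∀ e : ℕ → ℝ, F (xs, e) = ENNReal.ofReal (‖∑ i ∈ Finset.range n,
            e i • ((n : ℝ)⁻¹ • Ψ xs (xs i - empMean n xs))‖ ^ 4) := fun e => by
          rw [hF, Set.indicator_of_mem (show (xs, e) ∈ Prod.fst ⁻¹' G from hxs)]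
        simp_rw [e]
        rw [hK, Set.indicator_of_mem hxs]
        exact hε.lintegral_sum_fourth_le _ n
      · have e : ∀ e : ℕ → ℝ, F (xs, e) = 0 := fun e => by
          rw [hF, Set.indicator_of_notMem (show (xs, e) ∉ Prod.fst ⁻¹' G from hxs)]
        simp_rw [e]
        simp
    refine le_trans (le_of_eq ?_) (hle.trans (le_of_eq ?_))
    · refine lintegral_congr fun ω => ?_
      by_cases hω : (fun i => X i ω) ∈ G
      · obtain ⟨h1, h2, h3, h4, h5⟩ := hgood ω hω
        have hΨω := hΨ _ (ψ ω) (η ω) h1 h2 h3 h4 h5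
        rw [Set.indicator_of_mem (show ω ∈ {ω | (fun i => X i ω) ∈ G} from hω), hF,
          Set.indicator_of_mem (show ((fun i => X i ω), fun i => ε i ω) ∈ Prod.fst ⁻¹' G from hω)]
        congr 3
        rw [← hΨω, noiseVec, map_smul, map_sum, Finset.smul_sum]
        refine Finset.sum_congr rfl fun i _ => ?_
        rw [map_smul, smul_comm]
      · rw [Set.indicator_of_notMem (show ω ∉ {ω | (fun i => X i ω) ∈ G} from hω), hF,
          Set.indicator_of_notMem (show ((fun i => X i ω), fun i => ε i ω) ∉ Prod.fst ⁻¹' G from hω)]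
    · refine lintegral_congr fun ω => ?_
      by_cases hω : (fun i => X i ω) ∈ G
      · obtain ⟨h1, h2, h3, h4, h5⟩ := hgood ω hω
        have hΨω := hΨ _ (ψ ω) (η ω) h1 h2 h3 h4 h5
        rw [Set.indicator_of_mem (show ω ∈ {ω | (fun i => X i ω) ∈ G} from hω), hK,
          Set.indicator_of_mem hω, hΨω,
          sum_norm_truncInv_sq h1 fun j hj => h0.trans_le (h4 j hj)]
      · rw [Set.indicator_of_notMem (show ω ∉ {ω | (fun i => X i ω) ∈ G} from hω), hK,
          Set.indicator_of_notMem hω]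

end NoiseIntegral

/-! ### Power sums and the order of the cut-off -/

lemma rpow_le_telescope {r : ℝ} (hr : -1 < r) (hr0 : r ≤ 0) (j : ℕ) :
    (r + 1) * ((j : ℝ) + 1) ^ r ≤ ((j : ℝ) + 1) ^ (r + 1) - (j : ℝ) ^ (r + 1) := by
  have hj : (0 : ℝ) < (j : ℝ) + 1 := by positivity
  have hs : -1 ≤ -((j : ℝ) + 1)⁻¹ := by
    have : ((j : ℝ) + 1)⁻¹ ≤ 1 := inv_le_one_of_one_le₀ (by linarith [(Nat.cast_nonneg j : (0:ℝ) ≤ j)])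
    linarith
  have h := rpow_one_add_le_one_add_mul_self hs (p := r + 1) (by linarith) (by linarith)
  have h1 : (j : ℝ) = ((j : ℝ) + 1) * (1 + -((j : ℝ) + 1)⁻¹) := by field_simp; ring
  have h2 : (j : ℝ) ^ (r + 1) = ((j : ℝ) + 1) ^ (r + 1) * (1 + -((j : ℝ) + 1)⁻¹) ^ (r + 1) := by
    conv_lhs => rw [h1]
    exact Real.mul_rpow hj.le (by linarith)
  have h3 : ((j : ℝ) + 1) ^ r = ((j : ℝ) + 1) ^ (r + 1) * ((j : ℝ) + 1)⁻¹ := by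
    rw [Real.rpow_add_one hj.ne']; field_simp
  have h4 := mul_le_mul_of_nonneg_left h (Real.rpow_nonneg hj.le (r + 1))
  rw [h2, h3]; nlinarith

lemma exists_sum_rpow_le {r : ℝ} (hr : -1 < r) :
    ∃ K : ℝ, 0 ≤ K ∧ ∀ m : ℕ, ∑ j ∈ Finset.range m, ((j : ℝ) + 1) ^ r ≤ K * (m : ℝ) ^ (r + 1) := by
  rcases le_total 0 r with h0 | h0
  · exact ⟨1, zero_le_one, fun m => by rw [one_mul]; exact sum_add_one_rpow_le h0 m⟩
  · have hp : 0 < r + 1 := by linarith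
    refine ⟨(r + 1)⁻¹, (inv_pos.2 hp).le, fun m => ?_⟩
    rw [inv_mul_eq_div, le_div_iff₀ hp, Finset.sum_mul]
    have h1 := Finset.sum_range_sub (fun j : ℕ => (j : ℝ) ^ (r + 1)) m
    simp only [Nat.cast_zero, Real.zero_rpow hp.ne', sub_zero] at h1
    rw [← h1]
    refine Finset.sum_le_sum fun j _ => ?_
    have := rpow_le_telescope hr h0 j
    push_cast; linarith

lemma tail_le_telescope {q : ℝ} (hq : 1 ≤ q) {j : ℕ} (hj : 1 ≤ j) :
    ((j : ℝ) + 1) ^ (-(q + 1)) ≤ (j : ℝ) ^ (-q) - ((j : ℝ) + 1) ^ (-q) := by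
  have hj0 : (0 : ℝ) < j := by exact_mod_cast hj
  have hj1 : (0 : ℝ) < (j : ℝ) + 1 := by positivity
  have h := one_add_mul_self_le_rpow_one_add (s := (j : ℝ)⁻¹) (p := q)
    (by linarith [inv_pos.2 hj0]) hq
  have h1 : (j : ℝ) ^ (-q) = ((j : ℝ) + 1) ^ (-q) * (1 + (j : ℝ)⁻¹) ^ q := by
    have : (1 + (j : ℝ)⁻¹) = ((j : ℝ) + 1) / j := by field_simp
    rw [this, Real.div_rpow hj1.le hj0.le, Real.rpow_neg hj1.le, Real.rpow_neg hj0.le]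
    have := (Real.rpow_pos_of_pos hj1 q).ne'
    field_simp
  have h2 : ((j : ℝ) + 1) ^ (-(q + 1)) = ((j : ℝ) + 1) ^ (-q) * ((j : ℝ) + 1)⁻¹ := by
    rw [neg_add, ← sub_eq_add_neg, Real.rpow_sub_one hj1.ne']; rfl
  have h3 : ((j : ℝ) + 1)⁻¹ ≤ q * (j : ℝ)⁻¹ := by
    have : ((j : ℝ) + 1)⁻¹ ≤ (j : ℝ)⁻¹ := inv_anti₀ hj0 (by linarith)
    nlinarith [inv_pos.2 hj0]
  have h4 := mul_le_mul_of_nonneg_left (h3.trans (by linarith : q * (j : ℝ)⁻¹ ≤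
    (1 + (j : ℝ)⁻¹) ^ q - 1)) (Real.rpow_nonneg hj1.le (-q))
  rw [h2, h1]; nlinarith

/-- The tail of the inner product of `b` and `x` beyond the cut-off. -/
lemma abs_partial_inner_sub_le {H : Type*} [NormedAddCommGroup H] [InnerProductSpace ℝ H]
    (φ : HilbertBasis ℕ ℝ H) {β γ C₁ C₂ : ℝ} (hC₁ : 0 ≤ C₁) (hq : 2 ≤ β + γ)
    {b x : H} (hb : ∀ j : ℕ, |inner ℝ b (φ j)| ≤ C₁ * ((j : ℝ) + 1) ^ (-β))
    (hx : ∀ j : ℕ, |inner ℝ x (φ j)| ≤ C₂ * ((j : ℝ) + 1) ^ (-γ)) {m : ℕ} (hm : 1 ≤ m) :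
    |∑ j ∈ Finset.range m, inner ℝ b (φ j) * inner ℝ x (φ j) - inner ℝ b x| ≤
      C₁ * C₂ * (m : ℝ) ^ (-(β + γ - 1)) := by
  have hC₂ : 0 ≤ C₂ := by have := (abs_nonneg _).trans (hx 0); simpa using this
  have hsum : HasSum (fun j => inner ℝ b (φ j) * inner ℝ x (φ j)) (inner ℝ b x) := by
    have := φ.hasSum_inner_mul_inner b x
    refine this.congr_fun fun j => ?_
    rw [real_inner_comm x]
  have hlim := hsum.tendsto_sum_nat
  refine le_of_tendsto ((tendsto_const_nhds.sub hlim).abs) ?_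
  filter_upwards [eventually_ge_atTop m] with N hN
  rw [abs_sub_comm, ← Finset.sum_Ico_eq_sub _ hN]
  refine (Finset.abs_sum_le_sum_abs _ _).trans ?_
  have h1 : ∀ j ∈ Finset.Ico m N, |inner ℝ b (φ j) * inner ℝ x (φ j)| ≤
      C₁ * C₂ * ((j : ℝ) ^ (-(β + γ - 1)) - ((j : ℝ) + 1) ^ (-(β + γ - 1))) := fun j hj => by
    have hj1 : 1 ≤ j := hm.trans (Finset.mem_Ico.1 hj).1
    have hjp : (0 : ℝ) < (j : ℝ) + 1 := by positivity
    have h2 := tail_le_telescope (q := β + γ - 1) (by linarith) hj1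
    rw [abs_mul]
    calc _ ≤ (C₁ * ((j : ℝ) + 1) ^ (-β)) * (C₂ * ((j : ℝ) + 1) ^ (-γ)) :=
          mul_le_mul (hb j) (hx j) (abs_nonneg _) (by positivity)
      _ = C₁ * C₂ * ((j : ℝ) + 1) ^ (-(β + γ - 1 + 1)) := by
          rw [show -(β + γ - 1 + 1) = -β + -γ by ring, Real.rpow_add hjp]; ring
      _ ≤ _ := mul_le_mul_of_nonneg_left h2 (by positivity)
  refine (Finset.sum_le_sum h1).trans ?_
  rw [← Finset.mul_sum]
  refine mul_le_mul_of_nonneg_left ?_ (by positivity)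
  have h4 : ∑ j ∈ Finset.Ico m N, ((j : ℝ) ^ (-(β + γ - 1)) - ((j : ℝ) + 1) ^ (-(β + γ - 1))) =
      (m : ℝ) ^ (-(β + γ - 1)) - (N : ℝ) ^ (-(β + γ - 1)) := by
    have h3 := Finset.sum_Ico_sub (fun j : ℕ => (j : ℝ) ^ (-(β + γ - 1))) hN
    rw [← neg_sub ((N : ℝ) ^ _), ← h3, ← Finset.sum_neg_distrib]
    exact Finset.sum_congr rfl fun j _ => by push_cast; ring
  rw [h4]
  linarith [Real.rpow_nonneg (Nat.cast_nonneg N : (0:ℝ) ≤ N) (-(β + γ - 1))]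

/-- The effective sample size, of which the cut-off is a power. -/
def effSize (α γ : ℝ) (n : ℕ) : ℝ := if α + 1 = 2 * γ then (n : ℝ) / Real.log n else n

/-- The exponent that relates the cut-off to the effective sample size. -/
def cutExp (α β γ : ℝ) : ℝ := if α + 1 < 2 * γ then 2 * (β + γ - 1) else α + 2 * β - 1

lemma mZero_eq (α β γ : ℝ) (n : ℕ) : mZero α β γ n = effSize α γ n ^ (1 / cutExp α β γ) := by
  unfold mZero effSize cutExp
  split_ifs <;> first | rfl | linarith

lemma le_cutExp {α β γ : ℝ} (hβ : α + 2 ≤ β) : 3 * (α + 1) ≤ cutExp α β γ := by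
  unfold cutExp; split_ifs <;> linarith

lemma two_mul_le_cutExp (α β γ : ℝ) : 2 * (β + γ - 1) ≤ cutExp α β γ := by
  unfold cutExp; split_ifs <;> linarith

lemma tendsto_effSize (α γ : ℝ) : Tendsto (effSize α γ) atTop atTop := by
  unfold effSize
  split_ifs
  · have h := (Real.isLittleO_log_id_atTop).comp_tendsto tendsto_natCast_atTop_atTop
    have h2 : Tendsto (fun n : ℕ => Real.log n / (n : ℝ)) atTop (𝓝[>] 0) := by
      refine tendsto_nhdsWithin_iff.2 ⟨h.tendsto_div_nhds_zero, ?_⟩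
      filter_upwards [eventually_ge_atTop 2] with n hn
      have h1 : (1 : ℝ) < n := by exact_mod_cast hn
      exact div_pos (Real.log_pos h1) (by linarith)
    refine h2.inv_tendsto_nhdsGT_zero.congr fun n => ?_
    simp [inv_div]
  · exact tendsto_natCast_atTop_atTop

lemma effSize_le (α γ : ℝ) : ∀ᶠ n : ℕ in atTop, effSize α γ n ≤ n := by
  filter_upwards [eventually_ge_atTop 3] with n hn
  have h3 : (3 : ℝ) ≤ n := by exact_mod_cast hn
  unfold effSize
  split_ifs
  · refine div_le_self (by linarith) ?_
    rw [Real.le_log_iff_exp_le (by linarith)]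
    linarith [Real.exp_one_lt_d9]
  · exact le_rfl

/-- In all three cases the rate is the squared order of the tail at the cut-off. -/
lemma tau_eq {α β γ : ℝ} (he : 0 < cutExp α β γ) :
    ∀ᶠ n : ℕ in atTop, tau α β γ n = mZero α β γ n ^ (-(2 * (β + γ - 1))) := by
  filter_upwards [(tendsto_effSize α γ).eventually_gt_atTop 0] with n hn
  rw [mZero_eq, ← Real.rpow_mul hn.le]
  unfold tau
  unfold effSize cutExp at *
  split_ifs at * with h1 h2 h2
  · linarith
  · have : 1 / (2 * (β + γ - 1)) * -(2 * (β + γ - 1)) = -1 := by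
      rw [one_div, inv_mul_eq_div, neg_div, div_self he.ne']
    rw [this, Real.rpow_neg_one]
  · have : 1 / (α + 2 * β - 1) * -(2 * (β + γ - 1)) = -1 := by
      rw [show 2 * (β + γ - 1) = α + 2 * β - 1 by linarith]; field_simp
    rw [this, Real.rpow_neg_one, inv_div, div_eq_inv_mul]
  · congr 1; ring

/-- The properties of the cut-off on which the rate of convergence depends. -/
lemma exists_rate_bounds {α β γ : ℝ} (hα : 1 < α) (hβ : α + 2 ≤ β) (hγ : 1 / 2 < γ) {m : ℕ → ℕ}
    (hm : (fun n => (m n : ℝ)) =Θ[atTop] mZero α β γ) :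
    ∃ K : ℝ, 0 < K ∧ ∀ᶠ n : ℕ in atTop, 1 ≤ m n ∧ (m n : ℝ) ^ (3 * (α + 1)) ≤ K * n ∧
      (m n : ℝ) ^ (-(2 * (β + γ - 1))) ≤ K * tau α β γ n ∧
      (n : ℝ)⁻¹ * ∑ j ∈ Finset.range (m n), ((j : ℝ) + 1) ^ (α - 2 * γ) ≤ K * tau α β γ n ∧
      (n : ℝ)⁻¹ ≤ tau α β γ n := by
  have hle := le_cutExp (γ := γ) hβ
  have he : 0 < cutExp α β γ := by linarith
  have hq : 0 < 2 * (β + γ - 1) := by linarith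
  obtain ⟨c₁, hc₁, h1⟩ := hm.1.exists_pos
  obtain ⟨c₂, hc₂, h2⟩ := hm.2.exists_pos
  have hM : Tendsto (mZero α β γ) atTop atTop := by
    have := (tendsto_rpow_atTop (y := 1 / cutExp α β γ) (by positivity)).comp (tendsto_effSize α γ)
    exact this.congr fun n => (mZero_eq α β γ n).symm
  -- everything but the power sum is a computation with powers of `mZero`
  have hbase : ∀ᶠ n : ℕ in atTop, 1 ≤ mZero α β γ n ∧ 1 ≤ m n ∧ (m n : ℝ) ≤ c₁ * mZero α β γ n ∧
      mZero α β γ n ≤ c₂ * m n ∧ mZero α β γ n ^ cutExp α β γ = effSize α γ n ∧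
      effSize α γ n ≤ n ∧ (3 : ℝ) ≤ n ∧
      tau α β γ n = mZero α β γ n ^ (-(2 * (β + γ - 1))) := by
    filter_upwards [h1.bound, h2.bound, hM.eventually_ge_atTop 1, effSize_le α γ, tau_eq he,
      (tendsto_effSize α γ).eventually_gt_atTop 0, eventually_ge_atTop 3] with n a1 a2 a3 a4 a5 a6 a7
    rw [Real.norm_eq_abs, Real.norm_eq_abs, abs_of_nonneg (by positivity),
      abs_of_nonneg (by linarith)] at a1
    rw [Real.norm_eq_abs, Real.norm_eq_abs, abs_of_nonneg (by linarith),
      abs_of_nonneg (by positivity)] at a2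
    refine ⟨a3, ?_, a1, a2, ?_, a4, by exact_mod_cast a7, a5⟩
    · rw [Nat.one_le_iff_ne_zero]
      intro h
      rw [h] at a2; simp at a2; linarith
    · rw [mZero_eq, ← Real.rpow_mul a6.le, one_div_mul_cancel he.ne', Real.rpow_one]
  have hsum : ∃ K : ℝ, 0 ≤ K ∧ ∀ᶠ n : ℕ in atTop,
      (n : ℝ)⁻¹ * ∑ j ∈ Finset.range (m n), ((j : ℝ) + 1) ^ (α - 2 * γ) ≤ K * tau α β γ n := by
    rcases lt_trichotomy (α + 1) (2 * γ) with h | h | h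
    · have hs := summable_add_one_rpow (r := α - 2 * γ) (by linarith)
      refine ⟨∑' j : ℕ, ((j : ℝ) + 1) ^ (α - 2 * γ),
        tsum_nonneg fun j => Real.rpow_nonneg (by positivity) _, .of_forall fun n => ?_⟩
      rw [tau, if_pos h, mul_comm]
      exact mul_le_mul_of_nonneg_right
        (hs.sum_le_tsum _ fun j _ => Real.rpow_nonneg (by positivity) _) (by positivity)
    · refine ⟨2 + |Real.log c₁|, by positivity, ?_⟩
      filter_upwards [hbase] with n ⟨b1, b2, b3, b4, b5, b6, b7, b8⟩
      rw [tau, if_neg (by linarith), if_pos h, mul_left_comm]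
      refine mul_le_mul_of_nonneg_left ?_ (by positivity)
      have hlog : 1 ≤ Real.log n := by
        rw [Real.le_log_iff_exp_le (by linarith)]
        linarith [Real.exp_one_lt_d9]
      have e1 : ∑ j ∈ Finset.range (m n), ((j : ℝ) + 1) ^ (α - 2 * γ) = (harmonic (m n) : ℝ) := by
        rw [harmonic]
        push_cast
        refine Finset.sum_congr rfl fun j _ => ?_
        rw [show α - 2 * γ = -1 by linarith, Real.rpow_neg_one]
      have e2 := harmonic_le_one_add_log (m n)
      have hmpos : (0 : ℝ) < m n := by exact_mod_cast b2
      have e3 : Real.log (m n) ≤ Real.log c₁ + Real.log n := by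
        rw [← Real.log_mul hc₁.ne' (by linarith)]
        refine Real.log_le_log hmpos (b3.trans (mul_le_mul_of_nonneg_left ?_ hc₁.le))
        refine le_trans ?_ (b5.le.trans b6)
        exact Real.self_le_rpow_of_one_le b1 (by linarith)
      rw [e1]
      nlinarith [le_abs_self (Real.log c₁), abs_nonneg (Real.log c₁)]
    · obtain ⟨K, hK, hKs⟩ := exists_sum_rpow_le (r := α - 2 * γ) (by linarith)
      refine ⟨K * c₁ ^ (α - 2 * γ + 1), by positivity, ?_⟩
      filter_upwards [hbase] with n ⟨b1, b2, b3, b4, b5, b6, b7, b8⟩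
      have hMp : 0 < mZero α β γ n := by linarith
      have e1 : effSize α γ n = n := by rw [effSize, if_neg h.ne']
      rw [e1] at b5
      have e2 : cutExp α β γ = α + 2 * β - 1 := by rw [cutExp, if_neg (by linarith)]
      calc (n : ℝ)⁻¹ * ∑ j ∈ Finset.range (m n), ((j : ℝ) + 1) ^ (α - 2 * γ)
          ≤ (n : ℝ)⁻¹ * (K * (c₁ * mZero α β γ n) ^ (α - 2 * γ + 1)) := by
            refine mul_le_mul_of_nonneg_left ((hKs _).trans ?_) (by positivity)
            exact mul_le_mul_of_nonneg_left
              (Real.rpow_le_rpow (by positivity) b3 (by linarith)) hK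
        _ = K * c₁ ^ (α - 2 * γ + 1) * tau α β γ n := by
            have e3 : mZero α β γ n ^ (-(2 * (β + γ - 1))) =
                mZero α β γ n ^ (-(α + 2 * β - 1)) * mZero α β γ n ^ (α - 2 * γ + 1) := by
              rw [← Real.rpow_add hMp]; congr 1; ring
            rw [b8, ← b5, ← Real.rpow_neg hMp.le, Real.mul_rpow hc₁.le hMp.le, e2, e3]
            generalize mZero α β γ n ^ (-(α + 2 * β - 1)) = u
            generalize mZero α β γ n ^ (α - 2 * γ + 1) = v
            generalize c₁ ^ (α - 2 * γ + 1) = w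
            ring
  obtain ⟨K, hK, hKs⟩ := hsum
  refine ⟨K + c₁ ^ (3 * (α + 1)) + c₂ ^ (2 * (β + γ - 1)), by positivity, ?_⟩
  filter_upwards [hbase, hKs] with n ⟨b1, b2, b3, b4, b5, b6, b7, b8⟩ hKn
  have hMp : 0 < mZero α β γ n := by linarith
  have hmp : (0 : ℝ) < m n := by exact_mod_cast b2
  have hc1 : 0 < c₁ ^ (3 * (α + 1)) := by positivity
  have hc2 : 0 < c₂ ^ (2 * (β + γ - 1)) := by positivity
  have hτ : 0 < tau α β γ n := by rw [b8]; positivity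
  refine ⟨b2, ?_, ?_, ?_, ?_⟩
  · calc (m n : ℝ) ^ (3 * (α + 1)) ≤ (c₁ * mZero α β γ n) ^ (3 * (α + 1)) :=
          Real.rpow_le_rpow hmp.le b3 (by linarith)
      _ = c₁ ^ (3 * (α + 1)) * mZero α β γ n ^ (3 * (α + 1)) := Real.mul_rpow hc₁.le hMp.le
      _ ≤ c₁ ^ (3 * (α + 1)) * n := by
          refine mul_le_mul_of_nonneg_left ?_ hc1.le
          exact (Real.rpow_le_rpow_of_exponent_le b1 hle).trans (b5.le.trans b6)
      _ ≤ _ := mul_le_mul_of_nonneg_right (by linarith) (by linarith)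
  · calc (m n : ℝ) ^ (-(2 * (β + γ - 1)))
        ≤ c₂ ^ (2 * (β + γ - 1)) * mZero α β γ n ^ (-(2 * (β + γ - 1))) := by
          rw [Real.rpow_neg hmp.le, Real.rpow_neg hMp.le, ← div_eq_mul_inv,
            inv_le_comm₀ (by positivity) (by positivity), inv_div,
            div_le_iff₀ (by positivity), mul_comm (_ ^ _) (c₂ ^ _),
            ← Real.mul_rpow hc₂.le hmp.le]
          exact Real.rpow_le_rpow hMp.le b4 hq.le
      _ ≤ _ := by
          rw [← b8]
          exact mul_le_mul_of_nonneg_right (by linarith) hτ.le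
  · exact hKn.trans (mul_le_mul_of_nonneg_right (by linarith) hτ.le)
  · rw [b8, Real.rpow_neg hMp.le]
    refine inv_anti₀ (by positivity) ?_
    exact (Real.rpow_le_rpow_of_exponent_le b1 (two_mul_le_cutExp α β γ)).trans (b5.le.trans b6)

/-! ### The error on and off the event of a good spectral approximation -/

section Deterministic

variable {H : Type*} [NormedAddCommGroup H] [InnerProductSpace ℝ H]

lemma exists_norm_le_of_coef_le (φ : HilbertBasis ℕ ℝ H) {C₁ β : ℝ} (hβ : 1 / 2 < β) :
    ∃ R : ℝ, 0 ≤ R ∧ ∀ b : H, (∀ j : ℕ, |inner ℝ b (φ j)| ≤ C₁ * ((j : ℝ) + 1) ^ (-β)) →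
      ‖b‖ ≤ R := by
  have hs : Summable fun j : ℕ => C₁ ^ 2 * ((j : ℝ) + 1) ^ (-(2 * β)) :=
    (summable_add_one_rpow (by linarith)).mul_left _
  refine ⟨√(∑' j : ℕ, C₁ ^ 2 * ((j : ℝ) + 1) ^ (-(2 * β))), Real.sqrt_nonneg _, fun b hb => ?_⟩
  refine Real.le_sqrt_of_sq_le ?_
  refine (hasSum_inner_sq φ b).tsum_eq.symm.le.trans
    ((hasSum_inner_sq φ b).summable.tsum_le_tsum (fun j => ?_) hs)
  have h1 := pow_le_pow_left₀ (abs_nonneg _) (hb j) 2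
  rw [sq_abs, real_inner_comm, mul_pow, ← Real.rpow_natCast (_ ^ (-β)),
    ← Real.rpow_mul (by positivity)] at h1
  convert h1 using 3
  push_cast; ring

lemma norm_sum_inner_smul_le (ψ : HilbertBasis ℕ ℝ H) (b : H) (m : ℕ) :
    ‖∑ j ∈ Finset.range m, inner ℝ b (ψ j) • ψ j‖ ≤ ‖b‖ := by
  refine le_of_sq_le_sq ?_ (norm_nonneg b)
  rw [norm_sum_smul_sq, ← (hasSum_inner_sq ψ b).tsum_eq]
  simp only [real_inner_comm (ψ _) b]
  exact (hasSum_inner_sq ψ b).summable.sum_le_tsum _ fun j _ => sq_nonneg _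

/-- Without noise the estimator is the projection of `b` to the leading empirical eigenvectors. -/
lemma truncInv_empOp {n m : ℕ} {xs : ℕ → H} {ψ : HilbertBasis ℕ ℝ H} {η : ℕ → ℝ}
    (heig : ∀ j, empOp n xs (ψ j) = η j • ψ j) (hη : ∀ j < m, 0 < η j) (b : H) :
    truncInv ψ η m (empOp n xs b) = ∑ j ∈ Finset.range m, inner ℝ b (ψ j) • ψ j := by
  rw [truncInv_apply]
  refine Finset.sum_congr rfl fun j hj => ?_
  rw [empOp_symm, heig, real_inner_smul_right,
    inv_mul_cancel_left₀ (hη j (Finset.mem_range.1 hj)).ne']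

open Classical in
/-- An estimator that is replaced by `c₀` if its norm exceeds `L`. -/
def guard (L : ℝ) (c₀ v : H) : H := if ‖v‖ ≤ L then v else c₀

lemma sq_guard_error_le {L R : ℝ} {c₀ b x v : H} (hL : 0 ≤ L) (hb : ‖b‖ ≤ R) :
    (inner ℝ (guard L c₀ v) x - inner ℝ b x) ^ 2 ≤ ((L + ‖c₀‖ + R) * ‖x‖) ^ 2 := by
  have h1 : ‖guard L c₀ v‖ ≤ L + ‖c₀‖ := by
    unfold guard; split_ifs with h
    · linarith [norm_nonneg c₀]
    · linarith
  rw [← inner_sub_left, ← sq_abs]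
  refine pow_le_pow_left₀ (abs_nonneg _) ((abs_real_inner_le_norm _ _).trans ?_) 2
  exact mul_le_mul_of_nonneg_right ((norm_sub_le _ _).trans (by linarith)) (norm_nonneg x)

/-- The squared error of a guarded estimator `u + v` whose first part `u` is no larger than `b`:
where the guard is active, `v` is at least of unit length. -/
lemma sq_guard_add_error_le {L R p q : ℝ} {c₀ b x u v : H} (hL : R + 1 ≤ L) (hb : ‖b‖ ≤ R)
    (hu : ‖u‖ ≤ ‖b‖) (hux : |inner ℝ u x - inner ℝ b x| ≤ p + q) :
    (inner ℝ (guard L c₀ (u + v)) x - inner ℝ b x) ^ 2 ≤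
      3 * p ^ 2 + 3 * q ^ 2 + 3 * inner ℝ v x ^ 2 + ((‖c₀‖ + R) * ‖x‖) ^ 2 * ‖v‖ ^ 4 := by
  by_cases h : ‖u + v‖ ≤ L
  · have hD : 0 ≤ ((‖c₀‖ + R) * ‖x‖) ^ 2 * ‖v‖ ^ 4 := by positivity
    rw [guard, if_pos h, inner_add_left]
    have h1 : (inner ℝ u x - inner ℝ b x) ^ 2 ≤ (p + q) ^ 2 := by
      rw [← sq_abs]; exact pow_le_pow_left₀ (abs_nonneg _) hux 2
    have h2 := sq_nonneg (p - q)
    set w := inner ℝ u x - inner ℝ b x with hw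
    have h3 : inner ℝ u x + inner ℝ v x - inner ℝ b x = w + inner ℝ v x := by rw [hw]; ring
    rw [h3]
    nlinarith [sq_nonneg (w - 2 * inner ℝ v x)]
  · have h1 : 1 ≤ ‖v‖ := by
      have := norm_add_le u v
      push Not at h
      linarith
    have h2 : 1 ≤ ‖v‖ ^ 4 := one_le_pow₀ h1
    have h3 : (inner ℝ (guard L c₀ (u + v)) x - inner ℝ b x) ^ 2 ≤ ((‖c₀‖ + R) * ‖x‖) ^ 2 := by
      rw [guard, if_neg h, ← inner_sub_left, ← sq_abs]
      refine pow_le_pow_left₀ (abs_nonneg _) ((abs_real_inner_le_norm _ _).trans ?_) 2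
      exact mul_le_mul_of_nonneg_right ((norm_sub_le _ _).trans (by linarith)) (norm_nonneg x)
    have h4 := le_mul_of_one_le_right (sq_nonneg ((‖c₀‖ + R) * ‖x‖)) h2
    nlinarith [sq_nonneg p, sq_nonneg q, sq_nonneg (inner ℝ v x : ℝ)]

variable {φ ψ : HilbertBasis ℕ ℝ H} {θ η t : ℕ → ℝ} {B : H →L[ℝ] H} {ζ : ℝ}

/-- The gap above the `m`-th eigenvalue, up to a constant. -/
def cutGap (C α : ℝ) (m : ℕ) : ℝ := C⁻¹ * (m : ℝ) ^ (-α - 1)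

/-- The cut-off separates the empirical spectrum at levels that do not depend on the sample. -/
lemma IsPerturbation.separated (h : IsPerturbation φ ψ θ η t B ζ) {C α : ℝ} (hC : 0 < C)
    (hα : 1 < α) (hθ0 : ∀ j, 0 ≤ θ j)
    (hgap : ∀ j : ℕ, C⁻¹ * ((j : ℝ) + 1) ^ (-α - 1) ≤ θ j - θ (j + 1)) {m : ℕ} (hm1 : 1 ≤ m)
    (hm : 4 * C * (ζ * (m : ℝ) ^ (α + 3 / 2)) ≤ 1) :
    (∀ j, η j ≤ θ 0 + C⁻¹) ∧ (∀ j < m, θ m + 3 / 4 * cutGap C α m ≤ η j) ∧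
      ∀ j, m ≤ j → η j ≤ θ m + 1 / 4 * cutGap C α m := by
  have hθ := antitone_of_gap hC hgap
  have hmp : (1 : ℝ) ≤ m := by exact_mod_cast hm1
  have hm0 : (0 : ℝ) < m := by linarith
  have hg : 4 * ζ ≤ cutGap C α m := by
    have h1 : ζ * (m : ℝ) ^ (α + 1) ≤ ζ * (m : ℝ) ^ (α + 3 / 2) :=
      mul_le_mul_of_nonneg_left (Real.rpow_le_rpow_of_exponent_le hmp (by linarith)) h.nonneg_dist
    have h2 : cutGap C α m = (C * (m : ℝ) ^ (α + 1))⁻¹ := by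
      rw [cutGap, mul_inv, ← Real.rpow_neg hm0.le]; congr 2; ring
    rw [h2, ← one_div, le_div_iff₀ (by positivity)]
    nlinarith
  have hg1 : cutGap C α m ≤ C⁻¹ := by
    rw [cutGap]
    exact mul_le_of_le_one_right (inv_pos.2 hC).le
      (Real.rpow_le_one_of_one_le_of_nonpos hmp (by linarith))
  have hζ := h.nonneg_dist
  have hW := fun j => abs_le.1 (h.abs_eigenvalue_sub_le hθ hθ0 j)
  refine ⟨fun j => ?_, fun j hj => ?_, fun j hj => ?_⟩
  · linarith [(hW j).2, hθ (Nat.zero_le j)]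
  · have h1 := hgap (m - 1)
    rw [Nat.sub_add_cancel hm1, Nat.cast_sub hm1, Nat.cast_one, sub_add_cancel] at h1
    have h2 := hθ (Nat.le_sub_one_of_lt hj)
    rw [cutGap] at *
    linarith [(hW j).1]
  · linarith [(hW j).2, hθ hj]

lemma cutGap_pos {C α : ℝ} (hC : 0 < C) {m : ℕ} (hm : 1 ≤ m) : 0 < cutGap C α m := by
  have : (0 : ℝ) < m := by exact_mod_cast hm
  unfold cutGap; positivity

end Deterministic

/-- On the event that the squared distance is at most `n ^ (-11 / 12)`, the perturbation is smaller
than all the gaps between the eigenvalues in use: `m ^ (2 * α + 3)` is of order `n ^ (5 / 6)`, and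
`5 / 6 < 11 / 12`. -/
lemma eventually_small_perturbation {C α K : ℝ} (hα : 1 < α) (hK : 0 < K) {m : ℕ → ℕ}
    (hm : ∀ᶠ n : ℕ in atTop, 1 ≤ m n ∧ (m n : ℝ) ^ (3 * (α + 1)) ≤ K * n) :
    ∀ᶠ n : ℕ in atTop, ∀ ζ : ℝ, ζ ^ 2 ≤ (n : ℝ) ^ (-(11 / 12) : ℝ) →
      4 * C * (ζ * (m n : ℝ) ^ (α + 3 / 2)) ≤ 1 := by
  have hlim : Tendsto (fun n : ℕ => 16 * C ^ 2 * K ^ (5 / 6 : ℝ) * (n : ℝ) ^ (-(1 / 12) : ℝ)) atTop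
      (𝓝 (16 * C ^ 2 * K ^ (5 / 6 : ℝ) * 0)) :=
    ((tendsto_rpow_neg_atTop (by norm_num)).comp tendsto_natCast_atTop_atTop).const_mul _
  rw [mul_zero] at hlim
  filter_upwards [hm, hlim.eventually_le_const zero_lt_one, eventually_ge_atTop 1]
    with n ⟨h1, h2⟩ h3 h4 ζ hζ
  have hn : (0 : ℝ) < n := by exact_mod_cast h4
  have hm1 : (1 : ℝ) ≤ m n := by exact_mod_cast h1
  have h5 : ((m n : ℝ) ^ (α + 3 / 2)) ^ 2 ≤ K ^ (5 / 6 : ℝ) * (n : ℝ) ^ (5 / 6 : ℝ) := by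
    rw [← Real.rpow_natCast, ← Real.rpow_mul (by linarith), ← Real.mul_rpow hK.le hn.le]
    calc (m n : ℝ) ^ ((α + 3 / 2) * (2 : ℕ)) ≤ (m n : ℝ) ^ (3 * (α + 1) * (5 / 6)) :=
          Real.rpow_le_rpow_of_exponent_le hm1 (by push_cast; linarith)
      _ = ((m n : ℝ) ^ (3 * (α + 1))) ^ (5 / 6 : ℝ) := Real.rpow_mul (by linarith) _ _
      _ ≤ _ := Real.rpow_le_rpow (by positivity) h2 (by norm_num)
  have h6 : (4 * C * (ζ * (m n : ℝ) ^ (α + 3 / 2))) ^ 2 ≤ 1 := by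
    calc (4 * C * (ζ * (m n : ℝ) ^ (α + 3 / 2))) ^ 2
        = 16 * C ^ 2 * (ζ ^ 2 * ((m n : ℝ) ^ (α + 3 / 2)) ^ 2) := by ring
      _ ≤ 16 * C ^ 2 * ((n : ℝ) ^ (-(11 / 12) : ℝ) * (K ^ (5 / 6 : ℝ) * (n : ℝ) ^ (5 / 6 : ℝ))) := by
          refine mul_le_mul_of_nonneg_left ?_ (by positivity)
          exact mul_le_mul hζ h5 (sq_nonneg _) (by positivity)
      _ = 16 * C ^ 2 * K ^ (5 / 6 : ℝ) * (n : ℝ) ^ (-(1 / 12) : ℝ) := by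
          have : (n : ℝ) ^ (-(1 / 12) : ℝ) = (n : ℝ) ^ (-(11 / 12) : ℝ) * (n : ℝ) ^ (5 / 6 : ℝ) := by
            rw [← Real.rpow_add hn]; norm_num
          rw [this]; ring
      _ ≤ 1 := h3
  exact (abs_le_one_iff_mul_self_le_one.2 (by rwa [← sq])).trans' (le_abs_self _)

/-- Markov's inequality for the `r`-th power. With `r` large, exceptional events have probability of
smaller order than any prescribed power of `n`. -/
lemma measure_lt_le {Ω : Type*} [MeasurableSpace Ω] {P : Measure Ω} {F : Ω → ℝ≥0∞}
    (hF : Measurable F) {n r : ℕ} (hn : n ≠ 0) {D : ℝ}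
    (h : ∫⁻ ω, F ω ^ r ∂P ≤ ENNReal.ofReal (D * ((n : ℝ)⁻¹) ^ r)) :
    P {ω | ENNReal.ofReal ((n : ℝ) ^ (-(11 / 12) : ℝ)) < F ω} ≤
      ENNReal.ofReal (D * (n : ℝ) ^ (-(r / 12) : ℝ)) := by
  have hn0 : (0 : ℝ) < n := by exact_mod_cast Nat.pos_of_ne_zero hn
  set c : ℝ := (n : ℝ) ^ (-(11 / 12) : ℝ) with hc
  have hc0 : 0 < c := by positivity
  have h1 : ENNReal.ofReal (c ^ r) * P {ω | ENNReal.ofReal c < F ω} ≤ ∫⁻ ω, F ω ^ r ∂P := by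
    refine le_trans (mul_le_mul_right (measure_mono fun ω hω => ?_) _)
      (mul_meas_ge_le_lintegral (hF.pow_const r) _)
    change ENNReal.ofReal c < F ω at hω
    change ENNReal.ofReal (c ^ r) ≤ F ω ^ r
    rw [ENNReal.ofReal_pow hc0.le]
    exact pow_le_pow_left₀ (by simp) hω.le r
  have h2 : ENNReal.ofReal (D * ((n : ℝ)⁻¹) ^ r) =
      ENNReal.ofReal (c ^ r) * ENNReal.ofReal (D * (n : ℝ) ^ (-(r / 12) : ℝ)) := by
    rw [← ENNReal.ofReal_mul (by positivity)]
    congr 1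
    rw [mul_left_comm]
    congr 1
    rw [hc, ← Real.rpow_natCast, ← Real.rpow_natCast, ← Real.rpow_mul hn0.le,
      ← Real.rpow_add hn0, ← Real.rpow_neg_one, ← Real.rpow_mul hn0.le]
    congr 1; ring
  rw [h2] at h
  exact (ENNReal.mul_le_mul_iff_right (by simpa using by positivity) ENNReal.ofReal_ne_top).1
    (h1.trans h)

/-! ### The risk bound -/

section Risk

variable {H : Type*} [NormedAddCommGroup H] [InnerProductSpace ℝ H] [MeasurableSpace H]
  [BorelSpace H] [SecondCountableTopology H] [CompleteSpace H] {Ω : Type*} [MeasurableSpace Ω]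
  {P : Measure Ω} [IsProbabilityMeasure P]

omit [MeasurableSpace Ω] in
lemma indicator_le_of_forall_mem {S : Set Ω} {f g : Ω → ℝ≥0∞} (h : ∀ ω ∈ S, f ω ≤ g ω) (ω : Ω) :
    S.indicator f ω ≤ g ω := by
  by_cases hω : ω ∈ S
  · rw [Set.indicator_of_mem hω]; exact h ω hω
  · rw [Set.indicator_of_notMem hω]; exact zero_le

/-- Integration of a pointwise error bound: `d` is the distance between the covariance operators,
`u` and `v` are the second and fourth order noise terms. -/
lemma lintegral_error_le {G : Set Ω} (hG : MeasurableSet G) {d u v f : Ω → ℝ≥0∞}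
    (hd : Measurable d) (hu : Measurable (G.indicator u)) {a₁ a₂ a₃ a₄ a₅ : ℝ≥0∞}
    (hf : ∀ ω ∈ G, f ω ≤ a₁ * d ω + a₂ + a₃ * u ω + a₄ * v ω) (hf' : ∀ ω ∉ G, f ω ≤ a₅)
    (h₄ : a₄ ≠ ∞) :
    ∫⁻ ω, f ω ∂P ≤ a₁ * ∫⁻ ω, d ω ∂P + a₂ + a₃ * ∫⁻ ω, G.indicator u ω ∂P +
      a₅ * P Gᶜ + a₄ * ∫⁻ ω, G.indicator v ω ∂P := by
  have h1 : ∀ ω, f ω ≤ (a₁ * d ω + a₂ + a₃ * G.indicator u ω + Gᶜ.indicator (fun _ => a₅) ω) +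
      a₄ * G.indicator v ω := fun ω => by
    by_cases hω : ω ∈ G
    · rw [Set.indicator_of_mem hω, Set.indicator_of_mem hω,
        Set.indicator_of_notMem (show ω ∉ Gᶜ from fun h => h hω), add_zero]
      exact hf ω hω
    · rw [Set.indicator_of_notMem hω, Set.indicator_of_notMem hω,
        Set.indicator_of_mem (show ω ∈ Gᶜ from hω), mul_zero, mul_zero, add_zero, add_zero]
      exact (hf' ω hω).trans le_add_self
  refine (lintegral_mono h1).trans (le_of_eq ?_)
  have m1 : Measurable fun ω => a₁ * d ω + a₂ := (hd.const_mul _).add_const _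
  have m2 : Measurable fun ω => a₁ * d ω + a₂ + a₃ * G.indicator u ω := m1.add (hu.const_mul _)
  have m3 : Measurable fun ω => a₁ * d ω + a₂ + a₃ * G.indicator u ω +
      Gᶜ.indicator (fun _ => a₅) ω := m2.add (measurable_const.indicator hG.compl)
  rw [lintegral_add_left m3, lintegral_const_mul' _ _ h₄, lintegral_add_left m2,
    lintegral_add_left m1, lintegral_add_left (hd.const_mul _),
    lintegral_const_mul _ hd, lintegral_const_mul _ hu, lintegral_indicator_const hG.compl,
    lintegral_const, measure_univ, mul_one]

variable {ε : ℕ → Ω → ℝ} {σ2 μ4 : ℝ} {X : ℕ → Ω → H} {μ : H} {φ : HilbertBasis ℕ ℝ H} {θ : ℕ → ℝ}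

lemma fourth_order_le {μ4 C K w τ y z : ℝ} (hμ4 : 0 ≤ μ4) (hw : 0 ≤ w) (hy0 : 0 ≤ y)
    (hy : y ≤ 2 * C * z) (hz : w * z ^ 2 ≤ K) (hwτ : w ≤ τ) :
    3 * μ4 * (w * y) ^ 2 ≤ 12 * μ4 * C ^ 2 * K * τ := by
  have h1 : y ^ 2 ≤ (2 * C * z) ^ 2 := pow_le_pow_left₀ hy0 hy 2
  have hz0 : 0 ≤ w * z ^ 2 := mul_nonneg hw (sq_nonneg z)
  calc 3 * μ4 * (w * y) ^ 2 = 3 * μ4 * w ^ 2 * y ^ 2 := by ring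
    _ ≤ 3 * μ4 * w ^ 2 * (2 * C * z) ^ 2 := mul_le_mul_of_nonneg_left h1 (by positivity)
    _ = 12 * μ4 * C ^ 2 * ((w * z ^ 2) * w) := by ring
    _ ≤ 12 * μ4 * C ^ 2 * (K * τ) :=
        mul_le_mul_of_nonneg_left (mul_le_mul hz hwτ hw (hz0.trans hz)) (by positivity)
    _ = _ := by ring

set_option maxHeartbeats 1000000 in
/-- The risk of the guarded principal components estimator, for a random design with values in any
separable Hilbert space. -/
theorem exists_risk_bound (hX : IsSample P X μ φ θ) (hε : IsNoise P ε σ2 μ4)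
    (hXε : IndepFun (fun ω i => X i ω) (fun ω i => ε i ω) P)
    {α β γ C C₁ C₂ C₄ C₅ : ℝ} (hC : 0 < C) (hC₁ : 0 < C₁) (hC₂ : 0 < C₂) (hC₄ : 0 < C₄)
    (hC₅ : 0 < C₅) (hα : 1 < α) (hβ : α + 2 ≤ β) (hγ : 1 / 2 < γ)
    (hlow : ∀ j : ℕ, C⁻¹ * ((j : ℝ) + 1) ^ (-α) ≤ θ j)
    (hupp : ∀ j : ℕ, θ j ≤ C * ((j : ℝ) + 1) ^ (-α))
    (hgap : ∀ j : ℕ, C⁻¹ * ((j : ℝ) + 1) ^ (-α - 1) ≤ θ j - θ (j + 1))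
    (x : H) (hx : ∀ j : ℕ, |inner ℝ x (φ j)| ≤ C₂ * ((j : ℝ) + 1) ^ (-γ)) (c₀ : H)
    (ψ : ℕ → Ω → HilbertBasis ℕ ℝ H) (η : ℕ → Ω → ℕ → ℝ) (hη : ∀ n ω, Antitone (η n ω))
    (heig : ∀ n ω j, empOp n (fun i => X i ω) (ψ n ω j) = η n ω j • ψ n ω j)
    (m : ℕ → ℕ) (hm : (fun n => (m n : ℝ)) =Θ[atTop] mZero α β γ) :
    ∃ M : ℝ, ∀ᶠ n : ℕ in atTop, ∀ b : H,
      (∀ j : ℕ, |inner ℝ b (φ j)| ≤ C₁ * ((j : ℝ) + 1) ^ (-β)) →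
      ∫⁻ ω, ENNReal.ofReal ((inner ℝ (guard (C₄ * (n : ℝ) ^ C₅) c₀ (truncInv (ψ n ω) (η n ω) (m n)
        (empOp n (fun i => X i ω) b + noiseVec n (fun i => X i ω) (fun i => ε i ω)))) x -
          inner ℝ b x) ^ 2) ∂P ≤ ENNReal.ofReal (M * tau α β γ n) := by
  -- small enough for `θ k / t k ^ 2` to be summable, and positive
  set p : ℝ := (α - 1) / 4 with hp
  have hp0 : 0 < p := by rw [hp]; linarith
  set t : ℕ → ℝ := fun k => ((k : ℝ) + 1) ^ (-p) with ht
  have ht0 : ∀ k, 0 < t k := fun k => Real.rpow_pos_of_pos (cast_add_one_pos k) _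
  have ht1 : ∀ k, t k ≤ 1 := fun k =>
    Real.rpow_le_one_of_one_le_of_nonpos (one_le_cast_add_one k) (by linarith)
  have hθ0 : ∀ j, 0 ≤ θ j := fun j => (hX.pos j).le
  have hθ := antitone_of_gap hC hgap
  have hw : Summable fun k => θ k / t k ^ 2 := by
    refine Summable.of_nonneg_of_le (fun k => div_nonneg (hθ0 k) (sq_nonneg _)) (fun k => ?_)
      ((summable_add_one_rpow (r := -(α + 1) / 2) (by linarith)).mul_left C)
    rw [div_le_iff₀ (pow_pos (ht0 k) 2), ht]
    dsimp only
    rw [← Real.rpow_natCast (_ ^ (-p)), ← Real.rpow_mul (cast_add_one_pos k).le, mul_assoc,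
      ← Real.rpow_add (cast_add_one_pos k)]
    refine (hupp k).trans (le_of_eq ?_)
    congr 2; rw [hp]; push_cast; ring
  obtain ⟨K, hK, hrate⟩ := exists_rate_bounds hα hβ hγ hm
  obtain ⟨K₁, hK₁, hbias⟩ := exists_bias_bound φ hC hα hp0 hβ hγ hC₁ hC₂ hθ0 hgap
  obtain ⟨K₂, hK₂, hvar⟩ := exists_variance_bound φ hC hα hp0 hγ hC₂ hlow hgap
  obtain ⟨R, hR, hbR⟩ := exists_norm_le_of_coef_le φ (C₁ := C₁) (β := β) (by linarith)
  -- a moment of this order outweighs the norm constraint off the main event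
  obtain ⟨r, hr⟩ := exists_nat_ge (12 * (1 + 2 * C₅))
  have hr1 : 1 ≤ r := by
    have : (0 : ℝ) < r := by linarith
    exact_mod_cast this
  obtain ⟨D, hD, hmom⟩ := hX.exists_empDist_moments hw le_rfl
  obtain ⟨D', hD', hmom'⟩ := hX.exists_empDist_moments hw hr1
  have hσ := hε.var_nonneg
  have hμ4 : 0 ≤ μ4 := by rw [← hε.fourth 0]; exact integral_nonneg fun ω => by positivity
  have hsmall := eventually_small_perturbation (C := C) hα hK
    (hrate.mono fun n h => ⟨h.1, h.2.1⟩)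
  have hguard : ∀ᶠ n : ℕ in atTop, R + 1 ≤ C₄ * (n : ℝ) ^ C₅ :=
    (((tendsto_rpow_atTop hC₅).comp tendsto_natCast_atTop_atTop).const_mul_atTop
      hC₄).eventually_ge_atTop _
  set Q := ((‖c₀‖ + R) * ‖x‖) ^ 2 with hQ
  set S := ((C₄ + ‖c₀‖ + R) * ‖x‖) ^ 2 with hS
  refine ⟨3 * K₁ ^ 2 * D + 3 * (C₁ * C₂) ^ 2 * K + 3 * (σ2 * K₂ * K + σ2 * K₂ * K * D) + S * D' +
    Q * (12 * μ4 * C ^ 2 * K), ?_⟩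
  filter_upwards [hrate, hsmall, hguard, eventually_ge_atTop 1]
    with n ⟨r1, r2, r3, r4, r5⟩ hζ1 hL hn1 b hb
  have hn : n ≠ 0 := by omega
  have hnp : (0 : ℝ) < n := by exact_mod_cast hn1
  have hn1' : (1 : ℝ) ≤ n := by exact_mod_cast hn1
  have hm1 : (1 : ℝ) ≤ m n := by exact_mod_cast r1
  have hτ : 0 < tau α β γ n := lt_of_lt_of_le (inv_pos.2 hnp) r5
  set d : (ℕ → H) → ℝ≥0∞ := empDist φ θ t n with hd
  have hdm : Measurable d := measurable_empDist φ θ t n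
  have hXm : Measurable fun ω i => X i ω := measurable_pi_iff.2 hX.measurable
  set G : Set (ℕ → H) := {xs | d xs ≤ ENNReal.ofReal ((n : ℝ) ^ (-(11 / 12) : ℝ))} with hGdef
  have hG : MeasurableSet G := measurableSet_le hdm measurable_const
  set GΩ : Set Ω := {ω | (fun i => X i ω) ∈ G} with hGΩ
  have hGΩm : MeasurableSet GΩ := hXm hG
  let ζ : Ω → ℝ := fun ω => √(d fun i => X i ω).toReal
  -- the perturbation is controlled on the good event
  have hfin : ∀ ω ∈ GΩ, d (fun i => X i ω) ≠ ∞ := fun ω hω =>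
    ne_top_of_le_ne_top ENNReal.ofReal_ne_top hω
  have hζsq : ∀ ω ∈ GΩ, ENNReal.ofReal (ζ ω ^ 2) = d fun i => X i ω := fun ω hω => by
    rw [Real.sq_sqrt ENNReal.toReal_nonneg, ENNReal.ofReal_toReal (hfin ω hω)]
  have hpert : ∀ ω ∈ GΩ, IsPerturbation φ (ψ n ω) θ (η n ω) t (empOp n fun i => X i ω) (ζ ω) :=
    fun ω hω => isPerturbation_empOp φ (ψ n ω) ht0 ht1 (heig n ω) (hη n ω) (hfin ω hω)
  have hζm : ∀ ω ∈ GΩ, 4 * C * (ζ ω * (m n : ℝ) ^ (α + 3 / 2)) ≤ 1 := fun ω hω => by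
    refine hζ1 _ ?_
    rw [Real.sq_sqrt ENNReal.toReal_nonneg]
    exact ENNReal.toReal_le_of_le_ofReal (by positivity) hω
  have heta : ∀ ω ∈ GΩ, ∀ j < m n,
      0 < η n ω j ∧ (η n ω j)⁻¹ ≤ 2 * C * ((j : ℝ) + 1) ^ α := fun ω hω j hj =>
    (hpert ω hω).le_eigenvalue hθ hθ0 hC hα hlow (hζm ω hω) hj
  let N : Ω → H := fun ω => truncInv (ψ n ω) (η n ω) (m n)
    (noiseVec n (fun i => X i ω) fun i => ε i ω)
  have hgp := cutGap_pos (α := α) hC r1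
  obtain ⟨hN2, hN4, hNm⟩ := lintegral_noise_le hX.measurable hε hXε n (m n) (θ 0 + C⁻¹)
    (lo := θ (m n) + 1 / 4 * cutGap C α (m n)) (hi := θ (m n) + 3 / 4 * cutGap C α (m n))
    (by linarith [hθ0 (m n)]) (by linarith) hG (ψ n) (η n) (fun ω hω =>
      ⟨heig n ω, (hpert ω hω).eigenvalue_nonneg,
        (hpert ω hω).separated hC hα hθ0 hgap r1 (hζm ω hω)⟩) x
  have hp1 : (n : ℝ)⁻¹ * (m n : ℝ) ^ (3 * (α + 1)) ≤ K := by
    rw [inv_mul_le_iff₀ hnp]; exact r2.trans_eq (mul_comm _ _)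
  -- pointwise error
  have hgood : ∀ ω ∈ GΩ, ENNReal.ofReal ((inner ℝ (guard (C₄ * (n : ℝ) ^ C₅) c₀
      (truncInv (ψ n ω) (η n ω) (m n) (empOp n (fun i => X i ω) b +
        noiseVec n (fun i => X i ω) (fun i => ε i ω)))) x - inner ℝ b x) ^ 2) ≤
      ENNReal.ofReal (3 * K₁ ^ 2) * d (fun i => X i ω) +
        ENNReal.ofReal (3 * (C₁ * C₂) ^ 2 * (K * tau α β γ n)) +
        ENNReal.ofReal 3 * ENNReal.ofReal (inner ℝ (N ω) x ^ 2) +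
        ENNReal.ofReal Q * ENNReal.ofReal (‖N ω‖ ^ 4) := fun ω hω => by
    have hproj := truncInv_empOp (heig n ω) (fun j hj => (heta ω hω j hj).1) b
    have e1 := hbias (ψ n ω) (η n ω) _ (ζ ω) (m n) b x (hpert ω hω) (hζm ω hω) hb hx
    have e2 := abs_partial_inner_sub_le φ hC₁.le (by linarith) hb hx r1
    have e3 : inner ℝ (∑ j ∈ Finset.range (m n), inner ℝ b (ψ n ω j) • ψ n ω j) x =
        ∑ j ∈ Finset.range (m n), inner ℝ b (ψ n ω j) * inner ℝ x (ψ n ω j) := by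
      rw [sum_inner]
      exact Finset.sum_congr rfl fun j _ => by rw [real_inner_smul_left, real_inner_comm x]
    have e4 := sq_guard_add_error_le (c₀ := c₀) (x := x) (v := N ω) hL (hbR b hb)
      (norm_sum_inner_smul_le (ψ n ω) b (m n)) (p := K₁ * ζ ω)
      (q := C₁ * C₂ * (m n : ℝ) ^ (-(β + γ - 1)))
      (by rw [e3]; exact (abs_sub_le _ _ _).trans (add_le_add e1 e2))
    have e5 : (C₁ * C₂ * (m n : ℝ) ^ (-(β + γ - 1))) ^ 2 ≤ (C₁ * C₂) ^ 2 * (K * tau α β γ n) := by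
      rw [mul_pow]
      refine mul_le_mul_of_nonneg_left (le_trans (le_of_eq ?_) r3) (sq_nonneg _)
      rw [← Real.rpow_natCast, ← Real.rpow_mul (by linarith)]
      congr 1; push_cast; ring
    rw [map_add, hproj, ← hζsq ω hω, ← ENNReal.ofReal_mul (by positivity),
      ← ENNReal.ofReal_mul (by positivity), ← ENNReal.ofReal_mul (by positivity),
      ← ENNReal.ofReal_add (by positivity) (by positivity),
      ← ENNReal.ofReal_add (by positivity) (by positivity),
      ← ENNReal.ofReal_add (by positivity) (by positivity)]
    refine ENNReal.ofReal_le_ofReal (e4.trans ?_)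
    rw [mul_pow K₁]
    linarith
  have hbad : ∀ ω ∉ GΩ, ENNReal.ofReal ((inner ℝ (guard (C₄ * (n : ℝ) ^ C₅) c₀
      (truncInv (ψ n ω) (η n ω) (m n) (empOp n (fun i => X i ω) b +
        noiseVec n (fun i => X i ω) (fun i => ε i ω)))) x - inner ℝ b x) ^ 2) ≤
      ENNReal.ofReal (S * (n : ℝ) ^ (2 * C₅)) := fun ω _ => by
    refine ENNReal.ofReal_le_ofReal ((sq_guard_error_le (by positivity) (hbR b hb)).trans ?_)
    have e1 : 1 ≤ (n : ℝ) ^ C₅ := Real.one_le_rpow hn1' hC₅.le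
    have e2 : (n : ℝ) ^ (2 * C₅) = ((n : ℝ) ^ C₅) ^ 2 := by
      rw [← Real.rpow_natCast, ← Real.rpow_mul hnp.le]; congr 1; push_cast; ring
    rw [hS, e2, ← mul_pow]
    refine pow_le_pow_left₀ (by positivity) ?_ 2
    rw [mul_right_comm]
    refine mul_le_mul_of_nonneg_right ?_ (norm_nonneg x)
    nlinarith [norm_nonneg c₀]
  have hdX : Measurable fun ω => d fun i => X i ω := hdm.comp hXm
  refine (lintegral_error_le hGΩm hdX hNm hgood hbad ENNReal.ofReal_ne_top).trans ?_
  -- the five contributions to the risk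
  have t1 : ∫⁻ ω, d (fun i => X i ω) ∂P ≤ ENNReal.ofReal (D * tau α β γ n) := by
    have := hmom n hn
    simp only [pow_one] at this
    exact this.trans (ENNReal.ofReal_le_ofReal (mul_le_mul_of_nonneg_left r5 hD))
  have t3 : ∫⁻ ω, GΩ.indicator (fun ω => ENNReal.ofReal (inner ℝ (N ω) x ^ 2)) ω ∂P ≤
      ENNReal.ofReal ((σ2 * K₂ * K + σ2 * K₂ * K * D) * tau α β γ n) := by
    refine hN2.trans ?_
    have e1 : ∀ ω, GΩ.indicator (fun ω => ENNReal.ofReal (σ2 * ((n : ℝ)⁻¹ *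
        ∑ j ∈ Finset.range (m n), (η n ω j)⁻¹ * inner ℝ x (ψ n ω j) ^ 2))) ω ≤
        ENNReal.ofReal (σ2 * K₂ * K * tau α β γ n) +
          ENNReal.ofReal (σ2 * K₂ * K) * d (fun i => X i ω) := by
      refine indicator_le_of_forall_mem fun ω hω => ?_
      rw [← hζsq ω hω, ← ENNReal.ofReal_mul (by positivity),
        ← ENNReal.ofReal_add (by positivity) (by positivity)]
      refine ENNReal.ofReal_le_ofReal ?_
      have e2 := hvar (ψ n ω) (η n ω) _ (ζ ω) (m n) x (hpert ω hω) (hζm ω hω) hx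
      have e3 : (n : ℝ)⁻¹ * (m n : ℝ) ^ (3 * α + 2) ≤ K := by
        refine le_trans (mul_le_mul_of_nonneg_left ?_ (by positivity)) hp1
        exact Real.rpow_le_rpow_of_exponent_le hm1 (by linarith)
      have e4 := mul_le_mul_of_nonneg_left e3 (mul_nonneg hK₂ (sq_nonneg (ζ ω)))
      have e5 := mul_le_mul_of_nonneg_left r4 hK₂
      have e6 := mul_le_mul_of_nonneg_left e2 (inv_pos.2 hnp).le
      calc _ ≤ σ2 * (K₂ * (K * tau α β γ n) + K₂ * ζ ω ^ 2 * K) :=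
            mul_le_mul_of_nonneg_left (by nlinarith) hσ
        _ = _ := by ring
    refine (lintegral_mono e1).trans ?_
    rw [lintegral_add_left measurable_const, lintegral_const_mul _ hdX, lintegral_const, measure_univ, mul_one]
    refine (add_le_add_right (mul_le_mul_right t1 _) _).trans (le_of_eq ?_)
    rw [← ENNReal.ofReal_mul (by positivity), ← ENNReal.ofReal_add (by positivity) (by positivity)]
    congr 1; ring
  have t4 : ∫⁻ ω, GΩ.indicator (fun ω => ENNReal.ofReal (‖N ω‖ ^ 4)) ω ∂P ≤
      ENNReal.ofReal (12 * μ4 * C ^ 2 * K * tau α β γ n) := by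
    refine hN4.trans ((lintegral_mono (g := fun _ => ENNReal.ofReal (12 * μ4 * C ^ 2 * K *
      tau α β γ n)) ?_).trans (by rw [lintegral_const, measure_univ, mul_one]))
    refine indicator_le_of_forall_mem fun ω hω => ENNReal.ofReal_le_ofReal ?_
    have e1 : ∑ j ∈ Finset.range (m n), (η n ω j)⁻¹ ≤ 2 * C * (m n : ℝ) ^ (α + 1) := by
      refine (Finset.sum_le_sum fun j hj => (heta ω hω j (Finset.mem_range.1 hj)).2).trans ?_
      rw [← Finset.mul_sum]
      exact mul_le_mul_of_nonneg_left (sum_add_one_rpow_le (by linarith) _) (by positivity)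
    have e2 : 0 ≤ ∑ j ∈ Finset.range (m n), (η n ω j)⁻¹ :=
      Finset.sum_nonneg fun j hj => (inv_pos.2 (heta ω hω j (Finset.mem_range.1 hj)).1).le
    have e3 : ((m n : ℝ) ^ (α + 1)) ^ 2 ≤ (m n : ℝ) ^ (3 * (α + 1)) := by
      rw [← Real.rpow_natCast, ← Real.rpow_mul (by linarith)]
      exact Real.rpow_le_rpow_of_exponent_le hm1 (by push_cast; linarith)
    exact fourth_order_le hμ4 (inv_pos.2 hnp).le e2 e1
      ((mul_le_mul_of_nonneg_left e3 (inv_pos.2 hnp).le).trans hp1) r5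
  have t5 : P GΩᶜ ≤ ENNReal.ofReal (D' * (n : ℝ) ^ (-(r / 12) : ℝ)) := by
    refine le_trans (le_of_eq ?_) (measure_lt_le hdX hn (hmom' n hn))
    congr 1; ext ω
    exact (not_le : ¬ (d fun i => X i ω) ≤ ENNReal.ofReal ((n : ℝ) ^ (-(11 / 12) : ℝ)) ↔ _)
  have t5' : ENNReal.ofReal (S * (n : ℝ) ^ (2 * C₅)) * P GΩᶜ ≤
      ENNReal.ofReal (S * D' * tau α β γ n) := by
    refine (mul_le_mul_right t5 _).trans ?_
    rw [← ENNReal.ofReal_mul (by positivity)]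
    refine ENNReal.ofReal_le_ofReal ?_
    have e1 : (n : ℝ) ^ (2 * C₅) * (n : ℝ) ^ (-(r / 12) : ℝ) ≤ tau α β γ n := by
      rw [← Real.rpow_add hnp]
      refine le_trans ?_ r5
      rw [← Real.rpow_neg_one]
      exact Real.rpow_le_rpow_of_exponent_le hn1' (by linarith)
    calc _ = S * D' * ((n : ℝ) ^ (2 * C₅) * (n : ℝ) ^ (-(r / 12) : ℝ)) := by ring
      _ ≤ _ := mul_le_mul_of_nonneg_left e1 (by positivity)
  calc _ ≤ ENNReal.ofReal (3 * K₁ ^ 2) * ENNReal.ofReal (D * tau α β γ n) +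
        ENNReal.ofReal (3 * (C₁ * C₂) ^ 2 * (K * tau α β γ n)) +
        ENNReal.ofReal 3 * ENNReal.ofReal ((σ2 * K₂ * K + σ2 * K₂ * K * D) * tau α β γ n) +
        ENNReal.ofReal (S * D' * tau α β γ n) +
        ENNReal.ofReal Q * ENNReal.ofReal (12 * μ4 * C ^ 2 * K * tau α β γ n) := by gcongr
    _ = _ := by
        rw [← ENNReal.ofReal_mul (by positivity), ← ENNReal.ofReal_mul (by positivity),
          ← ENNReal.ofReal_mul (by positivity),
          ← ENNReal.ofReal_add (by positivity) (by positivity),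
          ← ENNReal.ofReal_add (by positivity) (by positivity),
          ← ENNReal.ofReal_add (by positivity) (by positivity),
          ← ENNReal.ofReal_add (by positivity) (by positivity)]
        congr 1; ring

end Risk

/-! ### The functional linear model -/

section Model

variable {s t : ℝ} {Ω : Type*}

/-- As the centred design adds up to zero, the intercept and the centring of the responses
drop out. -/
lemma gHat_response (X : ℕ → Ω → L2 s t) (ε : ℕ → Ω → ℝ) (a : ℝ) (b : L2 s t) {n : ℕ}
    (hn : n ≠ 0) (ω : Ω) :
    gHat X (response a b X ε) n ω =
      empOp n (fun i => X i ω) b + noiseVec n (fun i => X i ω) (fun i => ε i ω) := by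
  have hn0 : (n : ℝ) ≠ 0 := Nat.cast_ne_zero.2 hn
  set v : ℕ → L2 s t := fun i => X i ω - empMean n (fun i => X i ω) with hv
  have h0 : ∑ i ∈ Finset.range n, v i = 0 := by
    rw [hv, Finset.sum_sub_distrib, Finset.sum_const, Finset.card_range, empMean,
      ← Nat.cast_smul_eq_nsmul ℝ, smul_smul, mul_inv_cancel₀ hn0, one_smul, sub_self]
  set c : ℝ := a + inner ℝ b (empMean n fun i => X i ω) - sampleMean (response a b X ε) n ω
  have h1 : ∀ i, (response a b X ε i ω - sampleMean (response a b X ε) n ω) • v i =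
      inner ℝ (v i) b • v i + ε i ω • v i + c • v i := fun i => by
    rw [← add_smul, ← add_smul]
    congr 1
    have h2 : inner ℝ (v i) b = inner ℝ b (X i ω) - inner ℝ b (empMean n fun i => X i ω) := by
      rw [real_inner_comm, inner_sub_right]
    rw [response, h2]
    ring
  change (n : ℝ)⁻¹ • ∑ i ∈ Finset.range n,
    (response a b X ε i ω - sampleMean (response a b X ε) n ω) • v i = _
  simp_rw [h1]
  rw [Finset.sum_add_distrib, Finset.sum_add_distrib, ← Finset.smul_sum (r := c), h0, smul_zero,
    add_zero, smul_add, empOp_apply, noiseVec]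

lemma bTilde_eq_guard (X : ℕ → Ω → L2 s t) (ε : ℕ → Ω → ℝ) (a : ℝ) (b : L2 s t)
    (θ' : ℕ → Ω → ℕ → ℝ) (φ' : ℕ → Ω → HilbertBasis ℕ ℝ (L2 s t)) {n : ℕ} (hn : n ≠ 0)
    (C₃ C₄ C₅ : ℝ) (m : ℕ) (ω : Ω) :
    bTilde C₃ C₄ C₅ X (response a b X ε) θ' φ' m n ω =
      guard (C₄ * (n : ℝ) ^ C₅) (Lp.const 2 (volume.restrict (Set.Icc s t)) C₃)
        (truncInv (φ' n ω) (θ' n ω) m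
          (empOp n (fun i => X i ω) b + noiseVec n (fun i => X i ω) (fun i => ε i ω))) := by
  have h : bHat X (response a b X ε) θ' φ' m n ω = truncInv (φ' n ω) (θ' n ω) m
      (empOp n (fun i => X i ω) b + noiseVec n (fun i => X i ω) (fun i => ε i ω)) := by
    rw [truncInv_apply, ← gHat_response X ε a b hn, bHat]
  rw [bTilde, guard, h]

variable [MeasurableSpace Ω] {P : Measure Ω} [IsProbabilityMeasure P]

omit [IsProbabilityMeasure P] in
lemma isNoise_of_moments {ε : ℕ → Ω → ℝ} (hεmeas : ∀ i, Measurable (ε i))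
    (hεindep : iIndepFun ε P) (hεident : ∀ i, IdentDistrib (ε i) (ε 0) P P)
    (hε0 : ∫ ω, ε 0 ω ∂P = 0) (hεmom : ∀ k : ℕ, Integrable (fun ω => |ε 0 ω| ^ k) P) :
    IsNoise P ε (∫ ω, ε 0 ω ^ 2 ∂P) (∫ ω, ε 0 ω ^ 4 ∂P) := by
  have hid : ∀ i (q : ℕ), IdentDistrib (fun ω => ε i ω ^ q) (fun ω => ε 0 ω ^ q) P P := fun i q =>
    (hεident i).comp (measurable_id.pow_const q)
  exact
    { measurable := hεmeas
      indep := hεindep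
      integrable := fun i q => (hid i q).integrable_iff.2 <| by
        refine (hεmom q).mono ((hεmeas 0).pow_const q).aestronglyMeasurable (ae_of_all _ fun ω => ?_)
        simp
      mean := fun i => (hεident i).integral_eq.trans hε0
      var := fun i => (hid i 2).integral_eq
      fourth := fun i => (hid i 4).integral_eq }

lemma isSample_of_covOp {X : ℕ → Ω → L2 s t} (hXmeas : ∀ i, Measurable (X i))
    (hXindep : iIndepFun X P) (hXident : ∀ i, IdentDistrib (X i) (X 0) P P)
    (hX2 : MemLp (X 0) 2 P) {θ : ℕ → ℝ} {φ : HilbertBasis ℕ ℝ (L2 s t)} (hθ : ∀ j, 0 < θ j)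
    (hspec : ∀ j, covOp P (X 0) (φ j) = θ j • φ j)
    (hξmom : ∀ r : ℕ, 2 ≤ r → ∃ Cr : ℝ, ∀ j : ℕ,
      Integrable (fun ω => |score P (X 0) φ j ω| ^ (2 * r)) P ∧
        ∫ ω, |score P (X 0) φ j ω| ^ (2 * r) ∂P ≤ Cr * θ j ^ r) :
    IsSample P X (∫ ω, X 0 ω ∂P) φ θ := by
  set μ := ∫ ω, X 0 ω ∂P with hμ
  have hY2 : MemLp (fun ω => X 0 ω - μ) 2 P := hX2.sub (memLp_const μ)
  have hX1 : Integrable (X 0) P := hX2.integrable (by norm_num)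
  have hY1 : Integrable (fun ω => X 0 ω - μ) P := hX1.sub (integrable_const μ)
  have hYsq : Integrable (fun ω => ‖X 0 ω - μ‖ ^ 2) P := hY2.integrable_norm_pow (by norm_num)
  refine ⟨hXmeas, hXindep, hXident, hθ, fun k => ?_, fun l k => ?_, hξmom⟩
  · have h1 : ∀ ω, inner ℝ (X 0 ω - μ) (φ k) = inner ℝ (φ k) (X 0 ω - μ) := fun ω =>
      real_inner_comm _ _
    simp_rw [h1]
    rw [integral_inner hY1, integral_sub hX1 (integrable_const μ), integral_const]
    simp [← hμ]
  · have hint : Integrable (fun ω => inner ℝ (X 0 ω - μ) (φ k) • (X 0 ω - μ)) P := by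
      have hm : AEStronglyMeasurable (fun ω => inner ℝ (X 0 ω - μ) (φ k)) P :=
        hY1.1.inner aestronglyMeasurable_const
      refine hYsq.mono' (hm.smul hY1.1) (ae_of_all _ fun ω => ?_)
      rw [norm_smul, sq]
      refine mul_le_mul_of_nonneg_right ?_ (norm_nonneg _)
      have := norm_inner_le_norm (𝕜 := ℝ) (X 0 ω - μ) (φ k)
      rwa [φ.orthonormal.1, mul_one] at this
    have h1 := integral_inner (𝕜 := ℝ) hint (φ l)
    have h2 : ∫ ω, inner ℝ (X 0 ω - μ) (φ k) • (X 0 ω - μ) ∂P = θ k • φ k := hspec k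
    have h3 : inner ℝ (φ l) (φ k) = if l = k then (1 : ℝ) else 0 :=
      orthonormal_iff_ite.1 φ.orthonormal l k
    rw [h2, real_inner_smul_right, h3] at h1
    rw [mul_ite, mul_one, mul_zero] at h1
    rw [← h1]
    refine integral_congr_ae (ae_of_all _ fun ω => ?_)
    dsimp only
    rw [real_inner_smul_right, real_inner_comm (X 0 ω - μ) (φ l), mul_comm]

end Model

end FLR

end

theorem theorem4p1 {s t : ℝ} (hst : s < t)
    {Ω : Type*} [MeasurableSpace Ω] (P : Measure Ω) [IsProbabilityMeasure P]
    -- the model: i.i.d. random functions, i.i.d. centred errors, independent of each other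
    (X : ℕ → Ω → FLR.L2 s t) (ε : ℕ → Ω → ℝ) (a : ℝ)
    (hXmeas : ∀ i, Measurable (X i)) (hεmeas : ∀ i, Measurable (ε i))
    (hXindep : iIndepFun X P) (hXident : ∀ i, IdentDistrib (X i) (X 0) P P)
    (hX2 : MemLp (X 0) 2 P)
    (hεindep : iIndepFun ε P) (hεident : ∀ i, IdentDistrib (ε i) (ε 0) P P)
    (hε0 : ∫ ω, ε 0 ω ∂P = 0)
    (hXε : IndepFun (fun ω i => X i ω) (fun ω i => ε i ω) P)
    -- all moments of the errors are finite
    (hεmom : ∀ k : ℕ, Integrable (fun ω => |ε 0 ω| ^ k) P)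
    -- spectral decomposition of the covariance
    (θ : ℕ → ℝ) (φ : HilbertBasis ℕ ℝ (FLR.L2 s t))
    (hspec : ∀ j, FLR.covOp P (X 0) (φ j) = θ j • φ j)
    (α β γ C C₁ C₂ C₃ C₄ C₅ : ℝ)
    (hC : 0 < C) (hC₁ : 0 < C₁) (hC₂ : 0 < C₂) (hC₃ : 0 < C₃) (hC₄ : 0 < C₄) (hC₅ : 0 < C₅)
    (hα : 1 < α) (hβ : α + 2 ≤ β) (hγ : 1 / 2 < γ)
    -- size and spacings of the eigenvalues
    (hθlow : ∀ j : ℕ, C⁻¹ * ((j : ℝ) + 1) ^ (-α) ≤ θ j)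
    (hθupp : ∀ j : ℕ, θ j ≤ C * ((j : ℝ) + 1) ^ (-α))
    (hθgap : ∀ j : ℕ, C⁻¹ * ((j : ℝ) + 1) ^ (-α - 1) ≤ θ j - θ (j + 1))
    -- moments of the principal component scores
    (hξmom : ∀ r : ℕ, 2 ≤ r → ∃ Cr : ℝ, ∀ j : ℕ,
      Integrable (fun ω => |FLR.score P (X 0) φ j ω| ^ (2 * r)) P ∧
        ∫ ω, |FLR.score P (X 0) φ j ω| ^ (2 * r) ∂P ≤ Cr * θ j ^ r)
    (hξfour : ∀ J : Fin 4 → ℕ, (∃ k, ∀ l, l ≠ k → J l ≠ J k) →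
      ∫ ω, ∏ k, FLR.score P (X 0) φ (J k) ω ∂P = 0)
    -- the function at which prediction takes place
    (x : FLR.L2 s t) (hx : ∀ j : ℕ, |inner ℝ x (φ j)| ≤ C₂ * ((j : ℝ) + 1) ^ (-γ))
    -- empirical spectral decomposition and cut-off
    (θ' : ℕ → Ω → ℕ → ℝ) (φ' : ℕ → Ω → HilbertBasis ℕ ℝ (FLR.L2 s t))
    (hemp : FLR.IsEmpEigensystem X θ' φ')
    (m : ℕ → ℕ) (hm : (fun n => (m n : ℝ)) =Θ[atTop] FLR.mZero α β γ) :
    ∃ M : ℝ, ∀ᶠ n : ℕ in atTop,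
      (⨆ b ∈ FLR.smoothClass φ C₁ β,
        (∫⁻ ω, ENNReal.ofReal
          ((inner ℝ (FLR.bTilde C₃ C₄ C₅ X (FLR.response a b X ε) θ' φ' (m n) n ω) x
            - inner ℝ b x) ^ 2) ∂P))
      ≤ ENNReal.ofReal (M * FLR.tau α β γ n) := by
  have : Fact ((2 : ℝ≥0∞) ≠ ∞) := ⟨ENNReal.ofNat_ne_top⟩
  have hθpos : ∀ j, 0 < θ j := fun j =>
    lt_of_lt_of_le (mul_pos (inv_pos.2 hC) (Real.rpow_pos_of_pos (by positivity) _)) (hθlow j)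
  have hS := FLR.isSample_of_covOp hXmeas hXindep hXident hX2 hθpos hspec hξmom
  have hN := FLR.isNoise_of_moments hεmeas hεindep hεident hε0 hεmom
  obtain ⟨M, hM⟩ := FLR.exists_risk_bound hS hN hXε hC hC₁ hC₂ hC₄ hC₅ hα hβ hγ hθlow hθupp hθgap x
    hx (Lp.const 2 (volume.restrict (Set.Icc s t)) C₃) φ' θ' hemp.antitone
    (fun n ω j => (FLR.empOp_apply _ _ _).trans (hemp.eigen n ω j)) m hm
  refine ⟨M, ?_⟩
  filter_upwards [hM, eventually_ge_atTop 1] with n hn hn1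
  refine iSup₂_le fun b hb => le_trans (le_of_eq (lintegral_congr fun ω => ?_)) (hn b hb)
  rw [FLR.bTilde_eq_guard X ε a b θ' φ' (by omega)]
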